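/- **Theorem 5.7.** Let $n\ge 1$ be an integer and let $dV$ be Lebesgue measure on $\mathbb C^n$, normalized so that $\int_{\mathbb C^n}e^{-|z|^2}\,dV(z)=1$. For $0<p<\infty$ and real $\alpha$, let $F^p_\alpha$ be the space of entire functions $f$ on $\mathbb C^n$ with $$\|f\|_{F^p_\alpha}=\Big(\int_{\mathbb C^n}\big|f(z)e^{-|z|^2/2}\big|^p\,\frac{dV(z)}{(1+|z|)^\alpha}\Big)^{1/p}<\infty ,$$ and let $F^\infty_\alpha$ be the space of entire functions $f$ with $$\|f\|_{F^\infty_\alpha}=\operatorname*{ess\,sup}_{z\in\mathbb C^n}\frac{|f(z)|e^{-|z|^2/2}}{(1+|z|)^\alpha}<\infty .$$ For real $\gamma$ put $(\psi,\varphi)_\gamma=\int_{\mathbb C^n}\psi(z)\overline{\varphi(z)}\,e^{-|z|^2}|z|^{-\gamma}\,dV(z)$. For an entire function $f$ with homogeneous expansion $f=\sum_{k\ge0}f_k$ and real $s$, put $f_s^-=\sum_{k\le|s|}f_k$ and $f_s^+=f-f_s^-$, and let $$\langle f,g\rangle_\gamma=\begin{cases}(f,g)_\gamma&\text{if }\gamma<2n,\\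 (f_{\gamma/2}^-,g_{\gamma/2}^-)_0+(f_{\gamma/2}^+,g_{\gamma/2}^+)_\gamma&\text{if }\gamma\ge2n.\end{cases}$$ Let $0<p\le1$ and let $\alpha,\beta$ be real numbers. Then $(F^p_{\alpha p})^*=F^\infty_\beta$ with equivalent norms under the pairing $\langle\cdot,\cdot\rangle_{\alpha+\beta}$, that is: 1. for all $f\in F^p_{\alpha p}$ and $g\in F^\infty_\beta$ the integrals defining $\langle f,g\rangle_{\alpha+\beta}$ converge absolutely; 2. the map $g\mapsto\langle\cdot,g\rangle_{\alpha+\beta}$ is a conjugate-linear bijection from $F^\infty_\beta$ onto the space $(F^p_{\alpha p})^*$ of all bounded linear functionals on $F^p_{\alpha p}$ (the linear $\nu$ for which there is a constant $M$ with $|\nu(f)|\le M\|f\|_{F^p_{\alpha p}}$ for all $f$); 3. there are constants $c,C>0$, depending only on $n,p,\alpha,\beta$, such that for all $g\in F^\infty_\beta$ $$c\,\|g\|_{F^\infty_\beta}\le\sup\big\{|\langle f,g\rangle_{\alpha+\beta}|:\ f\in F^p_{\alpha p},\ \|f\|_{F^p_{\alpha p}}\le1\big\}\le C\,\|g\|_{F^\infty_\beta}.$$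 -/

import Mathlib

open MeasureTheory
open scoped ENNReal ComplexConjugate

noncomputable section

namespace FockDuality

/-- `ℂⁿ` with its Hermitian inner product and Euclidean norm. -/
abbrev Cn (n : ℕ) : Type := EuclideanSpace ℂ (Fin n)

/-- Lebesgue measure on `ℂⁿ = ℝ²ⁿ`, normalized so that `∫ e^{-|z|²} dV(z) = 1`. -/
def V (n : ℕ) : Measure (Cn n) := ENNReal.ofReal ((Real.pi ^ n)⁻¹) • volume

/-- `dV_α(z) = dV(z) / (1 + |z|)^α`. -/
def weightedV (n : ℕ) (α : ℝ) : Measure (Cn n) :=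
  (V n).withDensity fun z => ENNReal.ofReal ((1 + ‖z‖) ^ (-α))

/-- `dW_α(z) = dV(z) / |z|^α`. -/
def W (n : ℕ) (α : ℝ) : Measure (Cn n) :=
  (V n).withDensity fun z => ENNReal.ofReal (‖z‖ ^ (-α))

/-- `z ↦ f(z) e^{-|z|²/2}`. -/
def gaussWeighted {n : ℕ} (f : Cn n → ℂ) (z : Cn n) : ℂ :=
  f z * (Real.exp (-‖z‖ ^ 2 / 2) : ℂ)

/-- `z ↦ f(z) e^{-|z|²/2} / (1 + |z|)^α`. -/
def gaussWeightedInf {n : ℕ} (α : ℝ) (f : Cn n → ℂ) (z : Cn n) : ℂ :=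
  gaussWeighted f z * ((1 + ‖z‖) ^ (-α) : ℝ)

/-- The weighted Fock space `F^p_α` for finite exponents `p > 0`: the entire functions `f` with
`∫ |f(z) e^{-|z|²/2}|^p dV_α(z) < ∞`. -/
def FockSpace (n : ℕ) (p α : ℝ) : Submodule ℂ (Cn n → ℂ) where
  carrier := {f | Differentiable ℂ f ∧
    MemLp (gaussWeighted f) (ENNReal.ofReal p) (weightedV n α)}
  zero_mem' := by
    refine ⟨differentiable_const 0, ?_⟩
    have h : gaussWeighted (0 : Cn n → ℂ) = 0 := by
      funext z; simp [gaussWeighted]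
    rw [h]; exact MemLp.zero
  add_mem' := by
    rintro f g ⟨hf, hf'⟩ ⟨hg, hg'⟩
    refine ⟨hf.add hg, ?_⟩
    have h : gaussWeighted (f + g) = gaussWeighted f + gaussWeighted g := by
      funext z; simp [gaussWeighted, add_mul]
    rw [h]; exact hf'.add hg'
  smul_mem' := by
    rintro c f ⟨hf, hf'⟩
    refine ⟨hf.const_smul c, ?_⟩
    have h : gaussWeighted (c • f) = c • gaussWeighted f := by
      funext z; simp [gaussWeighted, mul_assoc]
    rw [h]; exact hf'.const_smul c

/-- The weighted Fock space `F^∞_α`: the entire functions `f` such that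
`|f(z)| e^{-|z|²/2} / (1 + |z|)^α` is essentially bounded. -/
def FockSpaceInf (n : ℕ) (α : ℝ) : Submodule ℂ (Cn n → ℂ) where
  carrier := {f | Differentiable ℂ f ∧ MemLp (gaussWeightedInf α f) ∞ (V n)}
  zero_mem' := by
    refine ⟨differentiable_const 0, ?_⟩
    have h : gaussWeightedInf α (0 : Cn n → ℂ) = 0 := by
      funext z; simp [gaussWeightedInf, gaussWeighted]
    rw [h]; exact MemLp.zero
  add_mem' := by
    rintro f g ⟨hf, hf'⟩ ⟨hg, hg'⟩
    refine ⟨hf.add hg, ?_⟩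
    have h : gaussWeightedInf α (f + g) = gaussWeightedInf α f + gaussWeightedInf α g := by
      funext z; simp [gaussWeightedInf, gaussWeighted, add_mul]
    rw [h]; exact hf'.add hg'
  smul_mem' := by
    rintro c f ⟨hf, hf'⟩
    refine ⟨hf.const_smul c, ?_⟩
    have h : gaussWeightedInf α (c • f) = c • gaussWeightedInf α f := by
      funext z; simp [gaussWeightedInf, gaussWeighted, mul_assoc]
    rw [h]; exact hf'.const_smul c

/-- `‖f‖ = (∫ |f(z) e^{-|z|²/2}|^p dV_α(z))^{1/p}` (a quasi-norm if `p < 1`). -/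
def fockNorm {n : ℕ} {p α : ℝ} (f : FockSpace n p α) : ℝ :=
  (eLpNorm (gaussWeighted (f : Cn n → ℂ)) (ENNReal.ofReal p) (weightedV n α)).toReal

/-- `‖f‖ = ess sup |f(z)| e^{-|z|²/2} / (1 + |z|)^α`. -/
def fockNormInf {n : ℕ} {α : ℝ} (f : FockSpaceInf n α) : ℝ :=
  (eLpNorm (gaussWeightedInf α (f : Cn n → ℂ)) ∞ (V n)).toReal

/-- `fₖ`, the homogeneous part of degree `k` of the Taylor expansion of `f` at the origin:
`fₖ(z) = Dᵏf(0)(z, …, z) / k!`. -/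
def homogPart {n : ℕ} (f : Cn n → ℂ) (k : ℕ) (z : Cn n) : ℂ :=
  (iteratedFDeriv ℂ k f 0 fun _ => z) / (k.factorial : ℂ)

/-- `f_s⁻ = ∑_{k ≤ |s|} fₖ`. -/
def lowPart {n : ℕ} (s : ℝ) (f : Cn n → ℂ) (z : Cn n) : ℂ :=
  ∑ k ∈ Finset.range (⌊|s|⌋₊ + 1), homogPart f k z

/-- `f_s⁺ = f - f_s⁻ = ∑_{k > |s|} fₖ`. -/
def highPart {n : ℕ} (s : ℝ) (f : Cn n → ℂ) (z : Cn n) : ℂ :=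
  f z - lowPart s f z

/-- The integrand `ψ(z) conj(φ(z)) e^{-|z|²}`. -/
def pairIntegrand {n : ℕ} (ψ φ : Cn n → ℂ) (z : Cn n) : ℂ :=
  ψ z * conj (φ z) * (Real.exp (-‖z‖ ^ 2) : ℂ)

/-- `(ψ, φ)_α = ∫ ψ(z) conj(φ(z)) e^{-|z|²} dW_α(z)`. -/
def rawPairing {n : ℕ} (α : ℝ) (ψ φ : Cn n → ℂ) : ℂ :=
  ∫ z, pairIntegrand ψ φ z ∂(W n α)

open Classical in
/-- `⟨f, g⟩_α`, equal to `(f, g)_α` if `α < 2n` and to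
`(f⁻, g⁻)_0 + (f⁺, g⁺)_α` (parts taken at `α / 2`) if `α ≥ 2n`. -/
def pairing {n : ℕ} (α : ℝ) (f g : Cn n → ℂ) : ℂ :=
  if α < 2 * (n : ℝ) then rawPairing α f g
  else rawPairing 0 (lowPart (α / 2) f) (lowPart (α / 2) g)
    + rawPairing α (highPart (α / 2) f) (highPart (α / 2) g)

/-- All integrals in the definition of `⟨f, g⟩_α` converge absolutely. -/
def PairingConverges {n : ℕ} (α : ℝ) (f g : Cn n → ℂ) : Prop :=
  (α < 2 * (n : ℝ) → Integrable (pairIntegrand f g) (W n α)) ∧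
  (2 * (n : ℝ) ≤ α →
    Integrable (pairIntegrand (lowPart (α / 2) f) (lowPart (α / 2) g)) (W n 0) ∧
    Integrable (pairIntegrand (highPart (α / 2) f) (highPart (α / 2) g)) (W n α))

/-- The dual space `(F^p_α)^*`: the linear functionals `ν` on `F^p_α` that are bounded, that is,
`|ν(f)| ≤ C ‖f‖` for some constant `C` and all `f`. -/
def FockDual (n : ℕ) (p α : ℝ) : Submodule ℂ (FockSpace n p α →ₗ[ℂ] ℂ) where
  carrier := {ν | ∃ C : ℝ, ∀ f, ‖ν f‖ ≤ C * fockNorm f}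
  zero_mem' := ⟨0, fun f => by simp⟩
  add_mem' := by
    rintro ν μ ⟨C, hC⟩ ⟨D, hD⟩
    refine ⟨C + D, fun f => ?_⟩
    rw [LinearMap.add_apply, add_mul]
    exact (norm_add_le _ _).trans (add_le_add (hC f) (hD f))
  smul_mem' := by
    rintro c ν ⟨C, hC⟩
    refine ⟨‖c‖ * C, fun f => ?_⟩
    rw [LinearMap.smul_apply, norm_smul, mul_assoc]
    exact mul_le_mul_of_nonneg_left (hC f) (norm_nonneg c)

/-- `‖ν‖ = sup {|ν(f)| : ‖f‖ ≤ 1}`. -/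
def dualNorm {n : ℕ} {p α : ℝ} (ν : FockDual n p α) : ℝ :=
  sSup {x : ℝ | ∃ f : FockSpace n p α, fockNorm f ≤ 1 ∧ x = ‖ν.1 f‖}

end FockDuality

end

/-! The pairing is diagonal in the homogeneous degree. Write γ = α + β. Integrating first over
circles and then radially, the pairing of ⟨·, w⟩ᵏ/k! with g is m_k · conj g_k(w). Here m_k = 1 in
the low degrees that the pairing treats separately, and m_k = Γ(k + n - γ/2)/Γ(k + n) in the others
(`pairing_kernelPart`). The low degrees are exactly split off so that these Gamma values are
positive radial moments. Hence a bounded functional ν has only one candidate g, with g_k(w) = m_k⁻¹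
· conj ν(⟨·, w⟩ᵏ/k!).

The main point is the size of this g. The kernel K_w = e^{⟨·, w⟩} has Fock norm at most a constant
times e^{|w|²/2}(1 + |w|)^{-α} (`exists_fockNorm_kernel_le`), so on each complex line through 0 the
power series with coefficients conj ν(⟨·, w⟩ᵏ/k!) has growth exponent -α. The multiplier m_k⁻¹
behaves like k^{γ/2}. A series of size e^{|λ|²/2} is concentrated at degrees k ≈ |λ|², so k^{γ/2}
should act like |λ|^γ and turn the exponent -α into β. This is `exists_hasGrowth_gammaMultiplier`.
Gamma quotients that decay are Beta averages of F(tλ), which gain two powers of |λ| for each power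
of k; quotients that grow are reduced to these by the operators λF' + bF, which cost two powers each
by Cauchy's estimate on discs of radius 1/(1 + |λ|).

The same estimate applied to ν = ⟨·, g⟩ returns g itself, which gives the lower norm bound. The
upper bound uses p ≤ 1: subharmonicity of |F|^p bounds f pointwise by its norm, hence F^p embeds in
F^1, and f can be integrated against the supremum bound of g (`exists_norm_pairing_le`).

It remains to see that ν and ⟨·, g⟩, which agree on the homogeneous kernels, agree everywhere
(`eq_zero_of_kernelCoeff`). By the reproducing formula, ν(f_k) is an integral of the values of ν on
homogeneous kernels. The Taylor sums of a dilate f(r·), r < 1, converge geometrically in the Fock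
norm, and the dilates tend to f in F^p by a version of Pratt's lemma. Taylor expansions on ℂⁿ are
themselves obtained by expanding the kernel in the reproducing formula. -/

noncomputable section

namespace FockDuality

open Real Filter Topology

/-! ### Elementary growth inequalities -/

/-- The growth function `x ↦ e^{x²/2} (1 + x)^β`. -/
def growth (β x : ℝ) : ℝ := Real.exp (x ^ 2 / 2) * (1 + x) ^ β

lemma growth_pos {β x : ℝ} (hx : 0 ≤ x) : 0 < growth β x := by
  unfold growth; positivity

lemma growth_add {β s x : ℝ} (hx : 0 ≤ x) : growth (β + s) x = growth β x * (1 + x) ^ s := by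
  unfold growth; rw [rpow_add (by positivity), mul_assoc]

/-- Polynomial growth is dominated by a Gaussian. -/
lemma exists_one_add_rpow_le_exp (s : ℝ) {ε : ℝ} (hε : 0 < ε) :
    ∃ C : ℝ, 0 < C ∧ ∀ x : ℝ, 0 ≤ x → (1 + x) ^ s ≤ C * Real.exp (ε * x ^ 2) := by
  -- After log(1 + x) ≤ x, the number s²/(4ε) is the maximum of |s|x - εx²; the summand |s| is
  -- slack.
  refine ⟨Real.exp (s ^ 2 / (4 * ε) + |s|), Real.exp_pos _, fun x hx => ?_⟩
  rw [← Real.exp_add, rpow_def_of_pos (by positivity), Real.exp_le_exp]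
  have h1 : Real.log (1 + x) ≤ x := by
    have := Real.log_le_sub_one_of_pos (show 0 < 1 + x by positivity); linarith
  have h0 : 0 ≤ Real.log (1 + x) := Real.log_nonneg (by linarith)
  have h2 : Real.log (1 + x) * s ≤ x * |s| := by
    calc _ ≤ Real.log (1 + x) * |s| := mul_le_mul_of_nonneg_left (le_abs_self s) h0
      _ ≤ _ := mul_le_mul_of_nonneg_right h1 (abs_nonneg s)
  have h3 : x * |s| ≤ s ^ 2 / (4 * ε) + ε * x ^ 2 := by
    rw [← sub_nonneg]
    have : s ^ 2 / (4 * ε) + ε * x ^ 2 - x * |s| = (2 * ε * x - |s|) ^ 2 / (4 * ε) := by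
      field_simp
      rw [← sq_abs s]; ring
    rw [this]; positivity
  have := abs_nonneg s
  linarith

/-- Peetre's inequality. -/
lemma one_add_rpow_le_mul {x y d : ℝ} (s : ℝ) (hx : 0 ≤ x) (hy : 0 ≤ y) (hd : |x - y| ≤ d) :
    (1 + x) ^ s ≤ (1 + y) ^ s * (1 + d) ^ |s| := by
  have hd0 : 0 ≤ d := (abs_nonneg _).trans hd
  obtain ⟨h1, h2⟩ := abs_le.mp hd
  rcases le_total 0 s with hs | hs
  · rw [abs_of_nonneg hs, ← mul_rpow (by positivity) (by positivity)]
    refine rpow_le_rpow (by positivity) ?_ hs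
    nlinarith [mul_nonneg hy hd0]
  · rw [abs_of_nonpos hs, rpow_neg (by positivity), ← div_eq_mul_inv,
      ← div_rpow (by positivity) (by positivity)]
    refine rpow_le_rpow_of_nonpos (by positivity) ?_ hs
    rw [div_le_iff₀ (by positivity)]
    nlinarith [mul_nonneg hx hd0]

/-- A subcritical Gaussian leaves room for any power of 1 + x. It is applied with ρ = 0, where it
says that polynomials lie below every growth function, whatever the sign of β. -/
lemma exists_growth_le (β : ℝ) (s : ℝ) {ρ : ℝ} (hρ : ρ < 1) :
    ∃ C : ℝ, 0 < C ∧ ∀ x : ℝ, 0 ≤ x →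
      Real.exp (ρ * x ^ 2 / 2) * (1 + x) ^ s ≤ C * growth β x := by
  obtain ⟨C, hC, h⟩ := exists_one_add_rpow_le_exp (s - β) (ε := (1 - ρ) / 2) (by linarith)
  refine ⟨C, hC, fun x hx => ?_⟩
  have h2 : (1 + x) ^ s = (1 + x) ^ (s - β) * (1 + x) ^ β := by
    rw [← rpow_add (by positivity)]; simp
  have h3 : Real.exp (x ^ 2 / 2) = Real.exp ((1 - ρ) / 2 * x ^ 2) * Real.exp (ρ * x ^ 2 / 2) := by
    rw [← Real.exp_add]; ring_nf
  rw [h2, growth, h3]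
  have := mul_le_mul_of_nonneg_left (h x hx)
    (show 0 ≤ Real.exp (ρ * x ^ 2 / 2) * (1 + x) ^ β by positivity)
  linarith

/-! ### Fourier coefficients on the unit circle -/

lemma integral_exp_int_mul_I (m : ℤ) :
    ∫ θ in (0 : ℝ)..2 * π, Complex.exp (m * θ * Complex.I) = if m = 0 then (2 * π : ℂ) else 0 := by
  split_ifs with h
  · simp [h]
  · have hc : (m * Complex.I : ℂ) ≠ 0 := by simp [h]
    have := integral_exp_mul_complex (a := 0) (b := 2 * π) hc
    simp_rw [show ∀ θ : ℝ, (m * θ * Complex.I : ℂ) = m * Complex.I * θ from fun θ => by ring]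
    rw [this]
    have h2 : (m * Complex.I * ((2 * π : ℝ) : ℂ)) = m * (2 * π * Complex.I) := by push_cast; ring
    rw [h2, Complex.exp_int_mul_two_pi_mul_I]
    simp

/-- The Fourier coefficients of a power series on the unit circle. -/
lemma circleAverage_conj_pow_mul {a : ℕ → ℂ} {F : ℂ → ℂ} (ha : Summable fun k => ‖a k‖)
    (hF : ∀ l : ℂ, ‖l‖ = 1 → HasSum (fun k => a k * l ^ k) (F l)) (k : ℕ) :
    Real.circleAverage (fun l => conj l ^ k * F l) 0 1 = a k := by
  rw [Real.circleAverage_def]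
  have hn : ∀ θ : ℝ, ‖circleMap 0 1 θ‖ = 1 := fun θ => by simp
  have key : HasSum (fun j => ∫ θ in (0 : ℝ)..2 * π,
        conj (circleMap 0 1 θ) ^ k * (a j * circleMap 0 1 θ ^ j))
      (∫ θ in (0 : ℝ)..2 * π, conj (circleMap 0 1 θ) ^ k * F (circleMap 0 1 θ)) := by
    refine intervalIntegral.hasSum_integral_of_dominated_convergence (fun j _ => ‖a j‖) ?_ ?_ ?_ ?_ ?_
    · intro j
      refine Continuous.aestronglyMeasurable ?_
      have := continuous_circleMap 0 1
      fun_prop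
    · intro j
      refine ae_of_all _ fun θ _ => ?_
      simp [hn]
    · exact ae_of_all _ fun θ _ => ha
    · exact intervalIntegrable_const
    · exact ae_of_all _ fun θ _ => (hF _ (hn θ)).mul_left _
  have hj : ∀ j, ∫ θ in (0 : ℝ)..2 * π, conj (circleMap 0 1 θ) ^ k * (a j * circleMap 0 1 θ ^ j)
      = if j = k then (2 * π : ℂ) * a k else 0 := by
    intro j
    have : ∀ θ : ℝ, conj (circleMap 0 1 θ) ^ k * (a j * circleMap 0 1 θ ^ j)
        = a j * Complex.exp (((j - k : ℤ) : ℂ) * θ * Complex.I) := by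
      intro θ
      rw [circleMap, zero_add, Complex.ofReal_one, one_mul, ← Complex.exp_conj, ← Complex.exp_nat_mul,
        ← Complex.exp_nat_mul, mul_left_comm, ← Complex.exp_add]
      congr 2
      simp
      ring
    simp_rw [this]
    rw [intervalIntegral.integral_const_mul, integral_exp_int_mul_I]
    by_cases hjk : j = k
    · simp [hjk, mul_comm]
    · have : (j : ℤ) - k ≠ 0 := by omega
      simp [hjk, this]
  simp_rw [hj] at key
  have h2 := (hasSum_ite_eq k ((2 * π : ℂ) * a k)).unique key
  rw [← h2]
  have hpi : (π : ℂ) ≠ 0 := by exact_mod_cast Real.pi_ne_zero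
  simp only [Complex.real_smul]
  push_cast
  field_simp

lemma norm_circleAverage_le {f : ℂ → ℂ} {M : ℝ}
    (h : ∀ l : ℂ, ‖l‖ = 1 → ‖f l‖ ≤ M) : ‖Real.circleAverage f 0 1‖ ≤ M := by
  rw [Real.circleAverage_def, norm_smul]
  have := intervalIntegral.norm_integral_le_of_norm_le_const (a := 0) (b := 2 * π) (C := M)
    (f := fun θ => f (circleMap 0 1 θ)) (fun θ _ => h _ (by simp))
  have hpi := Real.pi_pos
  rw [sub_zero, abs_of_pos (by positivity)] at this
  rw [Real.norm_of_nonneg (by positivity)]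
  calc _ ≤ (2 * π)⁻¹ * (M * (2 * π)) := mul_le_mul_of_nonneg_left this (by positivity)
    _ = M := by field_simp

lemma norm_coeff_le {a : ℕ → ℂ} {F : ℂ → ℂ} {M : ℝ} (ha : Summable fun k => ‖a k‖)
    (hF : ∀ l : ℂ, ‖l‖ = 1 → HasSum (fun k => a k * l ^ k) (F l))
    (hM : ∀ l : ℂ, ‖l‖ = 1 → ‖F l‖ ≤ M) (k : ℕ) : ‖a k‖ ≤ M := by
  rw [← circleAverage_conj_pow_mul ha hF k]
  exact norm_circleAverage_le fun l hl => by simpa [hl] using hM l hl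

/-! ### One-variable power series of Gaussian growth -/

/-- The power series `∑ aₖ λᵏ` is entire and bounded by `M e^{|λ|²/2} (1 + |λ|)^β`. -/
structure HasGrowth (a : ℕ → ℂ) (β M : ℝ) : Prop where
  summable : ∀ r : ℝ, 0 ≤ r → Summable fun k => ‖a k‖ * r ^ k
  bound : ∀ l : ℂ, ‖∑' k, a k * l ^ k‖ ≤ M * growth β ‖l‖

namespace HasGrowth
variable {a : ℕ → ℂ} {β M : ℝ}

lemma nonneg (h : HasGrowth a β M) : 0 ≤ M := by
  have := (norm_nonneg _).trans (h.bound 0)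
  exact nonneg_of_mul_nonneg_left this (growth_pos (norm_nonneg _))

lemma hasSum (h : HasGrowth a β M) (l : ℂ) :
    HasSum (fun k => a k * l ^ k) (∑' k, a k * l ^ k) := by
  refine (Summable.of_norm ?_).hasSum
  simpa [norm_mul, norm_pow] using h.summable ‖l‖ (norm_nonneg l)

/-- Cauchy's estimate on the circle of radius `r`, reduced to the unit circle by rescaling the
coefficients. -/
lemma norm_coeff_mul_pow_le (h : HasGrowth a β M) (k : ℕ) {r : ℝ} (hr : 0 ≤ r) :
    ‖a k‖ * r ^ k ≤ M * growth β r := by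
  have := norm_coeff_le (a := fun k => a k * (r : ℂ) ^ k) (F := fun l => ∑' k, a k * (r * l) ^ k)
    (M := M * growth β r) ?_ ?_ ?_ k
  · simpa [abs_of_nonneg hr] using this
  · simpa [abs_of_nonneg hr] using h.summable r hr
  · intro l _
    simpa [mul_pow, mul_assoc] using h.hasSum (r * l)
  · intro l hl
    simpa [hl, abs_of_nonneg hr] using h.bound (r * l)

lemma differentiable (h : HasGrowth a β M) : Differentiable ℂ fun l : ℂ => ∑' k, a k * l ^ k := by
  intro l
  have := Complex.differentiableOn_tsum_of_summable_norm (U := Metric.ball (0 : ℂ) (‖l‖ + 1))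
    (F := fun k l => a k * l ^ k) (h.summable (‖l‖ + 1) (by positivity))
    (fun i => by fun_prop) Metric.isOpen_ball (fun i w hw => by
      rw [norm_mul, norm_pow]
      have : ‖w‖ ≤ ‖l‖ + 1 := by simpa using (mem_ball_zero_iff.mp hw).le
      gcongr)
  exact this.differentiableAt (Metric.isOpen_ball.mem_nhds (by simp))

lemma hasSum_deriv (h : HasGrowth a β M) (l : ℂ) :
    HasSum (fun k : ℕ => (k : ℂ) * a k * l ^ k) (l * deriv (fun l : ℂ => ∑' k, a k * l ^ k) l) := by
  have := Complex.hasSum_deriv_of_summable_norm (U := Metric.ball (0 : ℂ) (‖l‖ + 1)) (z := l)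
    (F := fun k l => a k * l ^ k) (h.summable (‖l‖ + 1) (by positivity))
    (fun i => by fun_prop) Metric.isOpen_ball (fun i w hw => by
      rw [norm_mul, norm_pow]
      have : ‖w‖ ≤ ‖l‖ + 1 := by simpa using (mem_ball_zero_iff.mp hw).le
      gcongr) (by simp)
  refine (this.mul_left l).congr_fun fun k => ?_
  rw [deriv_const_mul _ (by fun_prop)]
  rcases k with _ | k
  · simp
  · rw [deriv_pow_field, Nat.add_sub_cancel]; ring

/-- Cauchy's estimate on the disc of radius 1/(1 + |l|). There |w|² ≤ |l|² + 3, so the Gaussian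
changes by at most e^{3/2}, and Peetre's inequality with distance 1 gives 2^|β|. Differentiation
thus costs a single factor 1 + |l|. -/
lemma norm_deriv_le (h : HasGrowth a β M) (l : ℂ) :
    ‖deriv (fun l : ℂ => ∑' k, a k * l ^ k) l‖ ≤
      M * (Real.exp (3 / 2) * 2 ^ |β|) * (growth β ‖l‖ * (1 + ‖l‖)) := by
  have hr : 0 < (1 + ‖l‖)⁻¹ := by positivity
  have := Complex.norm_deriv_le_of_forall_mem_sphere_norm_le hr
    (f := fun l : ℂ => ∑' k, a k * l ^ k) (c := l)
    (C := M * (Real.exp (3 / 2) * 2 ^ |β|) * growth β ‖l‖)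
    h.differentiable.diffContOnCl ?_
  · rw [div_inv_eq_mul] at this
    linarith
  intro w hw
  have hwl : ‖w - l‖ = (1 + ‖l‖)⁻¹ := by simpa using hw
  have hd1 : (1 + ‖l‖)⁻¹ ≤ 1 := inv_le_one_of_one_le₀ (by linarith [norm_nonneg l])
  have hd2 : (1 + ‖l‖)⁻¹ * ‖l‖ ≤ 1 := by
    rw [inv_mul_le_iff₀ (by positivity)]; linarith
  have h1 : |‖w‖ - ‖l‖| ≤ 1 := (abs_norm_sub_norm_le w l).trans (hwl.trans_le hd1)
  have h2 := one_add_rpow_le_mul β (norm_nonneg w) (norm_nonneg l) h1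
  have h3 : ‖w‖ ≤ ‖l‖ + (1 + ‖l‖)⁻¹ := by
    have := norm_le_norm_add_norm_sub' w l; linarith
  have h4 : ‖w‖ ^ 2 / 2 ≤ 3 / 2 + ‖l‖ ^ 2 / 2 := by
    have h5 : ‖w‖ ^ 2 ≤ (‖l‖ + (1 + ‖l‖)⁻¹) ^ 2 := by gcongr
    nlinarith
  have hM := h.nonneg
  refine (h.bound w).trans ?_
  have h5 : growth β ‖w‖ ≤ Real.exp (3 / 2) * 2 ^ |β| * growth β ‖l‖ := by
    unfold growth
    calc _ ≤ Real.exp (3 / 2 + ‖l‖ ^ 2 / 2) * ((1 + ‖l‖) ^ β * (1 + 1) ^ |β|) := by gcongr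
      _ = _ := by rw [Real.exp_add]; norm_num; ring
  calc _ ≤ M * (Real.exp (3 / 2) * 2 ^ |β| * growth β ‖l‖) := by gcongr
    _ = _ := by ring

/-- Multiplication of the coefficients by `k + b`, that is, the operator `λ F' + b F`. -/
lemma add_const_mul (h : HasGrowth a β M) (b : ℝ) :
    HasGrowth (fun k => ((k + b : ℝ) : ℂ) * a k) (β + 2)
      ((Real.exp (3 / 2) * 2 ^ |β| + |b|) * M) := by
  constructor
  · intro r hr
    have h1 : Summable fun k : ℕ => (k : ℝ) * (‖a k‖ * r ^ k) := by
      -- The factor k ≤ 2ᵏ is paid for by summability at twice the radius.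
      have h2 := h.summable (2 * r) (by positivity)
      refine Summable.of_nonneg_of_le (fun k => by positivity) (fun k => ?_) h2
      have : (k : ℝ) ≤ 2 ^ k := by exact_mod_cast Nat.lt_two_pow_self.le
      calc _ ≤ 2 ^ k * (‖a k‖ * r ^ k) := by gcongr
        _ = _ := by rw [mul_pow]; ring
    have h2 := h1.add ((h.summable r hr).mul_left |b|)
    refine Summable.of_nonneg_of_le (fun k => by positivity) (fun k => ?_) h2
    rw [norm_mul, Complex.norm_real, Real.norm_eq_abs]
    calc _ ≤ ((k : ℝ) + |b|) * ‖a k‖ * r ^ k := by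
          gcongr
          exact (abs_add_le _ _).trans (by simp)
      _ = _ := by ring
  · intro l
    have h1 := (h.hasSum_deriv l).add ((h.hasSum l).mul_left (b : ℂ))
    have h2 : ∑' k : ℕ, ((k + b : ℝ) : ℂ) * a k * l ^ k
        = l * deriv (fun l : ℂ => ∑' k, a k * l ^ k) l + b * ∑' k, a k * l ^ k := by
      rw [← h1.tsum_eq]
      congr 1; funext k; push_cast; ring
    rw [h2]
    have hM := h.nonneg
    have hg := growth_pos (β := β) (norm_nonneg l)
    have hl := norm_nonneg l
    have h3 : growth (β + 2) ‖l‖ = growth β ‖l‖ * (1 + ‖l‖) ^ 2 := by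
      rw [growth_add hl]; norm_num
    rw [h3]
    refine (norm_add_le _ _).trans ?_
    rw [norm_mul, norm_mul, Complex.norm_real, Real.norm_eq_abs]
    have h4 := mul_le_mul_of_nonneg_left (h.norm_deriv_le l) hl
    have h5 := mul_le_mul_of_nonneg_left (h.bound l) (abs_nonneg b)
    -- The derivative and the multiplication by `l` cost one power of 1 + |l| each, whence the
    -- exponent β + 2.
    have h6 : ‖l‖ * (1 + ‖l‖) ≤ (1 + ‖l‖) ^ 2 := by nlinarith
    have h7 : (1 : ℝ) ≤ (1 + ‖l‖) ^ 2 := by nlinarith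
    have h8 := mul_le_mul_of_nonneg_left h6
      (show 0 ≤ M * (Real.exp (3 / 2) * 2 ^ |β|) * growth β ‖l‖ by positivity)
    have h9 := mul_le_mul_of_nonneg_left h7 (show 0 ≤ |b| * (M * growth β ‖l‖) by positivity)
    linarith

end HasGrowth

/-! ### Beta integrals and Gamma multipliers -/

lemma integrableOn_rpow_Ioo {A : ℝ} (hA : 0 < A) :
    IntegrableOn (fun t : ℝ => t ^ (A - 1)) (Set.Ioo 0 1) := by
  have := intervalIntegral.intervalIntegrable_rpow' (a := 0) (b := 1) (r := A - 1) (by linarith)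
  rw [intervalIntegrable_iff_integrableOn_Ioo_of_le zero_le_one] at this
  exact this

lemma integral_Ioo_rpow {A : ℝ} (hA : 0 < A) :
    ∫ t in Set.Ioo (0 : ℝ) 1, t ^ (A - 1) = 1 / A := by
  rw [← integral_Ioc_eq_integral_Ioo, ← intervalIntegral.integral_of_le zero_le_one,
    integral_rpow (Or.inl (by linarith))]
  simp [hA.ne']

lemma integrableOn_one_sub_rpow_Ioo {s : ℝ} (hs : 0 < s) :
    IntegrableOn (fun t : ℝ => (1 - t) ^ (s - 1)) (Set.Ioo 0 1) := by
  have := (intervalIntegral.intervalIntegrable_rpow' (a := 0) (b := 1) (r := s - 1)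
    (by linarith)).comp_sub_left 1
  simp only [sub_zero, sub_self] at this
  rw [← intervalIntegrable_iff_integrableOn_Ioo_of_le zero_le_one]
  exact this.symm

/-- Splitting of the beta density at `t = 1/2`. -/
lemma beta_density_le (A s : ℝ) {t : ℝ} (ht0 : 0 < t) (ht1 : t < 1) :
    t ^ (A - 1) * (1 - t) ^ (s - 1) ≤
      2 ^ |A - 1| * (1 - t) ^ (s - 1) ∧ 1 / 2 ≤ t ∨
    t ^ (A - 1) * (1 - t) ^ (s - 1) ≤
      2 ^ |s - 1| * t ^ (A - 1) ∧ t ≤ 1 / 2 := by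
  have key : ∀ (c u : ℝ), 1 / 2 ≤ u → u < 1 → u ^ c ≤ 2 ^ |c| := by
    intro c u hu hu1
    have hu0 : 0 < u := by linarith
    rcases le_total 0 c with hc | hc
    · exact (rpow_le_one hu0.le hu1.le hc).trans (one_le_rpow (by norm_num) (abs_nonneg _))
    · rw [abs_of_nonpos hc, rpow_neg (by norm_num), ← inv_rpow (by norm_num)]
      exact rpow_le_rpow_of_nonpos (by norm_num) (by linarith) hc
  have h1t : 0 < 1 - t := by linarith
  rcases le_total (1 / 2) t with h | h
  · left
    exact ⟨mul_le_mul_of_nonneg_right (key _ _ h ht1) (by positivity), h⟩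
  · right
    refine ⟨?_, h⟩
    rw [mul_comm]
    exact mul_le_mul_of_nonneg_right (key _ _ (by linarith) (by linarith)) (by positivity)

lemma integrableOn_beta {A s : ℝ} (hA : 0 < A) (hs : 0 < s) :
    IntegrableOn (fun t : ℝ => t ^ (A - 1) * (1 - t) ^ (s - 1)) (Set.Ioo 0 1) := by
  have h := ((integrableOn_one_sub_rpow_Ioo hs).const_mul (2 ^ |A - 1|)).add
    ((integrableOn_rpow_Ioo hA).const_mul (2 ^ |s - 1|))
  refine Integrable.mono' h (Measurable.aestronglyMeasurable (by fun_prop)) ?_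
  refine (ae_restrict_iff' measurableSet_Ioo).mpr (ae_of_all _ fun t ht => ?_)
  have h1 : 0 < 1 - t := by linarith [ht.2]
  have h0 := ht.1
  rw [Real.norm_of_nonneg (by positivity)]
  simp only [Pi.add_apply]
  rcases beta_density_le A s ht.1 ht.2 with h | h
  · refine h.1.trans (le_add_of_nonneg_right (by positivity))
  · refine h.1.trans (le_add_of_nonneg_left (by positivity))

lemma integral_beta {A s : ℝ} (hA : 0 < A) (hs : 0 < s) :
    ∫ t in Set.Ioo (0 : ℝ) 1, t ^ (A - 1) * (1 - t) ^ (s - 1)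
      = Real.Gamma A * Real.Gamma s / Real.Gamma (A + s) := by
  have h := Complex.betaIntegral_eq_Gamma_mul_div (A : ℂ) s (by simpa) (by simpa)
  rw [Complex.betaIntegral, intervalIntegral.integral_of_le zero_le_one,
    integral_Ioc_eq_integral_Ioo, ← Complex.ofReal_add, Complex.Gamma_ofReal, Complex.Gamma_ofReal,
    Complex.Gamma_ofReal] at h
  have h2 : ∫ t in Set.Ioo (0 : ℝ) 1, (t : ℂ) ^ ((A : ℂ) - 1) * (1 - (t : ℂ)) ^ ((s : ℂ) - 1)
      = ∫ t in Set.Ioo (0 : ℝ) 1, ((t ^ (A - 1) * (1 - t) ^ (s - 1) : ℝ) : ℂ) := by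
    refine setIntegral_congr_fun measurableSet_Ioo fun t ht => ?_
    have h1 : 0 ≤ 1 - t := by linarith [ht.2]
    rw [Complex.ofReal_mul, Complex.ofReal_cpow ht.1.le, Complex.ofReal_cpow h1]
    push_cast; rfl
  rw [h2, integral_complex_ofReal] at h
  exact_mod_cast h

/-- `∫₀¹ (1 - t)^{s-1} e^{-(1-t)x²/4} dt = O((1 + x)^{-2s})`. -/
lemma exists_integral_one_sub_rpow_exp_le {s : ℝ} (hs : 0 < s) :
    ∃ C : ℝ, 0 < C ∧ ∀ x : ℝ, 0 ≤ x →
      IntegrableOn (fun t : ℝ => (1 - t) ^ (s - 1) * Real.exp (-(1 - t) * x ^ 2 / 4)) (Set.Ioo 0 1) ∧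
      ∫ t in Set.Ioo (0 : ℝ) 1, (1 - t) ^ (s - 1) * Real.exp (-(1 - t) * x ^ 2 / 4)
        ≤ C * (1 + x) ^ (-(2 * s)) := by
  have hG := Real.Gamma_pos_of_pos hs
  refine ⟨2 ^ (2 * s) * (1 / s) + 16 ^ s * Real.Gamma s, by positivity, fun x hx => ?_⟩
  have hint : IntegrableOn (fun t : ℝ => (1 - t) ^ (s - 1) * Real.exp (-(1 - t) * x ^ 2 / 4))
      (Set.Ioo 0 1) := by
    refine Integrable.mono' (integrableOn_one_sub_rpow_Ioo hs)
      (Measurable.aestronglyMeasurable (by fun_prop)) ?_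
    refine (ae_restrict_iff' measurableSet_Ioo).mpr (ae_of_all _ fun t ht => ?_)
    have h1 : 0 < 1 - t := by linarith [ht.2]
    rw [Real.norm_of_nonneg (by positivity)]
    refine mul_le_of_le_one_right (by positivity) (Real.exp_le_one_iff.mpr ?_)
    have : 0 ≤ (1 - t) * x ^ 2 / 4 := by positivity
    linarith
  refine ⟨hint, ?_⟩
  have hflip : ∫ t in Set.Ioo (0 : ℝ) 1, (1 - t) ^ (s - 1) * Real.exp (-(1 - t) * x ^ 2 / 4)
      = ∫ t in Set.Ioo (0 : ℝ) 1, t ^ (s - 1) * Real.exp (-t * x ^ 2 / 4) := by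
    rw [← integral_Ioc_eq_integral_Ioo, ← integral_Ioc_eq_integral_Ioo,
      ← intervalIntegral.integral_of_le zero_le_one, ← intervalIntegral.integral_of_le zero_le_one,
      intervalIntegral.integral_comp_sub_left
        (fun t : ℝ => t ^ (s - 1) * Real.exp (-t * x ^ 2 / 4)) 1]
    simp
  rw [hflip]
  -- For x ≤ 1 the exponential is dropped. For x ≥ 1 the integral is extended to (0, ∞), where it
  -- equals (4/x²)^s Γ(s), and 1 + x ≤ 2x gives the factor 16^s.
  rcases le_total x 1 with hx1 | hx1
  · have h1 : ∫ t in Set.Ioo (0 : ℝ) 1, t ^ (s - 1) * Real.exp (-t * x ^ 2 / 4) ≤ 1 / s := by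
      rw [← integral_Ioo_rpow hs]
      refine integral_mono_of_nonneg ?_ (integrableOn_rpow_Ioo hs) ?_
      · refine (ae_restrict_iff' measurableSet_Ioo).mpr (ae_of_all _ fun t ht => ?_)
        have := ht.1
        simp only [Pi.zero_apply]; positivity
      · refine (ae_restrict_iff' measurableSet_Ioo).mpr (ae_of_all _ fun t ht => ?_)
        have := ht.1
        refine mul_le_of_le_one_right (by positivity) (Real.exp_le_one_iff.mpr ?_)
        have : 0 ≤ t * x ^ 2 / 4 := by positivity
        linarith
    have h2 : (1 : ℝ) ≤ 2 ^ (2 * s) * (1 + x) ^ (-(2 * s)) := by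
      rw [rpow_neg (by positivity), ← div_eq_mul_inv, ← div_rpow (by positivity) (by positivity)]
      refine one_le_rpow ?_ (by positivity)
      rw [le_div_iff₀ (by positivity)]; linarith
    have h3 : 0 < (1 + x) ^ (-(2 * s)) := by positivity
    calc _ ≤ 1 / s := h1
      _ ≤ (2 ^ (2 * s) * (1 + x) ^ (-(2 * s))) * (1 / s) := le_mul_of_one_le_left (by positivity) h2
      _ ≤ _ := by
        have : 0 ≤ 16 ^ s * Real.Gamma s * (1 + x) ^ (-(2 * s)) := by positivity
        linarith
  · have hx0 : 0 < x := by linarith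
    have hb : 0 < x ^ 2 / 4 := by positivity
    have h1 := Real.integral_rpow_mul_exp_neg_mul_Ioi hs hb
    have hpos : 0 < (1 / (x ^ 2 / 4)) ^ s * Real.Gamma s := by positivity
    -- A non-integrable function would have integral 0, but the value found is positive.
    have hi : IntegrableOn (fun t : ℝ => t ^ (s - 1) * Real.exp (-(x ^ 2 / 4 * t))) (Set.Ioi 0) := by
      by_contra hcon
      rw [integral_undef hcon] at h1
      exact hpos.ne h1
    have h2 : ∫ t in Set.Ioo (0 : ℝ) 1, t ^ (s - 1) * Real.exp (-t * x ^ 2 / 4)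
        ≤ (1 / (x ^ 2 / 4)) ^ s * Real.Gamma s := by
      rw [← h1]
      simp_rw [show ∀ t : ℝ, -t * x ^ 2 / 4 = -(x ^ 2 / 4 * t) from fun t => by ring]
      refine setIntegral_mono_set hi ?_ (LE.le.eventuallyLE fun t ht => ht.1)
      refine (ae_restrict_iff' measurableSet_Ioi).mpr (ae_of_all _ fun t (ht : 0 < t) => ?_)
      simp only [Pi.zero_apply]; positivity
    have h3 : (1 / (x ^ 2 / 4)) ^ s ≤ 16 ^ s * (1 + x) ^ (-(2 * s)) := by
      rw [rpow_neg (by positivity), rpow_mul (by positivity), ← div_eq_mul_inv,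
        ← div_rpow (by norm_num) (by positivity)]
      refine rpow_le_rpow (by positivity) ?_ hs.le
      rw [rpow_two, div_le_div_iff₀ (by positivity) (by positivity)]
      nlinarith
    calc _ ≤ _ := h2
      _ ≤ (16 ^ s * (1 + x) ^ (-(2 * s))) * Real.Gamma s := by gcongr
      _ ≤ _ := by
        have : 0 ≤ 2 ^ (2 * s) * (1 / s) * (1 + x) ^ (-(2 * s)) := by positivity
        linarith

/-- `∫₀¹ t^{A-1} (1-t)^{s-1} e^{t²x²/2} (1+tx)^β dt = O(e^{x²/2} (1+x)^{β-2s})`. -/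
lemma exists_integral_beta_growth_le (β : ℝ) {A s : ℝ} (hA : 0 < A) (hs : 0 < s) :
    ∃ C : ℝ, 0 < C ∧ ∀ x : ℝ, 0 ≤ x →
      IntegrableOn (fun t : ℝ => t ^ (A - 1) * (1 - t) ^ (s - 1) * growth β (t * x)) (Set.Ioo 0 1) ∧
      ∫ t in Set.Ioo (0 : ℝ) 1, t ^ (A - 1) * (1 - t) ^ (s - 1) * growth β (t * x)
        ≤ C * growth (β - 2 * s) x := by
  obtain ⟨C1, hC1, h1⟩ := exists_integral_one_sub_rpow_exp_le hs
  obtain ⟨C2, hC2, h2⟩ := exists_one_add_rpow_le_exp |β| (ε := 1 / 4) (by norm_num)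
  obtain ⟨C3, hC3, h3⟩ := exists_one_add_rpow_le_exp (2 * s) (ε := 1 / 8) (by norm_num)
  refine ⟨C2 * (2 ^ |A - 1| * C1 + 2 ^ |s - 1| * C3 * (1 / A)), by positivity, fun x hx => ?_⟩
  obtain ⟨hi, h1⟩ := h1 x hx
  let D : ℝ → ℝ := fun t => C2 * growth β x *
    (2 ^ |A - 1| * ((1 - t) ^ (s - 1) * Real.exp (-(1 - t) * x ^ 2 / 4))
      + 2 ^ |s - 1| * Real.exp (-(x ^ 2 / 8)) * t ^ (A - 1))
  have hD : IntegrableOn D (Set.Ioo 0 1) :=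
    ((hi.const_mul _).add ((integrableOn_rpow_Ioo hA).const_mul _)).const_mul _
  have hgx := growth_pos (β := β) hx
  have hle : ∀ t ∈ Set.Ioo (0 : ℝ) 1,
      t ^ (A - 1) * (1 - t) ^ (s - 1) * growth β (t * x) ≤ D t := by
    intro t ht
    have ht0 := ht.1
    have ht1 : 0 < 1 - t := by linarith [ht.2]
    -- Passing from tx to x gains e^{-(1-t²)x²/2}, while Peetre's inequality loses a polynomial in
    -- (1 - t)x, absorbed in e^{(1-t)²x²/4}. At least e^{-(1-t)x²/4} of the gain is left.
    have e1 : growth β (t * x) ≤ C2 * growth β x * Real.exp (-(1 - t) * x ^ 2 / 4) := by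
      have p1 := one_add_rpow_le_mul (x := t * x) (y := x) (d := (1 - t) * x) β (by positivity) hx
        (by rw [abs_le]; constructor <;> nlinarith)
      have p2 := h2 ((1 - t) * x) (by positivity)
      have p3 : Real.exp ((t * x) ^ 2 / 2) * Real.exp (1 / 4 * ((1 - t) * x) ^ 2)
          ≤ Real.exp (x ^ 2 / 2) * Real.exp (-(1 - t) * x ^ 2 / 4) := by
        rw [← Real.exp_add, ← Real.exp_add, Real.exp_le_exp]
        have : 0 ≤ (1 - t) * t * x ^ 2 := by positivity
        nlinarith
      unfold growth
      calc _ ≤ Real.exp ((t * x) ^ 2 / 2) *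
            ((1 + x) ^ β * (C2 * Real.exp (1 / 4 * ((1 - t) * x) ^ 2))) := by
              gcongr
              exact p1.trans (by gcongr)
        _ = C2 * (1 + x) ^ β *
            (Real.exp ((t * x) ^ 2 / 2) * Real.exp (1 / 4 * ((1 - t) * x) ^ 2)) := by ring
        _ ≤ C2 * (1 + x) ^ β * (Real.exp (x ^ 2 / 2) * Real.exp (-(1 - t) * x ^ 2 / 4)) := by gcongr
        _ = _ := by ring
    have e2 : t ^ (A - 1) * (1 - t) ^ (s - 1) * Real.exp (-(1 - t) * x ^ 2 / 4) ≤
        2 ^ |A - 1| * ((1 - t) ^ (s - 1) * Real.exp (-(1 - t) * x ^ 2 / 4))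
          + 2 ^ |s - 1| * Real.exp (-(x ^ 2 / 8)) * t ^ (A - 1) := by
      -- For t ≥ 1/2 only the singularity at t = 1 matters and the Gaussian factor is kept. For t ≤
      -- 1/2 that factor is at most e^{-x²/8}, which beats every power of 1 + x.
      rcases beta_density_le A s ht.1 ht.2 with h | h
      · refine le_add_of_le_of_nonneg ?_ (by positivity)
        rw [← mul_assoc]
        exact mul_le_mul_of_nonneg_right h.1 (Real.exp_pos _).le
      · refine le_add_of_nonneg_of_le (by positivity) ?_
        have : Real.exp (-(1 - t) * x ^ 2 / 4) ≤ Real.exp (-(x ^ 2 / 8)) := by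
          rw [Real.exp_le_exp]
          nlinarith [h.2, sq_nonneg x]
        calc _ ≤ (2 ^ |s - 1| * t ^ (A - 1)) * Real.exp (-(x ^ 2 / 8)) :=
            mul_le_mul h.1 this (Real.exp_pos _).le (by positivity)
          _ = _ := by ring
    calc _ ≤ t ^ (A - 1) * (1 - t) ^ (s - 1) *
          (C2 * growth β x * Real.exp (-(1 - t) * x ^ 2 / 4)) := by gcongr
      _ = C2 * growth β x *
          (t ^ (A - 1) * (1 - t) ^ (s - 1) * Real.exp (-(1 - t) * x ^ 2 / 4)) := by ring
      _ ≤ _ := by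
        simp only [D]
        gcongr
  have hnn : ∀ t ∈ Set.Ioo (0 : ℝ) 1,
      0 ≤ t ^ (A - 1) * (1 - t) ^ (s - 1) * growth β (t * x) := by
    intro t ht
    have ht0 := ht.1
    have ht1 : 0 < 1 - t := by linarith [ht.2]
    have := growth_pos (β := β) (x := t * x) (by positivity)
    positivity
  have hint : IntegrableOn (fun t : ℝ => t ^ (A - 1) * (1 - t) ^ (s - 1) * growth β (t * x))
      (Set.Ioo 0 1) := by
    refine Integrable.mono' hD (Measurable.aestronglyMeasurable (by unfold growth; fun_prop)) ?_
    refine (ae_restrict_iff' measurableSet_Ioo).mpr (ae_of_all _ fun t ht => ?_)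
    rw [Real.norm_of_nonneg (hnn t ht)]
    exact hle t ht
  refine ⟨hint, (setIntegral_mono_on hint hD measurableSet_Ioo hle).trans ?_⟩
  have hDi : ∫ t in Set.Ioo (0 : ℝ) 1, D t = C2 * growth β x *
      (2 ^ |A - 1| * (∫ t in Set.Ioo (0 : ℝ) 1, (1 - t) ^ (s - 1) * Real.exp (-(1 - t) * x ^ 2 / 4))
      + 2 ^ |s - 1| * Real.exp (-(x ^ 2 / 8)) * (1 / A)) := by
    simp only [D]
    rw [integral_const_mul, integral_add (hi.const_mul _) ((integrableOn_rpow_Ioo hA).const_mul _),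
      integral_const_mul, integral_const_mul, integral_Ioo_rpow hA]
  have h4 : Real.exp (-(x ^ 2 / 8)) ≤ C3 * (1 + x) ^ (-(2 * s)) := by
    have h5 := h3 x hx
    rw [rpow_neg (by positivity), Real.exp_neg, ← div_eq_mul_inv, inv_le_iff_one_le_mul₀' (by positivity),
      ← mul_div_assoc, one_le_div (by positivity)]
    rw [show x ^ 2 / 8 = 1 / 8 * x ^ 2 by ring]
    linarith
  rw [hDi, show growth (β - 2 * s) x = growth β x * (1 + x) ^ (-(2 * s)) by
    rw [← growth_add hx, sub_eq_add_neg]]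
  calc _ ≤ C2 * growth β x * (2 ^ |A - 1| * (C1 * (1 + x) ^ (-(2 * s)))
      + 2 ^ |s - 1| * (C3 * (1 + x) ^ (-(2 * s))) * (1 / A)) := by gcongr
    _ = _ := by ring

/-- The Beta multiplier `Γ(k + A) / Γ(k + A + s)` lowers the growth exponent by `2s`. -/
lemma exists_hasGrowth_beta (β : ℝ) {A s : ℝ} (hA : 0 < A) (hs : 0 < s) :
    ∃ C : ℝ, 0 < C ∧ ∀ (a : ℕ → ℂ) (M : ℝ), HasGrowth a β M →
      HasGrowth (fun k => ((Real.Gamma (k + A) / Real.Gamma (k + A + s) : ℝ) : ℂ) * a k)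
        (β - 2 * s) (C * M) := by
  obtain ⟨C, hC, hbound⟩ := exists_integral_beta_growth_le β hA hs
  have hG := Real.Gamma_pos_of_pos hs
  refine ⟨C / Real.Gamma s, by positivity, fun a M h => ?_⟩
  have hM := h.nonneg
  -- The moments of the Beta density ω are the multiplier times Γ(s), so the new series is Γ(s)⁻¹ ∫
  -- ω(t) F(tλ) dt, and the growth of F can be integrated along the ray.
  let ω : ℝ → ℝ := fun t => t ^ (A - 1) * (1 - t) ^ (s - 1)
  have hω : ∀ t ∈ Set.Ioo (0 : ℝ) 1, 0 ≤ ω t := fun t ht => by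
    have ht0 := ht.1
    have ht1 : 0 < 1 - t := by linarith [ht.2]
    positivity
  have hmom : ∀ k : ℕ, IntegrableOn (fun t => ω t * t ^ k) (Set.Ioo 0 1) ∧
      ∫ t in Set.Ioo (0 : ℝ) 1, ω t * t ^ k
        = Real.Gamma (k + A) / Real.Gamma (k + A + s) * Real.Gamma s := by
    intro k
    have hk : 0 < (k : ℝ) + A := by positivity
    have heq : Set.EqOn (fun t : ℝ => t ^ ((k : ℝ) + A - 1) * (1 - t) ^ (s - 1))
        (fun t => ω t * t ^ k) (Set.Ioo 0 1) := by
      intro t ht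
      simp only [ω]
      rw [show (k : ℝ) + A - 1 = (A - 1) + k by ring, rpow_add ht.1, rpow_natCast]
      ring
    refine ⟨(integrableOn_beta hk hs).congr_fun heq measurableSet_Ioo, ?_⟩
    rw [← setIntegral_congr_fun measurableSet_Ioo heq, integral_beta hk hs]
    ring
  have hmle : ∀ k : ℕ, Real.Gamma (k + A) / Real.Gamma (k + A + s) ≤
      Real.Gamma A / Real.Gamma (A + s) := by
    intro k
    have h1 := (hmom k).2
    have h0 := (hmom 0).2
    have hle : ∫ t in Set.Ioo (0 : ℝ) 1, ω t * t ^ k ≤ ∫ t in Set.Ioo (0 : ℝ) 1, ω t * t ^ 0 := by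
      refine setIntegral_mono_on (hmom k).1 (hmom 0).1 measurableSet_Ioo fun t ht => ?_
      rw [pow_zero]
      exact mul_le_mul_of_nonneg_left (pow_le_one₀ ht.1.le ht.2.le) (hω t ht)
    rw [h1, h0] at hle
    simpa using le_of_mul_le_mul_right hle hG
  have hpos : ∀ k : ℕ, 0 < Real.Gamma (k + A) / Real.Gamma (k + A + s) := fun k =>
    div_pos (Real.Gamma_pos_of_pos (by positivity)) (Real.Gamma_pos_of_pos (by positivity))
  constructor
  · intro r hr
    refine Summable.of_nonneg_of_le (fun k => by positivity) (fun k => ?_)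
      ((h.summable r hr).mul_left (Real.Gamma A / Real.Gamma (A + s)))
    rw [norm_mul, Complex.norm_real, Real.norm_of_nonneg (hpos k).le, mul_assoc]
    exact mul_le_mul_of_nonneg_right (hmle k) (by positivity)
  · intro l
    have hsum : HasSum (fun k : ℕ => ∫ t in Set.Ioo (0 : ℝ) 1, (ω t : ℂ) * (a k * (t * l) ^ k))
        (∫ t in Set.Ioo (0 : ℝ) 1, (ω t : ℂ) * ∑' k, a k * (t * l) ^ k) := by
      refine hasSum_integral_of_dominated_convergence (fun k t => ω t * (‖a k‖ * ‖l‖ ^ k)) ?_ ?_ ?_ ?_ ?_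
      · intro k
        exact Measurable.aestronglyMeasurable (by simp only [ω]; fun_prop)
      · intro k
        refine (ae_restrict_iff' measurableSet_Ioo).mpr (ae_of_all _ fun t ht => ?_)
        rw [norm_mul, Complex.norm_real, Real.norm_of_nonneg (hω t ht), norm_mul, norm_pow,
          norm_mul, Complex.norm_real, Real.norm_of_nonneg ht.1.le]
        have := hω t ht
        have : t * ‖l‖ ≤ ‖l‖ := mul_le_of_le_one_left (norm_nonneg l) ht.2.le
        have := ht.1
        gcongr
      · exact ae_of_all _ fun t => (h.summable _ (norm_nonneg l)).mul_left _
      · simp_rw [tsum_mul_left]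
        exact (integrableOn_beta hA hs).mul_const _
      · exact ae_of_all _ fun t => (h.hasSum _).mul_left _
    have hterm : ∀ k : ℕ, ∫ t in Set.Ioo (0 : ℝ) 1, (ω t : ℂ) * (a k * (t * l) ^ k)
        = Real.Gamma s * (((Real.Gamma (k + A) / Real.Gamma (k + A + s) : ℝ) : ℂ) * a k * l ^ k) := by
      intro k
      have : ∀ t : ℝ, (ω t : ℂ) * (a k * (t * l) ^ k) = ((ω t * t ^ k : ℝ) : ℂ) * (a k * l ^ k) := by
        intro t; push_cast; ring
      simp_rw [this]
      rw [integral_mul_const, integral_complex_ofReal, (hmom k).2]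
      push_cast; ring
    simp_rw [hterm] at hsum
    have hnorm : ‖∫ t in Set.Ioo (0 : ℝ) 1, (ω t : ℂ) * ∑' k, a k * (t * l) ^ k‖ ≤
        M * (C * growth (β - 2 * s) ‖l‖) := by
      obtain ⟨hi, hle⟩ := hbound ‖l‖ (norm_nonneg l)
      refine (norm_integral_le_of_norm_le (hi.const_mul M) ?_).trans ?_
      · refine (ae_restrict_iff' measurableSet_Ioo).mpr (ae_of_all _ fun t ht => ?_)
        rw [norm_mul, Complex.norm_real, Real.norm_of_nonneg (hω t ht)]
        have := h.bound (t * l)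
        rw [norm_mul, Complex.norm_real, Real.norm_of_nonneg ht.1.le] at this
        calc _ ≤ ω t * (M * growth β (t * ‖l‖)) := mul_le_mul_of_nonneg_left this (hω t ht)
          _ = _ := by simp only [ω]; ring
      · rw [integral_const_mul]
        gcongr
    rw [← hsum.tsum_eq, tsum_mul_left, norm_mul, Complex.norm_real, Real.norm_of_nonneg hG.le] at hnorm
    rw [div_mul_eq_mul_div, div_mul_eq_mul_div, le_div_iff₀ hG]
    linarith

/-- For A < B this is the Beta multiplier. Otherwise Γ(k+A)/Γ(k+B) = (k+B) · Γ(k+A)/Γ(k+B+1): the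
parameter B is raised until it exceeds A, and each factor k + B is put back by the operator λF' +
BF. The number `m` counts the raises. -/
lemma exists_hasGrowth_gamma_pos (A : ℝ) (hA : 0 < A) (m : ℕ) :
    ∀ B β : ℝ, 0 < B → A < B + m →
    ∃ C : ℝ, 0 < C ∧ ∀ (a : ℕ → ℂ) (M : ℝ), HasGrowth a β M →
      HasGrowth (fun k => ((Real.Gamma (k + A) / Real.Gamma (k + B) : ℝ) : ℂ) * a k)
        (β - 2 * (B - A)) (C * M) := by
  induction m with
  | zero =>
    intro B β hB hAB
    obtain ⟨C, hC, h⟩ := exists_hasGrowth_beta β hA (s := B - A) (by simpa using hAB)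
    refine ⟨C, hC, fun a M ha => ?_⟩
    convert h a M ha using 6
    ring
  | succ m ih =>
    intro B β hB hAB
    obtain ⟨C, hC, h⟩ := ih (B + 1) β (by linarith) (by push_cast at hAB; linarith)
    refine ⟨(Real.exp (3 / 2) * 2 ^ |β - 2 * (B + 1 - A)| + |B|) * C, by positivity,
      fun a M ha => ?_⟩
    have h1 := (h a M ha).add_const_mul B
    have e1 : β - 2 * (B + 1 - A) + 2 = β - 2 * (B - A) := by ring
    rw [e1, ← mul_assoc] at h1
    convert h1 using 1
    funext k
    have hk : (k : ℝ) + B ≠ 0 := by positivity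
    have hG := (Real.Gamma_pos_of_pos (show 0 < (k : ℝ) + B by positivity)).ne'
    rw [← mul_assoc, ← Complex.ofReal_mul, ← add_assoc (k : ℝ) B 1, Real.Gamma_add_one hk]
    congr 2
    field_simp

/-- Deleting the first `j` coefficients and dividing by `λʲ`. -/
lemma exists_hasGrowth_shift (β : ℝ) (j : ℕ) :
    ∃ C : ℝ, 0 < C ∧ ∀ (a : ℕ → ℂ) (M : ℝ), HasGrowth a β M →
      HasGrowth (fun k => a (k + j)) (β - j) (C * M) := by
  obtain ⟨C0, hC0, h0⟩ := exists_growth_le β (j : ℝ) (ρ := 0) one_pos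
  refine ⟨max (2 * growth β 2 * 2 ^ |β - j|) (2 ^ j * (1 + j * growth β 1 * C0)),
    lt_max_of_lt_left (by have := growth_pos (β := β) (x := 2) (by norm_num); positivity),
    fun a M h => ?_⟩
  have hM := h.nonneg
  have hg2 := growth_pos (β := β) (x := 2) (by norm_num)
  have hg1 := growth_pos (β := β) (x := 1) (by norm_num)
  have hsum : ∀ r : ℝ, 0 ≤ r → Summable fun k => ‖a (k + j)‖ * r ^ k := by
    intro r hr
    have h1 : Summable fun k => ‖a (k + j)‖ * (r + 1) ^ (k + j) :=
      (summable_nat_add_iff j).mpr (h.summable (r + 1) (by positivity))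
    refine Summable.of_nonneg_of_le (fun k => by positivity) (fun k => ?_) h1
    gcongr ?_ * ?_
    calc r ^ k ≤ (r + 1) ^ k := by gcongr; linarith
      _ ≤ _ := pow_le_pow_right₀ (by linarith) (by omega)
  refine ⟨hsum, fun l => ?_⟩
  have hgl := growth_pos (β := β - j) (norm_nonneg l)
  -- In the unit disc, Cauchy's estimate at radius 2 makes the series geometric. Outside it, the
  -- first `j` terms are subtracted from the full sum and λʲ is divided out.
  rcases le_total ‖l‖ 1 with hl | hl
  · have hc : ∀ k, ‖a (k + j) * l ^ k‖ ≤ M * growth β 2 * (1 / 2) ^ k := by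
      intro k
      have h1 := h.norm_coeff_mul_pow_le (k + j) (r := 2) (by norm_num)
      have h2 : ‖a (k + j)‖ * 2 ^ k ≤ M * growth β 2 := by
        refine le_trans ?_ h1
        gcongr <;> norm_num
      rw [norm_mul, norm_pow, one_div, inv_pow, ← div_eq_mul_inv, le_div_iff₀ (by positivity)]
      calc ‖a (k + j)‖ * ‖l‖ ^ k * 2 ^ k ≤ ‖a (k + j)‖ * 1 * 2 ^ k := by
            gcongr
            exact pow_le_one₀ (norm_nonneg l) hl
        _ ≤ _ := by rw [mul_one]; exact h2
    have h3 := tsum_of_norm_bounded (hasSum_geometric_two.mul_left (M * growth β 2)) hc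
    have h4 : 1 ≤ 2 ^ |β - j| * growth (β - j) ‖l‖ := by
      have h5 := one_add_rpow_le_mul (x := 0) (y := ‖l‖) (d := 1) (β - j) le_rfl (norm_nonneg l)
        (by simpa using hl)
      have h6 : 1 ≤ Real.exp (‖l‖ ^ 2 / 2) := Real.one_le_exp (by positivity)
      unfold growth
      norm_num at h5
      have h7 : 0 < 2 ^ |β - j| * (1 + ‖l‖) ^ (β - j) := by positivity
      nlinarith
    refine h3.trans ?_
    calc M * growth β 2 * 2 ≤ M * growth β 2 * 2 * (2 ^ |β - j| * growth (β - j) ‖l‖) :=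
          le_mul_of_one_le_right (by positivity) h4
      _ = (2 * growth β 2 * 2 ^ |β - j|) * M * growth (β - j) ‖l‖ := by ring
      _ ≤ _ := by gcongr; exact le_max_left _ _
  · have hl0 : 0 < ‖l‖ := by linarith
    have e1 : l ^ j * ∑' k, a (k + j) * l ^ k
        = ∑' k, a k * l ^ k - ∑ k ∈ Finset.range j, a k * l ^ k := by
      rw [eq_sub_iff_add_eq', ← (h.hasSum l).summable.sum_add_tsum_nat_add j, ← tsum_mul_left]
      congr 2; funext k; ring
    have e2 : ‖l‖ ^ j * ‖∑' k, a (k + j) * l ^ k‖ ≤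
        M * growth β ‖l‖ + j * (M * growth β 1 * ‖l‖ ^ j) := by
      rw [← norm_pow, ← norm_mul, e1]
      refine (norm_sub_le _ _).trans (add_le_add (h.bound l) ?_)
      refine (norm_sum_le_of_le _ (f := fun k => a k * l ^ k)
        (n := fun _ => M * growth β 1 * ‖l‖ ^ j) fun k hk => ?_).trans_eq (by simp)
      have h1 := h.norm_coeff_mul_pow_le k (r := 1) zero_le_one
      rw [one_pow, mul_one] at h1
      rw [norm_mul, norm_pow]
      exact mul_le_mul h1 (pow_le_pow_right₀ hl (Finset.mem_range.mp hk).le)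
        (by positivity) (by positivity)
    have e3 : ‖l‖ ^ j ≤ C0 * growth β ‖l‖ := by
      have := h0 ‖l‖ hl0.le
      simp only [zero_mul, zero_div, Real.exp_zero, one_mul, rpow_natCast] at this
      refine le_trans ?_ this
      gcongr
      linarith
    have e4 : growth β ‖l‖ = growth (β - j) ‖l‖ * (1 + ‖l‖) ^ j := by
      rw [← rpow_natCast, ← growth_add hl0.le]; congr 1; ring
    have e5 : (1 + ‖l‖) ^ j ≤ 2 ^ j * ‖l‖ ^ j := by
      rw [← mul_pow]; gcongr; linarith
    have e6 : ‖l‖ ^ j * ‖∑' k, a (k + j) * l ^ k‖ ≤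
        ‖l‖ ^ j * (2 ^ j * (1 + j * growth β 1 * C0) * M * growth (β - j) ‖l‖) := by
      calc _ ≤ _ := e2
        _ ≤ M * growth β ‖l‖ + j * (M * growth β 1 * (C0 * growth β ‖l‖)) := by gcongr
        _ = (1 + j * growth β 1 * C0) * M * growth (β - j) ‖l‖ * (1 + ‖l‖) ^ j := by rw [e4]; ring
        _ ≤ (1 + j * growth β 1 * C0) * M * growth (β - j) ‖l‖ * (2 ^ j * ‖l‖ ^ j) := by gcongr
        _ = _ := by ring
    refine (le_of_mul_le_mul_left e6 (by positivity)).trans ?_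
    gcongr
    exact le_max_right _ _

/-- The coefficient multiplier equal to `1` for `k < j` and to `Γ(k + A) / Γ(k + B)` for `k ≥ j`. -/
def gammaMultiplier (j : ℕ) (A B : ℝ) (k : ℕ) : ℝ :=
  if k < j then 1 else Real.Gamma (k + A) / Real.Gamma (k + B)

lemma gammaMultiplier_pos {j : ℕ} {A B : ℝ} (hA : 0 < j + A) (hB : 0 < j + B) (k : ℕ) :
    0 < gammaMultiplier j A B k := by
  unfold gammaMultiplier
  split_ifs with h
  · exact one_pos
  · have : (j : ℝ) ≤ k := by exact_mod_cast not_lt.mp h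
    exact div_pos (Real.Gamma_pos_of_pos (by linarith)) (Real.Gamma_pos_of_pos (by linarith))

lemma gammaMultiplier_mul_swap {j : ℕ} {A B : ℝ} (hA : 0 < j + A) (hB : 0 < j + B) (k : ℕ) :
    gammaMultiplier j A B k * gammaMultiplier j B A k = 1 := by
  unfold gammaMultiplier
  split_ifs with h
  · simp
  · have : (j : ℝ) ≤ k := by exact_mod_cast not_lt.mp h
    have h1 := (Real.Gamma_pos_of_pos (show 0 < k + A by linarith)).ne'
    have h2 := (Real.Gamma_pos_of_pos (show 0 < k + B by linarith)).ne'
    field_simp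

/-- The multiplier theorem: `gammaMultiplier j A B` changes the growth exponent by `2 (A - B)`. -/
theorem exists_hasGrowth_gammaMultiplier (β : ℝ) {j : ℕ} {A B : ℝ} (hA : 0 < j + A)
    (hB : 0 < j + B) :
    ∃ C : ℝ, 0 < C ∧ ∀ (a : ℕ → ℂ) (M : ℝ), HasGrowth a β M →
      HasGrowth (fun k => (gammaMultiplier j A B k : ℂ) * a k) (β - 2 * (B - A)) (C * M) := by
  obtain ⟨C1, hC1, h1⟩ := exists_hasGrowth_shift β j
  obtain ⟨m, hm⟩ := exists_nat_gt (A - B)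
  -- After the shift of the index the parameters are j + A and j + B, which are positive even if A
  -- or B is not. Multiplying back by λʲ restores the `j` that the shift took from the exponent.
  obtain ⟨C2, hC2, h2⟩ := exists_hasGrowth_gamma_pos (j + A) hA m (j + B) (β - j) hB (by linarith)
  obtain ⟨C0, hC0, h0⟩ := exists_growth_le (β - 2 * (B - A)) (j : ℝ) (ρ := 0) one_pos
  have hg1 := growth_pos (β := β) (x := 1) (by norm_num)
  refine ⟨j * growth β 1 * C0 + C2 * C1, by positivity, fun a M h => ?_⟩
  have hM := h.nonneg
  have h3 := h2 _ _ (h1 a M h)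
  set b : ℕ → ℂ := fun k => (gammaMultiplier j A B k : ℂ) * a k with hb
  have hbj : (fun k : ℕ => ((Real.Gamma (k + (j + A)) / Real.Gamma (k + (j + B)) : ℝ) : ℂ) * a (k + j))
      = fun k => b (k + j) := by
    funext k
    simp [hb, gammaMultiplier, add_assoc]
  rw [hbj] at h3
  have hsum : ∀ r : ℝ, 0 ≤ r → Summable fun k => ‖b k‖ * r ^ k := by
    intro r hr
    rw [← summable_nat_add_iff j]
    refine ((h3.summable r hr).mul_right (r ^ j)).congr fun k => ?_
    rw [pow_add]; ring
  refine ⟨hsum, fun l => ?_⟩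
  have hl := norm_nonneg l
  have hgl := growth_pos (β := β - 2 * (B - A)) hl
  have hs : Summable fun k => b k * l ^ k := by
    refine Summable.of_norm ?_
    simpa [norm_mul, norm_pow] using hsum ‖l‖ hl
  rw [← hs.sum_add_tsum_nat_add j]
  have e0 : ∑' k, b (k + j) * l ^ (k + j) = l ^ j * ∑' k, b (k + j) * l ^ k := by
    rw [← tsum_mul_left]; congr 1; funext k; ring
  rw [e0, add_mul, add_mul]
  refine (norm_add_le _ _).trans (add_le_add ?_ ?_)
  · have e3 : (1 + ‖l‖) ^ j ≤ C0 * growth (β - 2 * (B - A)) ‖l‖ := by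
      simpa using h0 ‖l‖ hl
    refine (norm_sum_le_of_le _ (f := fun k => b k * l ^ k)
      (n := fun _ => M * growth β 1 * (1 + ‖l‖) ^ j) fun k hk => ?_).trans ?_
    · have hk := Finset.mem_range.mp hk
      have h1 := h.norm_coeff_mul_pow_le k (r := 1) zero_le_one
      rw [one_pow, mul_one] at h1
      simp only [hb, gammaMultiplier, hk, if_true, Complex.ofReal_one, one_mul]
      rw [norm_mul, norm_pow]
      refine mul_le_mul h1 ?_ (by positivity) (by positivity)
      calc ‖l‖ ^ k ≤ (1 + ‖l‖) ^ k := by gcongr; linarith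
        _ ≤ _ := pow_le_pow_right₀ (by linarith) hk.le
    · simp only [Finset.sum_const, Finset.card_range, nsmul_eq_mul]
      calc _ ≤ j * (M * growth β 1 * (C0 * growth (β - 2 * (B - A)) ‖l‖)) := by gcongr
        _ = _ := by ring
  · rw [norm_mul, norm_pow]
    have e4 : growth (β - 2 * (B - A)) ‖l‖
        = growth (β - j - 2 * (j + B - (j + A))) ‖l‖ * (1 + ‖l‖) ^ j := by
      rw [← rpow_natCast, ← growth_add hl]; congr 1; ring
    have h4 := h3.bound l
    have hg3 := growth_pos (β := β - j - 2 * (j + B - (j + A))) hl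
    have h5 : ‖l‖ ^ j ≤ (1 + ‖l‖) ^ j := by gcongr; linarith
    calc _ ≤ (1 + ‖l‖) ^ j * (C2 * (C1 * M) * growth (β - j - 2 * (j + B - (j + A))) ‖l‖) := by gcongr
      _ = _ := by rw [e4]; ring

/-! ### Lebesgue measure on ℂⁿ: rotations, polar coordinates, Gaussian moments -/

variable {n : ℕ}

lemma finrank_Cn (n : ℕ) : Module.finrank ℝ (Cn n) = 2 * n := by
  rw [← Module.finrank_mul_finrank ℝ ℂ (Cn n)]
  simp

instance isAddHaarMeasure_V (n : ℕ) : (V n).IsAddHaarMeasure := by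
  unfold V
  exact Measure.IsAddHaarMeasure.smul _ (by simp; positivity) ENNReal.ofReal_ne_top

lemma nontrivial_Cn (hn : 1 ≤ n) : Nontrivial (Cn n) := by
  have : Nonempty (Fin n) := ⟨⟨0, hn⟩⟩
  infer_instance

/-- Multiplication by a unimodular constant preserves Lebesgue measure. -/
lemma measurePreserving_unit_smul {l : ℂ} (hl : ‖l‖ = 1) :
    MeasurePreserving (fun z : Cn n => l • z) (V n) (V n) := by
  have hl0 : l ≠ 0 := by rintro rfl; simp at hl
  let e : Cn n ≃ₗᵢ[ℝ] Cn n :=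
    { (LinearEquiv.smulOfNeZero ℂ (Cn n) l hl0).restrictScalars ℝ with
      norm_map' := fun z => by
        change ‖l • z‖ = ‖z‖
        rw [norm_smul, hl, one_mul] }
  exact (LinearIsometryEquiv.measurePreserving e).smul_measure _

lemma continuous_circleMap_smul :
    Continuous fun x : ℝ × Cn n => circleMap 0 1 x.1 • x.2 :=
  ((continuous_circleMap 0 1).comp continuous_fst).smul continuous_snd

/-- Averaging over rotations does not change the integral. -/
lemma integral_eq_integral_circleAverage {E : Type*} [NormedAddCommGroup E] [NormedSpace ℝ E]
    [CompleteSpace E] {F : Cn n → E} (hF : Integrable F (V n)) :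
    Integrable (fun z => Real.circleAverage (fun l => F (l • z)) 0 1) (V n) ∧
    ∫ z, F z ∂(V n) = ∫ z, Real.circleAverage (fun l => F (l • z)) 0 1 ∂(V n) := by
  let τ : Measure ℝ := volume.restrict (Set.Ioc 0 (2 * π))
  -- The shear (θ, z) ↦ (θ, e^{iθ}z) preserves the product measure, which makes the rotated
  -- integrand integrable in both variables and justifies Fubini.
  have hmp : MeasurePreserving (fun x : ℝ × Cn n => (x.1, circleMap 0 1 x.1 • x.2))
      (τ.prod (V n)) (τ.prod (V n)) := by
    refine MeasurePreserving.skew_product (g := fun θ z => circleMap 0 1 θ • z)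
      (MeasurePreserving.id τ) continuous_circleMap_smul.measurable (ae_of_all _ fun θ => ?_)
    exact (measurePreserving_unit_smul (by simp)).map_eq
  have hint : Integrable (fun x : ℝ × Cn n => F (circleMap 0 1 x.1 • x.2)) (τ.prod (V n)) :=
    hmp.integrable_comp_of_integrable (hF.comp_snd τ)
  have hpi := Real.pi_pos
  simp_rw [Real.circleAverage_def, intervalIntegral.integral_of_le (by positivity : (0:ℝ) ≤ 2 * π)]
  refine ⟨hint.integral_prod_right.smul _, ?_⟩
  rw [integral_smul, ← integral_integral_swap hint]
  have hθ : ∀ θ : ℝ, ∫ z, F (circleMap 0 1 θ • z) ∂(V n) = ∫ z, F z ∂(V n) := by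
    intro θ
    have hθ1 : ‖circleMap 0 1 θ‖ = 1 := by simp
    have hne : circleMap 0 1 θ ≠ 0 := by intro h; rw [h] at hθ1; simp at hθ1
    exact (measurePreserving_unit_smul hθ1).integral_comp
      (Homeomorph.smulOfNeZero _ hne).measurableEmbedding F
  simp_rw [hθ]
  rw [integral_const, smul_smul, measureReal_restrict_apply_univ, Real.volume_real_Ioc_of_le
    (by positivity)]
  rw [sub_zero, inv_mul_cancel₀ (by positivity), one_smul]

/-- The weighted pairing measure as a density with respect to `V`. -/
lemma integral_W (γ : ℝ) (F : Cn n → ℂ) :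
    ∫ z, F z ∂(W n γ) = ∫ z, (‖z‖ ^ (-γ) : ℝ) • F z ∂(V n) := by
  rw [W, integral_withDensity_eq_integral_toReal_smul (by fun_prop) (by simp)]
  refine integral_congr_ae (ae_of_all _ fun z => ?_)
  simp only
  rw [ENNReal.toReal_ofReal (by positivity)]

lemma integrable_W (γ : ℝ) (F : Cn n → ℂ) :
    Integrable F (W n γ) ↔ Integrable (fun z => (‖z‖ ^ (-γ) : ℝ) • F z) (V n) := by
  rw [W, integrable_withDensity_iff_integrable_smul₀' (by fun_prop) (by simp)]
  refine integrable_congr (ae_of_all _ fun z => ?_)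
  simp only
  rw [ENNReal.toReal_ofReal (by positivity)]

/-- Integration in polar coordinates of a homogeneous function against a radial one. -/
lemma integral_radial_smul_homogeneous (hn : 1 ≤ n) {F : Cn n → ℂ} {m : ℕ}
    (hF : ∀ (r : ℝ) (z : Cn n), 0 < r → F (r • z) = (r : ℂ) ^ m * F z) (φ : ℝ → ℝ) :
    ∫ z, φ ‖z‖ • F z ∂(V n) =
      (∫ ζ : Metric.sphere (0 : Cn n) 1, F ζ ∂(V n).toSphere) *
        ((∫ r in Set.Ioi (0 : ℝ), r ^ (2 * n - 1) * (φ r * r ^ m) : ℝ) : ℂ) := by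
  have := nontrivial_Cn hn
  calc ∫ z, φ ‖z‖ • F z ∂(V n)
      = ∫ z : ({(0)}ᶜ : Set (Cn n)), φ ‖z.1‖ • F z ∂((V n).comap (↑)) := by
        rw [integral_subtype_comap (measurableSet_singleton _).compl fun z => φ ‖z‖ • F z,
          restrict_compl_singleton]
    _ = ∫ x : Metric.sphere (0 : Cn n) 1 × Set.Ioi (0 : ℝ), F x.1 * ((φ x.2 * (x.2 : ℝ) ^ m : ℝ) : ℂ)
          ∂(V n).toSphere.prod (.volumeIoiPow (Module.finrank ℝ (Cn n) - 1)) := by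
        rw [← (V n).measurePreserving_homeomorphUnitSphereProd.integral_comp
          (Homeomorph.measurableEmbedding _)]
        refine integral_congr_ae (ae_of_all _ fun z => ?_)
        have hz : (0 : ℝ) < ‖z.1‖ := norm_pos_iff.mpr z.2
        have h1 := hF ‖z.1‖ ((homeomorphUnitSphereProd (Cn n) z).1 : Cn n) hz
        have h2 : ‖z.1‖ • ((homeomorphUnitSphereProd (Cn n) z).1 : Cn n) = z := by
          simp [smul_smul, mul_inv_cancel₀ hz.ne']
        rw [h2] at h1
        simp only [h1, homeomorphUnitSphereProd_apply_snd_coe, Complex.real_smul]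
        push_cast; ring
    _ = _ := by
        rw [integral_prod_mul (fun ζ : Metric.sphere (0 : Cn n) 1 => F ζ)
          (fun r : Set.Ioi (0 : ℝ) => ((φ r * (r : ℝ) ^ m : ℝ) : ℂ)), integral_complex_ofReal]
        congr 2
        simp only [Measure.volumeIoiPow, ENNReal.ofReal]
        rw [integral_withDensity_eq_integral_smul,
          integral_subtype_comap measurableSet_Ioi fun a =>
            Real.toNNReal (a ^ (Module.finrank ℝ (Cn n) - 1)) • (φ a * a ^ m),
          setIntegral_congr_fun measurableSet_Ioi fun x hx => ?_]
        · rw [NNReal.smul_def, Real.coe_toNNReal _ (pow_nonneg hx.out.le _), finrank_Cn, smul_eq_mul]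
        · exact (measurable_subtype_coe.pow_const _).real_toNNReal

/-- The Jacobian of polar coordinates is r^{2n-1}, so the condition on `s` is integrability at the
origin. -/
lemma integrable_norm_rpow_mul_exp (hn : 1 ≤ n) {c s : ℝ} (hc : 0 < c) (hs : -(2 * n : ℝ) < s) :
    Integrable (fun z : Cn n => ‖z‖ ^ s * Real.exp (-c * ‖z‖ ^ 2)) (V n) := by
  have := nontrivial_Cn hn
  rw [integrable_fun_norm_addHaar (V n) (f := fun r => r ^ s * Real.exp (-c * r ^ 2))]
  refine (integrableOn_rpow_mul_exp_neg_mul_sq hc (s := s + (2 * n - 1)) (by linarith)).congr_fun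
    (fun r hr => ?_) measurableSet_Ioi
  have hr : (0 : ℝ) < r := hr
  have hnn : ((Module.finrank ℝ (Cn n) - 1 : ℕ) : ℝ) = 2 * n - 1 := by
    rw [finrank_Cn, Nat.cast_sub (by omega)]; push_cast; ring
  simp only [smul_eq_mul]
  rw [rpow_add hr, ← hnn, rpow_natCast]
  ring

lemma integrable_one_add_norm_rpow_mul_exp (hn : 1 ≤ n) {c : ℝ} (hc : 0 < c) (s : ℝ) :
    Integrable (fun z : Cn n => Real.exp (-c * ‖z‖ ^ 2) * (1 + ‖z‖) ^ s) (V n) := by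
  obtain ⟨C, hC, h⟩ := exists_one_add_rpow_le_exp s (ε := c / 2) (by positivity)
  have h0 := (integrable_norm_rpow_mul_exp hn (c := c / 2) (s := 0) (by positivity)
    (by have : (1 : ℝ) ≤ n := by exact_mod_cast hn
        linarith)).const_mul C
  refine h0.mono' (Measurable.aestronglyMeasurable (by fun_prop)) (ae_of_all _ fun z => ?_)
  rw [Real.norm_of_nonneg (by positivity), rpow_zero, one_mul]
  calc _ ≤ Real.exp (-c * ‖z‖ ^ 2) * (C * Real.exp (c / 2 * ‖z‖ ^ 2)) := by
        gcongr; exact h _ (norm_nonneg z)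
    _ = C * (Real.exp (-c * ‖z‖ ^ 2) * Real.exp (c / 2 * ‖z‖ ^ 2)) := by ring
    _ = _ := by rw [← Real.exp_add]; congr 2; ring

lemma integral_exp_neg_norm_sq (n : ℕ) : ∫ z, Real.exp (-‖z‖ ^ 2) ∂(V n) = 1 := by
  have h := GaussianFourier.integral_rexp_neg_mul_sq_norm (V := Cn n) one_pos
  simp only [neg_mul, one_mul, div_one, finrank_Cn] at h
  rw [V, integral_smul_measure, h, ENNReal.toReal_ofReal (by positivity)]
  push_cast
  rw [mul_div_cancel_left₀ _ two_ne_zero, rpow_natCast, smul_eq_mul,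
    inv_mul_cancel₀ (by positivity)]

/-- The radial moments of the weights `e^{-|z|²} |z|^{-γ}`. -/
lemma integral_radial_moment {k : ℕ} (hn : 1 ≤ n) {γ : ℝ} (hk : 0 < k + (n - γ / 2)) :
    ∫ r in Set.Ioi (0 : ℝ), r ^ (2 * n - 1) * ((r ^ (-γ) * Real.exp (-r ^ 2)) * r ^ (2 * k))
      = Real.Gamma (k + (n - γ / 2)) / 2 := by
  have h := integral_rpow_mul_exp_neg_rpow (p := 2) (q := 2 * (k + (n - γ / 2)) - 1) two_pos
    (by linarith)
  have e : (2 * (k + (n - γ / 2)) - 1 + 1) / 2 = k + (n - γ / 2) := by ring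
  rw [e] at h
  rw [div_eq_inv_mul, inv_eq_one_div, ← h]
  refine setIntegral_congr_fun measurableSet_Ioi fun r (hr : 0 < r) => ?_
  have hnn : ((2 * n - 1 : ℕ) : ℝ) = 2 * n - 1 := by
    rw [Nat.cast_sub (by omega)]; push_cast; ring
  rw [← rpow_natCast r (2 * n - 1), ← rpow_natCast r (2 * k), hnn, ← rpow_two,
    show 2 * (k + (n - γ / 2)) - 1 = (2 * n - 1) + (-γ) + ((2 * k : ℕ) : ℝ) by push_cast; ring,
    rpow_add hr, rpow_add hr]
  ring

/-! ### Entire functions given by moments -/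

/-- `f` is the sum of an everywhere convergent power series at the origin. -/
def IsEntire (f : Cn n → ℂ) : Prop :=
  ∃ p : FormalMultilinearSeries ℂ (Cn n) ℂ, HasFPowerSeriesOnBall f p 0 ⊤

lemma homogPart_smul (f : Cn n → ℂ) (k : ℕ) (l : ℂ) (z : Cn n) :
    homogPart f k (l • z) = l ^ k * homogPart f k z := by
  unfold homogPart
  have := (iteratedFDeriv ℂ k f 0).map_smul_univ (fun _ => l) (fun _ => z)
  rw [this]
  simp [mul_div_assoc]

lemma differentiable_homogPart (f : Cn n → ℂ) (k : ℕ) : Differentiable ℂ (homogPart f k) := by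
  have h : Differentiable ℂ (fun z : Cn n => iteratedFDeriv ℂ k f 0 fun _ => z) := fun z =>
    DifferentiableAt.comp z
      (ContinuousMultilinearMap.hasFDerivAt (iteratedFDeriv ℂ k f 0) fun _ => z).differentiableAt
      (differentiableAt_pi.mpr fun _ => differentiableAt_id)
  simpa only [homogPart, div_eq_mul_inv] using! h.mul_const ((k.factorial : ℂ)⁻¹)

namespace IsEntire
variable {f : Cn n → ℂ}

lemma homogPart_eq {p : FormalMultilinearSeries ℂ (Cn n) ℂ} (hp : HasFPowerSeriesOnBall f p 0 ⊤)
    (k : ℕ) (z : Cn n) : homogPart f k z = p k fun _ => z := by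
  have h := hp.factorial_smul z k
  have hk : (k.factorial : ℂ) ≠ 0 := by exact_mod_cast k.factorial_ne_zero
  rw [homogPart, ← h, nsmul_eq_mul, mul_div_cancel_left₀ _ hk]

lemma differentiable (hf : IsEntire f) : Differentiable ℂ f := by
  obtain ⟨p, hp⟩ := hf
  intro z
  exact (hp.analyticAt_of_mem (by simp)).differentiableAt

lemma hasSum (hf : IsEntire f) (z : Cn n) : HasSum (fun k => homogPart f k z) (f z) := by
  obtain ⟨p, hp⟩ := hf
  have := hp.hasSum (y := z) (by simp)
  rw [zero_add] at this
  exact this.congr_fun fun k => homogPart_eq hp k z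

lemma hasSum_smul (hf : IsEntire f) (l : ℂ) (z : Cn n) :
    HasSum (fun k => homogPart f k z * l ^ k) (f (l • z)) :=
  (hf.hasSum (l • z)).congr_fun fun k => by rw [homogPart_smul, mul_comm]

lemma summable (hf : IsEntire f) (z : Cn n) : Summable fun k => ‖homogPart f k z‖ := by
  obtain ⟨p, hp⟩ := hf
  have h := p.summable_norm_apply (x := z) (by rw [top_le_iff.mp hp.r_le]; simp)
  exact h.congr fun k => by rw [homogPart_eq hp k z]

/-- A power series in `l` representing `l ↦ f (l z)` on the unit circle has the coefficients
`homogPart f k z`. -/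
lemma circleAverage_conj_pow_mul (hf : IsEntire f) (k : ℕ) (z : Cn n) :
    Real.circleAverage (fun l => conj l ^ k * f (l • z)) 0 1 = homogPart f k z :=
  FockDuality.circleAverage_conj_pow_mul (F := fun l => f (l • z)) (hf.summable z)
    (fun l _ => hf.hasSum_smul l z) k

/-- Two expansions of l ↦ f(lz) on the unit circle have the same Fourier coefficients. This
identifies homogeneous parts without computing derivatives. -/
lemma homogPart_eq_of_hasSum (hf : IsEntire f) {a : ℕ → ℂ} {z : Cn n}
    (ha : Summable fun k => ‖a k‖) (h : ∀ l : ℂ, ‖l‖ = 1 → HasSum (fun k => a k * l ^ k) (f (l • z)))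
    (k : ℕ) : homogPart f k z = a k := by
  rw [← hf.circleAverage_conj_pow_mul k z,
    FockDuality.circleAverage_conj_pow_mul (F := fun l => f (l • z)) ha h k]

/-- The homogeneous parts of a homogeneous function. -/
lemma homogPart_of_homogeneous (hf : IsEntire f) {j : ℕ}
    (hj : ∀ (l : ℂ) (z : Cn n), f (l • z) = l ^ j * f z) (k : ℕ) (z : Cn n) :
    homogPart f k z = if k = j then f z else 0 := by
  refine hf.homogPart_eq_of_hasSum (a := fun k => if k = j then f z else 0)
    (summable_of_ne_finset_zero (s := {j}) fun k hk => by simp_all) (fun l _ => ?_) k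
  rw [hj]
  have := hasSum_ite_eq j (f z * l ^ j)
  rw [mul_comm]
  exact this.congr_fun fun k => by split_ifs with h <;> simp [h]

end IsEntire

/-- The power series `∑ₖ (1/k!) ∑ₛ m(k, s) z_{s(1)} ⋯ z_{s(k)}`. -/
def momentSeries (m : (k : ℕ) → (Fin k → Fin n) → ℂ) : FormalMultilinearSeries ℂ (Cn n) ℂ :=
  fun k => ((k.factorial : ℂ)⁻¹) • ∑ s, m k s •
    (ContinuousMultilinearMap.mkPiAlgebra ℂ (Fin k) ℂ).compContinuousLinearMap
      fun j => (EuclideanSpace.proj (s j) : Cn n →L[ℂ] ℂ)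

lemma momentSeries_apply (m : (k : ℕ) → (Fin k → Fin n) → ℂ) (k : ℕ) (z : Cn n) :
    momentSeries m k (fun _ => z) = (k.factorial : ℂ)⁻¹ * ∑ s, m k s * ∏ j, z (s j) := by
  simp [momentSeries]

/-- The moments grow more slowly than `k! R^{-k}` for every `R`. -/
def MomentBound (m : (k : ℕ) → (Fin k → Fin n) → ℂ) : Prop :=
  ∀ R : ℝ, 0 < R → ∃ C : ℝ, ∀ k s, ‖m k s‖ * R ^ k ≤ C * k.factorial

lemma norm_momentSeries_le (m : (k : ℕ) → (Fin k → Fin n) → ℂ) (k : ℕ) :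
    ‖momentSeries m k‖ ≤ (k.factorial : ℝ)⁻¹ * ∑ s, ‖m k s‖ := by
  rw [momentSeries, norm_smul, norm_inv, Complex.norm_natCast]
  gcongr
  refine norm_sum_le_of_le _ fun s _ => ?_
  rw [norm_smul]
  refine mul_le_of_le_one_right (norm_nonneg _) ?_
  refine (ContinuousMultilinearMap.norm_compContinuousLinearMap_le _ _).trans ?_
  rw [ContinuousMultilinearMap.norm_mkPiAlgebra, one_mul]
  refine Finset.prod_le_one (fun _ _ => norm_nonneg _) fun j _ => ?_
  refine ContinuousLinearMap.opNorm_le_bound _ zero_le_one fun z => ?_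
  rw [one_mul]
  exact PiLp.norm_apply_le z (s j)

lemma MomentBound.hasFPowerSeriesOnBall {m : (k : ℕ) → (Fin k → Fin n) → ℂ} (hm : MomentBound m) :
    HasFPowerSeriesOnBall (momentSeries m).sum (momentSeries m) 0 ⊤ := by
  have hr : (momentSeries m).radius = ⊤ := by
    refine ENNReal.eq_top_of_forall_nnreal_le fun r => ?_
    -- There are nᵏ monomials of degree k, each of norm at most 1; the chosen radius exceeds n · r,
    -- so the k-th term of the series at radius `r` stays below `C`.
    obtain ⟨C, hC⟩ := hm ((n + 1) * (r + 1)) (by positivity)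
    refine (momentSeries m).le_radius_of_bound C fun k => ?_
    have hk : (0 : ℝ) < k.factorial := by exact_mod_cast k.factorial_pos
    have h1 : ∀ s : Fin k → Fin n, ‖m k s‖ ≤ C * k.factorial / ((n + 1) * (r + 1)) ^ k := fun s => by
      rw [le_div_iff₀ (by positivity)]; exact hC k s
    have h0 : ‖momentSeries m k‖ ≤ C * (n : ℝ) ^ k / ((n + 1) * (r + 1)) ^ k := by
      refine (norm_momentSeries_le m k).trans ?_
      calc _ ≤ (k.factorial : ℝ)⁻¹ * ∑ _s : Fin k → Fin n,
              C * k.factorial / ((n + 1) * (r + 1)) ^ k := by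
            gcongr with s; exact h1 s
        _ = _ := by
          simp only [Finset.sum_const, Finset.card_univ, Fintype.card_pi, Fintype.card_fin,
            Finset.prod_const, nsmul_eq_mul]
          push_cast
          field_simp
    rcases Nat.eq_zero_or_pos n with hn | hn
    · rcases k with _ | k
      · simpa using h0
      · subst hn
        have : ‖momentSeries m (k + 1)‖ ≤ 0 := by simpa using h0
        have h00 := le_antisymm this (norm_nonneg _)
        have hC0 : 0 ≤ C := by
          have := hC 0 Fin.elim0
          simp only [pow_zero, mul_one, Nat.factorial_zero, Nat.cast_one] at this
          exact (norm_nonneg _).trans this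
        rw [h00, zero_mul]; exact hC0
    · have hC0 : 0 ≤ C := by
        have := hC 0 Fin.elim0
        simp only [pow_zero, mul_one, Nat.factorial_zero, Nat.cast_one] at this
        exact (norm_nonneg _).trans this
      calc _ ≤ (C * (n : ℝ) ^ k / ((n + 1) * (r + 1)) ^ k) * r ^ k := by gcongr
        _ = C * ((n : ℝ) * r) ^ k / ((n + 1) * (r + 1)) ^ k := by rw [mul_pow]; ring
        _ ≤ C := by
          rw [div_le_iff₀ (by positivity)]
          gcongr <;> linarith
  have := (momentSeries m).hasFPowerSeriesOnBall (by rw [hr]; simp)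
  rwa [hr] at this

lemma MomentBound.isEntire {m : (k : ℕ) → (Fin k → Fin n) → ℂ} (hm : MomentBound m) :
    IsEntire (momentSeries m).sum := ⟨_, hm.hasFPowerSeriesOnBall⟩

lemma MomentBound.homogPart_sum {m : (k : ℕ) → (Fin k → Fin n) → ℂ} (hm : MomentBound m)
    (k : ℕ) (z : Cn n) :
    homogPart (momentSeries m).sum k z = (k.factorial : ℂ)⁻¹ * ∑ s, m k s * ∏ j, z (s j) := by
  rw [IsEntire.homogPart_eq hm.hasFPowerSeriesOnBall, momentSeries_apply]

/-! ### Weighted sizes -/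

/-- `|f(z)| e^{-|z|²/2} (1 + |z|)^{-α}`. -/
def wsize (α : ℝ) (f : Cn n → ℂ) (z : Cn n) : ℝ :=
  ‖f z‖ * (Real.exp (-‖z‖ ^ 2 / 2) * (1 + ‖z‖) ^ (-α))

lemma wsize_nonneg (α : ℝ) (f : Cn n → ℂ) (z : Cn n) : 0 ≤ wsize α f z := by
  unfold wsize; positivity

lemma wsize_eq_div (α : ℝ) (f : Cn n → ℂ) (z : Cn n) : wsize α f z = ‖f z‖ / growth α ‖z‖ := by
  rw [wsize, growth, rpow_neg (by positivity), neg_div, Real.exp_neg, ← mul_inv]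
  exact (div_eq_mul_inv _ _).symm

lemma wsize_le_iff {α : ℝ} {f : Cn n → ℂ} {z : Cn n} {M : ℝ} :
    wsize α f z ≤ M ↔ ‖f z‖ ≤ M * growth α ‖z‖ := by
  have hg := growth_pos (β := α) (norm_nonneg z)
  rw [wsize_eq_div, div_le_iff₀ hg]

lemma continuous_wsize (α : ℝ) {f : Cn n → ℂ} (hf : Continuous f) : Continuous (wsize α f) := by
  unfold wsize
  refine hf.norm.mul (Continuous.mul (by fun_prop) ?_)
  exact (continuous_const.add continuous_norm).rpow_const fun z => Or.inl (show 1 + ‖z‖ ≠ 0 by positivity)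

lemma norm_gaussWeighted (f : Cn n → ℂ) (z : Cn n) :
    ‖gaussWeighted f z‖ = ‖f z‖ * Real.exp (-‖z‖ ^ 2 / 2) := by
  rw [gaussWeighted, norm_mul, Complex.norm_real, Real.norm_of_nonneg (Real.exp_pos _).le]

lemma norm_gaussWeightedInf (α : ℝ) (f : Cn n → ℂ) (z : Cn n) :
    ‖gaussWeightedInf α f z‖ = wsize α f z := by
  rw [gaussWeightedInf, norm_mul, norm_gaussWeighted, Complex.norm_real,
    Real.norm_of_nonneg (by positivity), wsize, mul_assoc]

lemma continuous_gaussWeighted {f : Cn n → ℂ} (hf : Continuous f) :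
    Continuous (gaussWeighted f) := by
  unfold gaussWeighted
  exact hf.mul (Complex.continuous_ofReal.comp (by fun_prop))

lemma continuous_gaussWeightedInf (α : ℝ) {f : Cn n → ℂ} (hf : Continuous f) :
    Continuous (gaussWeightedInf α f) := by
  unfold gaussWeightedInf
  refine (continuous_gaussWeighted hf).mul (Complex.continuous_ofReal.comp ?_)
  exact (continuous_const.add continuous_norm).rpow_const fun z => Or.inl (show 1 + ‖z‖ ≠ 0 by positivity)

lemma wsize_rpow_eq {p α : ℝ} (f : Cn n → ℂ) (z : Cn n) :
    wsize α f z ^ p = (1 + ‖z‖) ^ (-(α * p)) * ‖gaussWeighted f z‖ ^ p := by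
  rw [wsize, norm_gaussWeighted, ← mul_assoc, mul_rpow (by positivity) (by positivity),
    ← rpow_mul (by positivity), neg_mul, mul_comm]

lemma integrable_weightedV {α : ℝ} (g : Cn n → ℝ) :
    Integrable g (weightedV n α) ↔ Integrable (fun z => (1 + ‖z‖) ^ (-α) * g z) (V n) := by
  rw [weightedV, integrable_withDensity_iff_integrable_smul₀' (by fun_prop) (by simp)]
  refine integrable_congr (ae_of_all _ fun z => ?_)
  simp only
  rw [ENNReal.toReal_ofReal (by positivity), smul_eq_mul]

lemma integral_weightedV {α : ℝ} (g : Cn n → ℝ) :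
    ∫ z, g z ∂(weightedV n α) = ∫ z, (1 + ‖z‖) ^ (-α) * g z ∂(V n) := by
  rw [weightedV, integral_withDensity_eq_integral_toReal_smul (by fun_prop) (by simp)]
  refine integral_congr_ae (ae_of_all _ fun z => ?_)
  simp only
  rw [ENNReal.toReal_ofReal (by positivity), smul_eq_mul]

/-- With the parameter `α * p` the weight of the measure becomes part of the p-th power of `wsize
α`, so that all later estimates are integrals against `V n`. -/
lemma mem_FockSpace_iff {p α : ℝ} (hp : 0 < p) {f : Cn n → ℂ} :
    f ∈ FockSpace n p (α * p) ↔
      Differentiable ℂ f ∧ Integrable (fun z => wsize α f z ^ p) (V n) := by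
  have : f ∈ FockSpace n p (α * p) ↔ Differentiable ℂ f ∧
    MemLp (gaussWeighted f) (ENNReal.ofReal p) (weightedV n (α * p)) := Iff.rfl
  rw [this]
  refine and_congr_right fun hf => ?_
  rw [← integrable_norm_rpow_iff (continuous_gaussWeighted hf.continuous).aestronglyMeasurable
    (by simpa using hp) ENNReal.ofReal_ne_top, ENNReal.toReal_ofReal hp.le, integrable_weightedV]
  simp_rw [wsize_rpow_eq]

lemma fockNorm_eq {p α : ℝ} (hp : 0 < p) (f : FockSpace n p (α * p)) :
    fockNorm f = (∫ z, wsize α (f : Cn n → ℂ) z ^ p ∂(V n)) ^ p⁻¹ := by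
  rw [fockNorm, MemLp.eLpNorm_eq_integral_rpow_norm (by simpa using hp) ENNReal.ofReal_ne_top f.2.2,
    ENNReal.toReal_ofReal (by positivity), ENNReal.toReal_ofReal hp.le, integral_weightedV]
  simp_rw [wsize_rpow_eq]

lemma fockNorm_nonneg {p α : ℝ} (f : FockSpace n p α) : 0 ≤ fockNorm f := ENNReal.toReal_nonneg

lemma fockNorm_rpow {p α : ℝ} (hp : 0 < p) (f : FockSpace n p (α * p)) :
    fockNorm f ^ p = ∫ z, wsize α (f : Cn n → ℂ) z ^ p ∂(V n) := by
  rw [fockNorm_eq hp, ← rpow_mul (integral_nonneg fun z => rpow_nonneg (wsize_nonneg _ _ _) _),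
    inv_mul_cancel₀ hp.ne', rpow_one]

lemma fockNorm_smul {p α : ℝ} (c : ℂ) (f : FockSpace n p α) :
    fockNorm (c • f) = ‖c‖ * fockNorm f := by
  have : gaussWeighted ((c • f : FockSpace n p α) : Cn n → ℂ) = c • gaussWeighted (f : Cn n → ℂ) := by
    funext z; simp [gaussWeighted, mul_assoc]
  rw [fockNorm, this, eLpNorm_const_smul, ENNReal.toReal_mul, fockNorm]
  simp

lemma mem_FockSpaceInf_of_le {β M : ℝ} {g : Cn n → ℂ} (hg : Differentiable ℂ g)
    (hM : ∀ z, wsize β g z ≤ M) : g ∈ FockSpaceInf n β := by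
  refine ⟨hg, memLp_top_of_bound
    (continuous_gaussWeightedInf β hg.continuous).aestronglyMeasurable M (ae_of_all _ fun z => ?_)⟩
  rw [norm_gaussWeightedInf]; exact hM z

/-- The essential supremum bounds a continuous function everywhere, since sets of full measure are
dense. -/
lemma wsize_le_fockNormInf {β : ℝ} (g : FockSpaceInf n β) (z : Cn n) :
    wsize β (g : Cn n → ℂ) z ≤ fockNormInf g := by
  have hc := continuous_wsize β g.2.1.continuous
  have h : ∀ᵐ z ∂(V n), wsize β (g : Cn n → ℂ) z ≤ fockNormInf g := by
    have h1 := ae_le_eLpNormEssSup (f := gaussWeightedInf β (g : Cn n → ℂ)) (μ := V n)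
    filter_upwards [h1] with z hz
    rw [← norm_gaussWeightedInf, fockNormInf, eLpNorm_exponent_top,
      ← ENNReal.ofReal_le_iff_le_toReal, ofReal_norm]
    · exact hz
    · have := g.2.2.2.ne
      rwa [eLpNorm_exponent_top] at this
  have h2 : Dense {z | wsize β (g : Cn n → ℂ) z ≤ fockNormInf g} := Measure.dense_of_ae h
  have h3 : IsClosed {z | wsize β (g : Cn n → ℂ) z ≤ fockNormInf g} :=
    isClosed_le hc continuous_const
  have := h3.closure_eq ▸ h2 z
  exact this

lemma fockNormInf_le {β M : ℝ} (hM : 0 ≤ M) (g : FockSpaceInf n β)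
    (h : ∀ z, wsize β (g : Cn n → ℂ) z ≤ M) : fockNormInf g ≤ M := by
  rw [fockNormInf, eLpNorm_exponent_top]
  refine ENNReal.toReal_le_of_le_ofReal hM (eLpNormEssSup_le_of_ae_bound (ae_of_all _ fun z => ?_))
  rw [norm_gaussWeightedInf]; exact h z

/-! ### Pointwise and norm estimates in Fock spaces -/

/-- `|F|^p` is subharmonic, for every `p > 0`. -/
lemma norm_rpow_le_circleAverage {F : ℂ → ℂ} (hF : Differentiable ℂ F) {p : ℝ} (hp : 0 < p) :
    ‖F 0‖ ^ p ≤ Real.circleAverage (fun l => ‖F l‖ ^ p) 0 1 := by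
  have hA : AnalyticOnNhd ℂ F Set.univ := fun z _ => hF.analyticAt z
  by_cases h0 : F 0 = 0
  · rw [h0, norm_zero, zero_rpow hp.ne']
    exact Real.circleAverage_nonneg_of_nonneg fun l _ => by positivity
  have hF0 : 0 < ‖F 0‖ := norm_pos_iff.mpr h0
  have hJ := AnalyticOnNhd.circleAverage_log_norm (c := 0) (R := 1) one_ne_zero
    (hA.mono (Set.subset_univ _)) h0
  -- Jensen's formula: each zero in the closed disc contributes a nonnegative term.
  have hlog : Real.log ‖F 0‖ ≤ Real.circleAverage (fun l => Real.log ‖F l‖) 0 1 := by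
    rw [hJ]
    refine le_add_of_nonneg_left (finsum_nonneg fun u => ?_)
    by_cases hu : u ∈ Metric.closedBall (0 : ℂ) |1|
    · refine mul_nonneg ?_ ?_
      · have := (hA.mono (Set.subset_univ (Metric.closedBall (0 : ℂ) |1|))).meromorphicOn
        exact_mod_cast (MeromorphicOn.AnalyticOnNhd.divisor_nonneg
          (hA.mono (Set.subset_univ (Metric.closedBall (0 : ℂ) |1|)))) u
      · rw [one_mul, zero_sub, norm_neg]
        have h1 : ‖u‖ ≤ 1 := by simpa using hu
        rcases eq_or_ne u 0 with rfl | hu0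
        · simp
        · exact Real.log_nonneg ((one_le_inv₀ (norm_pos_iff.mpr hu0)).mpr h1)
    · rw [Function.locallyFinsuppWithin.apply_eq_zero_of_notMem _ hu]
      simp
  have hlogint : CircleIntegrable (fun l => Real.log ‖F l‖) 0 1 :=
    MeromorphicOn.circleIntegrable_log_norm (hA.mono (Set.subset_univ _)).meromorphicOn
  -- By log t ≤ t - 1 with t = |F(l)|^p/|F(0)|^p, the function `G` lies below the normalized |F|^p
  -- off the zeros of F. Its average is at least 1 by the previous inequality.
  let G : ℂ → ℝ := fun l => (1 - p * Real.log ‖F 0‖) + p * Real.log ‖F l‖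
  have hGint : CircleIntegrable G 0 1 := by
    have h1 : CircleIntegrable (fun _ : ℂ => 1 - p * Real.log ‖F 0‖) 0 1 := circleIntegrable_const _ _ _
    have h2 : CircleIntegrable (fun l : ℂ => p * Real.log ‖F l‖) 0 1 := hlogint.const_smul (a := p)
    exact h1.add h2
  have hGavg : 1 ≤ Real.circleAverage G 0 1 := by
    have h1 : CircleIntegrable (fun _ : ℂ => 1 - p * Real.log ‖F 0‖) 0 1 := circleIntegrable_const _ _ _
    have h2 : CircleIntegrable (fun l : ℂ => p * Real.log ‖F l‖) 0 1 := hlogint.const_smul (a := p)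
    have h3 := Real.circleAverage_fun_add h1 h2
    have h4 := Real.circleAverage_fun_smul (a := p) (f := fun l => Real.log ‖F l‖) (c := 0) (R := 1)
    simp only [smul_eq_mul] at h4
    rw [h4, Real.circleAverage_const] at h3
    change 1 ≤ Real.circleAverage (fun l => (1 - p * Real.log ‖F 0‖) + p * Real.log ‖F l‖) 0 1
    rw [h3]
    nlinarith
  let H : ℂ → ℝ := fun l => ‖F l‖ ^ p / ‖F 0‖ ^ p
  -- At zeros of F the convention log 0 = 0 may put `G` above `H`. The values there are raised; the
  -- zeros are discrete, so circle averages do not change.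
  let H' : ℂ → ℝ := fun l => if F l = 0 then max (G l) 0 else H l
  have hHH' : H =ᶠ[Filter.codiscreteWithin (Metric.sphere (0 : ℂ) |1|)] H' := by
    have h1 := hA.preimage_zero_mem_codiscrete h0
    have h2 := Filter.codiscreteWithin_mono (Set.subset_univ (Metric.sphere (0 : ℂ) |1|)) h1
    filter_upwards [h2] with l hl
    have : F l ≠ 0 := by simpa using hl
    simp [H', this]
  have hcont : Continuous H := by
    have := hF.continuous
    exact (this.norm.rpow_const fun _ => Or.inr hp.le).div_const _
  have hHint : CircleIntegrable H 0 1 := (hcont.continuousOn).circleIntegrable (by norm_num)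
  have hH'int : CircleIntegrable H' 0 1 := hHint.congr_codiscreteWithin hHH'
  have hle : Real.circleAverage G 0 1 ≤ Real.circleAverage H' 0 1 := by
    refine Real.circleAverage_mono hGint hH'int fun l _ => ?_
    by_cases hl : F l = 0
    · simp [H', hl]
    · simp only [H', hl, if_false, H, G]
      have hFl : 0 < ‖F l‖ := norm_pos_iff.mpr hl
      have ht : 0 < ‖F l‖ ^ p / ‖F 0‖ ^ p := by positivity
      have := Real.log_le_sub_one_of_pos ht
      rw [Real.log_div (by positivity) (by positivity), Real.log_rpow hFl, Real.log_rpow hF0] at this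
      linarith
  rw [← Real.circleAverage_congr_codiscreteWithin hHH' one_ne_zero] at hle
  have hfin : 1 ≤ Real.circleAverage H 0 1 := hGavg.trans hle
  have h5 : Real.circleAverage H 0 1 = (‖F 0‖ ^ p)⁻¹ * Real.circleAverage (fun l => ‖F l‖ ^ p) 0 1 := by
    have h4 := Real.circleAverage_fun_smul (a := (‖F 0‖ ^ p)⁻¹) (f := fun l => ‖F l‖ ^ p) (c := 0) (R := 1)
    simp only [smul_eq_mul] at h4
    rw [← h4]
    simp only [H, div_eq_inv_mul]
  rw [h5, ← div_eq_inv_mul, one_le_div (by positivity)] at hfin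
  exact hfin

/-- The cross term of |z + u|² is the exponent of a modulus of a function holomorphic in u. Gaussian
weights can therefore be translated without leaving the holomorphic functions. -/
lemma norm_exp_neg_inner (z u : Cn n) :
    ‖Complex.exp (-inner ℂ z u)‖ * Real.exp (-‖z‖ ^ 2 / 2) * Real.exp (-‖u‖ ^ 2 / 2)
      = Real.exp (-‖z + u‖ ^ 2 / 2) := by
  rw [Complex.norm_exp, ← Real.exp_add, ← Real.exp_add]
  congr 1
  have := norm_add_sq (𝕜 := ℂ) z u
  simp only [RCLike.re_to_complex] at this
  rw [this, Complex.neg_re]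
  ring

lemma differentiable_inner_right (w : Cn n) : Differentiable ℂ fun z : Cn n => inner ℂ w z :=
  (innerSL ℂ w).differentiable

lemma integrable_gaussian_rpow (hn : 1 ≤ n) {p : ℝ} (hp : 0 < p) (s : ℝ) :
    Integrable (fun u : Cn n => (Real.exp (-‖u‖ ^ 2 / 2) * (1 + ‖u‖) ^ s) ^ p) (V n) := by
  refine (integrable_one_add_norm_rpow_mul_exp hn (c := p / 2) (by positivity) (s * p)).congr
    (ae_of_all _ fun u => ?_)
  simp only
  rw [mul_rpow (by positivity) (by positivity), ← Real.exp_mul, ← rpow_mul (by positivity)]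
  congr 2; ring

lemma integral_gaussian_rpow_pos (hn : 1 ≤ n) {p : ℝ} (hp : 0 < p) (s : ℝ) :
    0 < ∫ u : Cn n, (Real.exp (-‖u‖ ^ 2 / 2) * (1 + ‖u‖) ^ s) ^ p ∂(V n) := by
  rw [integral_pos_iff_support_of_nonneg (fun u => by positivity) (integrable_gaussian_rpow hn hp s),
    Set.eq_univ_of_forall (s := Function.support _) fun u => ?_]
  · exact Measure.measure_univ_pos.mpr (NeZero.ne (V n))
  · rw [Function.mem_support]
    positivity

/-- The sub-mean value property with respect to Gaussian weights. -/
lemma wsize_rpow_mul_le (hn : 1 ≤ n) {p : ℝ} (α : ℝ) (hp : 0 < p) {f : Cn n → ℂ}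
    (hf : Differentiable ℂ f) (hint : Integrable (fun z => wsize α f z ^ p) (V n)) (z : Cn n) :
    wsize α f z ^ p * ∫ u : Cn n, (Real.exp (-‖u‖ ^ 2 / 2) * (1 + ‖u‖) ^ (-|α|)) ^ p ∂(V n)
      ≤ ∫ u, wsize α f u ^ p ∂(V n) := by
  -- The translate of f is multiplied by e^{-⟨z, u⟩}, so that H(0) = f(z) and |f(z+u)|e^{-|z+u|²/2}
  -- = |H(u)| e^{-|u|²/2} e^{-|z|²/2}.
  let H : Cn n → ℂ := fun u => f (z + u) * Complex.exp (-inner ℂ z u)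
  have hH : Differentiable ℂ H :=
    (hf.comp ((differentiable_const z).add differentiable_id)).mul
      (differentiable_inner_right z).neg.cexp
  let ψ : Cn n → ℝ := fun u => Real.exp (-‖u‖ ^ 2 / 2) * (1 + ‖u‖) ^ (-|α|)
  have hψ0 : ∀ u, 0 < ψ u := fun u => by simp only [ψ]; positivity
  have hψc : Continuous ψ := by
    refine Continuous.mul (by fun_prop) ?_
    exact (continuous_const.add continuous_norm).rpow_const fun z =>
      Or.inl (show 1 + ‖z‖ ≠ 0 by positivity)
  set c : ℝ := Real.exp (-‖z‖ ^ 2 / 2) * (1 + ‖z‖) ^ (-α) with hc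
  have hc0 : 0 < c := by positivity
  have hle : ∀ u, c * (‖H u‖ * ψ u) ≤ wsize α f (z + u) := by
    intro u
    have h1 := norm_exp_neg_inner z u
    have h2 := one_add_rpow_le_mul (x := ‖z‖) (y := ‖z + u‖) (d := ‖u‖) (-α) (norm_nonneg _)
      (norm_nonneg _) (by simpa using abs_norm_sub_norm_le z (z + u))
    rw [abs_neg] at h2
    have h3 : (1 + ‖z‖) ^ (-α) * (1 + ‖u‖) ^ (-|α|) ≤ (1 + ‖z + u‖) ^ (-α) := by
      rw [rpow_neg (y := |α|) (by positivity), ← div_eq_mul_inv, div_le_iff₀ (by positivity)]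
      exact h2
    rw [wsize, ← h1]
    simp only [H, ψ, norm_mul, hc]
    calc _ = ‖f (z + u)‖ * (‖Complex.exp (-inner ℂ z u)‖ * Real.exp (-‖z‖ ^ 2 / 2)
            * Real.exp (-‖u‖ ^ 2 / 2)) * ((1 + ‖z‖) ^ (-α) * (1 + ‖u‖) ^ (-|α|)) := by ring
      _ ≤ ‖f (z + u)‖ * (‖Complex.exp (-inner ℂ z u)‖ * Real.exp (-‖z‖ ^ 2 / 2)
            * Real.exp (-‖u‖ ^ 2 / 2)) * (1 + ‖z + u‖) ^ (-α) := by gcongr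
      _ = _ := by ring
  have htrans : Integrable (fun u => wsize α f (z + u) ^ p) (V n) := hint.comp_add_left z
  let F : Cn n → ℝ := fun u => (‖H u‖ * ψ u) ^ p
  have hFle : ∀ u, c ^ p * F u ≤ wsize α f (z + u) ^ p := fun u => by
    have := hψ0 u
    simp only [F]
    rw [← mul_rpow hc0.le (by positivity)]
    exact rpow_le_rpow (by positivity) (hle u) hp.le
  have hF0 : ∀ u, 0 ≤ F u := fun u => by have := hψ0 u; simp only [F]; positivity
  have hFc : Continuous F := (hH.continuous.norm.mul hψc).rpow_const fun _ => Or.inr hp.le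
  have hFint : Integrable F (V n) := by
    refine (htrans.const_mul (c ^ p)⁻¹).mono' hFc.aestronglyMeasurable (ae_of_all _ fun u => ?_)
    rw [Real.norm_of_nonneg (hF0 u), ← div_eq_inv_mul, le_div_iff₀ (by positivity), mul_comm]
    exact hFle u
  obtain ⟨hai, ha⟩ := integral_eq_integral_circleAverage hFint
  -- Subharmonicity is used only on complex lines through 0; `ψ` is radial, hence constant on the
  -- circles over which the average is taken.
  have hrot : ∀ u, ‖H 0‖ ^ p * ψ u ^ p ≤ Real.circleAverage (fun l => F (l • u)) 0 1 := by
    intro u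
    have h1 := norm_rpow_le_circleAverage (F := fun l : ℂ => H (l • u))
      (hH.comp (differentiable_id.smul_const u)) hp
    simp only [zero_smul] at h1
    have h2 : Real.circleAverage (fun l => F (l • u)) 0 1
        = Real.circleAverage (fun l => ψ u ^ p • ‖H (l • u)‖ ^ p) 0 1 := by
      refine Real.circleAverage_congr_sphere fun l hl => ?_
      have hl1 : ‖l‖ = 1 := by simpa using hl
      simp only [F, ψ, norm_smul, hl1, one_mul, smul_eq_mul]
      rw [mul_rpow (by positivity) (by positivity), mul_comm]
    rw [h2, Real.circleAverage_fun_smul, smul_eq_mul, mul_comm]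
    exact mul_le_mul_of_nonneg_left h1 (by have := hψ0 u; positivity)
  have hψi : Integrable (fun u => ψ u ^ p) (V n) := integrable_gaussian_rpow hn hp _
  have hH0 : ‖H 0‖ = ‖f z‖ := by simp [H]
  calc wsize α f z ^ p * ∫ u, ψ u ^ p ∂(V n)
      = c ^ p * ∫ u, ‖H 0‖ ^ p * ψ u ^ p ∂(V n) := by
        rw [integral_const_mul, hH0, wsize, ← hc, mul_rpow (by positivity) hc0.le]; ring
    _ ≤ c ^ p * ∫ u, Real.circleAverage (fun l => F (l • u)) 0 1 ∂(V n) := by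
        exact mul_le_mul_of_nonneg_left (integral_mono (hψi.const_mul _) hai hrot) (by positivity)
    _ = ∫ u, c ^ p * F u ∂(V n) := by rw [← ha, integral_const_mul]
    _ ≤ ∫ u, wsize α f (z + u) ^ p ∂(V n) := integral_mono (hFint.const_mul _) htrans hFle
    _ = _ := integral_add_left_eq_self (fun u => wsize α f u ^ p) z

/-- Pointwise estimate in `F^p`. -/
theorem exists_wsize_le_fockNorm (hn : 1 ≤ n) {p : ℝ} (α : ℝ) (hp : 0 < p) :
    ∃ C : ℝ, 0 < C ∧ ∀ (f : FockSpace n p (α * p)) (z : Cn n),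
      wsize α (f : Cn n → ℂ) z ≤ C * fockNorm f := by
  set κ : ℝ := ∫ u : Cn n, (Real.exp (-‖u‖ ^ 2 / 2) * (1 + ‖u‖) ^ (-|α|)) ^ p ∂(V n) with hκ
  have hκ0 : 0 < κ := integral_gaussian_rpow_pos hn hp _
  refine ⟨(κ⁻¹) ^ p⁻¹, by positivity, fun f z => ?_⟩
  obtain ⟨hd, hi⟩ := (mem_FockSpace_iff hp).mp f.2
  have h := wsize_rpow_mul_le hn α hp hd hi z
  rw [← hκ, ← fockNorm_rpow hp, ← le_div_iff₀ hκ0] at h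
  have hN := fockNorm_nonneg f
  have hw := wsize_nonneg α (f : Cn n → ℂ) z
  rw [← rpow_le_rpow_iff hw (by positivity) hp, mul_rpow (by positivity) hN,
    ← rpow_mul (by positivity), inv_mul_cancel₀ hp.ne', rpow_one]
  rwa [← div_eq_inv_mul]

/-- `F^p ⊂ F^1` for `p ≤ 1`. -/
theorem exists_integral_wsize_le_fockNorm (hn : 1 ≤ n) {p : ℝ} (α : ℝ) (hp : 0 < p) (hp1 : p ≤ 1) :
    ∃ C : ℝ, 0 < C ∧ ∀ f : FockSpace n p (α * p),
      Integrable (wsize α (f : Cn n → ℂ)) (V n) ∧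
      ∫ z, wsize α (f : Cn n → ℂ) z ∂(V n) ≤ C * fockNorm f := by
  obtain ⟨C, hC, h⟩ := exists_wsize_le_fockNorm hn α hp
  refine ⟨C ^ (1 - p), by positivity, fun f => ?_⟩
  obtain ⟨hd, hi⟩ := (mem_FockSpace_iff hp).mp f.2
  have hN := fockNorm_nonneg f
  -- One factor to the power 1 - p ≥ 0 is bounded pointwise by the norm, and the p-th power is left
  -- to integrate.
  have hle : ∀ z, wsize α (f : Cn n → ℂ) z ≤
      (C * fockNorm f) ^ (1 - p) * wsize α (f : Cn n → ℂ) z ^ p := by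
    intro z
    have hw := wsize_nonneg α (f : Cn n → ℂ) z
    have e : wsize α (f : Cn n → ℂ) z
        = wsize α (f : Cn n → ℂ) z ^ (1 - p) * wsize α (f : Cn n → ℂ) z ^ p := by
      rw [← rpow_add' hw (by simp), sub_add_cancel, rpow_one]
    calc _ = wsize α (f : Cn n → ℂ) z ^ (1 - p) * wsize α (f : Cn n → ℂ) z ^ p := e
      _ ≤ _ := mul_le_mul_of_nonneg_right (rpow_le_rpow hw (h f z) (sub_nonneg.mpr hp1))
        (rpow_nonneg hw _)
  have hint : Integrable (wsize α (f : Cn n → ℂ)) (V n) := by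
    refine (hi.const_mul ((C * fockNorm f) ^ (1 - p))).mono'
      (continuous_wsize α hd.continuous).aestronglyMeasurable (ae_of_all _ fun z => ?_)
    rw [Real.norm_of_nonneg (wsize_nonneg _ _ _)]
    exact hle z
  refine ⟨hint, (integral_mono hint (hi.const_mul _) hle).trans_eq ?_⟩
  rw [integral_const_mul, ← fockNorm_rpow hp, mul_rpow hC.le hN, mul_assoc,
    ← rpow_add' hN (by simp), sub_add_cancel, rpow_one]

lemma exists_mem_FockSpace_of_wsize_le {p α : ℝ} (hp : 0 < p) {f : Cn n → ℂ}
    (hf : Differentiable ℂ f) {h : Cn n → ℝ} (hle : ∀ z, wsize α f z ≤ h z)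
    (hi : Integrable (fun z => h z ^ p) (V n)) :
    ∃ hm : f ∈ FockSpace n p (α * p),
      fockNorm (⟨f, hm⟩ : FockSpace n p (α * p)) ≤ (∫ z, h z ^ p ∂(V n)) ^ p⁻¹ := by
  have hle' : ∀ z, wsize α f z ^ p ≤ h z ^ p := fun z =>
    rpow_le_rpow (wsize_nonneg _ _ _) (hle z) hp.le
  have hint : Integrable (fun z => wsize α f z ^ p) (V n) := by
    refine hi.mono' ((continuous_wsize α hf.continuous).rpow_const
      fun _ => Or.inr hp.le).aestronglyMeasurable (ae_of_all _ fun z => ?_)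
    rw [Real.norm_of_nonneg (rpow_nonneg (wsize_nonneg _ _ _) _)]
    exact hle' z
  refine ⟨(mem_FockSpace_iff hp).mpr ⟨hf, hint⟩, ?_⟩
  rw [fockNorm_eq hp]
  exact rpow_le_rpow (integral_nonneg fun z => rpow_nonneg (wsize_nonneg _ _ _) _)
    (integral_mono hint hi hle') (by positivity)

/-- Functions of Gaussian growth less than critical lie in `F^p`. -/
theorem exists_fockNorm_le_of_gaussian (hn : 1 ≤ n) {p : ℝ} (α : ℝ) (hp : 0 < p) {ρ : ℝ}
    (hρ : ρ < 1) :
    ∃ C : ℝ, 0 < C ∧ ∀ (f : Cn n → ℂ) (A : ℝ), Differentiable ℂ f → 0 ≤ A →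
      (∀ z, ‖f z‖ ≤ A * Real.exp (ρ * ‖z‖ ^ 2 / 2)) →
      ∃ hm : f ∈ FockSpace n p (α * p),
        fockNorm (⟨f, hm⟩ : FockSpace n p (α * p)) ≤ C * A := by
  let h : Cn n → ℝ := fun z => Real.exp (-(1 - ρ) / 2 * ‖z‖ ^ 2) * (1 + ‖z‖) ^ (-α)
  have hi : Integrable (fun z => h z ^ p) (V n) := by
    refine (integrable_one_add_norm_rpow_mul_exp hn (c := p * (1 - ρ) / 2)
      (by have := sub_pos.mpr hρ; positivity) (-α * p)).congr (ae_of_all _ fun u => ?_)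
    simp only [h]
    rw [mul_rpow (by positivity) (by positivity), ← Real.exp_mul, ← rpow_mul (by positivity)]
    congr 2; ring
  have hI : 0 ≤ ∫ z, h z ^ p ∂(V n) := integral_nonneg fun z => by positivity
  refine ⟨(∫ z, h z ^ p ∂(V n)) ^ p⁻¹ + 1, by positivity, fun f A hf hA hle => ?_⟩
  obtain ⟨hm, hb⟩ := exists_mem_FockSpace_of_wsize_le (α := α) hp hf (h := fun z => A * h z)
    (fun z => by
      have e : Real.exp (-(1 - ρ) / 2 * ‖z‖ ^ 2)
          = Real.exp (ρ * ‖z‖ ^ 2 / 2) * Real.exp (-‖z‖ ^ 2 / 2) := by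
        rw [← Real.exp_add]; congr 1; ring
      simp only [wsize, h, e]
      calc _ ≤ A * Real.exp (ρ * ‖z‖ ^ 2 / 2) * (Real.exp (-‖z‖ ^ 2 / 2) * (1 + ‖z‖) ^ (-α)) := by
            gcongr; exact hle z
        _ = _ := by ring)
    ((hi.const_mul (A ^ p)).congr (ae_of_all _ fun z => by
      simp only [h]; rw [mul_rpow hA (by positivity)]))
  refine ⟨hm, hb.trans ?_⟩
  have e : ∫ z, (A * h z) ^ p ∂(V n) = A ^ p * ∫ z, h z ^ p ∂(V n) := by
    rw [← integral_const_mul]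
    refine integral_congr_ae (ae_of_all _ fun z => ?_)
    simp only [h]; rw [mul_rpow hA (by positivity)]
  rw [e, mul_rpow (by positivity) hI, ← rpow_mul hA, mul_inv_cancel₀ hp.ne', rpow_one]
  nlinarith

/-- The reproducing kernel `K_w(z) = e^{⟨z, w⟩}`. -/
def kernel (w z : Cn n) : ℂ := Complex.exp (inner ℂ w z)

lemma differentiable_kernel (w : Cn n) : Differentiable ℂ (kernel w) :=
  (differentiable_inner_right w).cexp

lemma norm_kernel_le (w z : Cn n) : ‖kernel w z‖ ≤ Real.exp (‖w‖ * ‖z‖) := by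
  rw [kernel, Complex.norm_exp, Real.exp_le_exp]
  exact (Complex.re_le_norm _).trans (norm_inner_le_norm w z)

/-- The weighted kernel |K_w(z)|e^{-|z|²/2} = e^{|w|²/2}e^{-|z-w|²/2} is a Gaussian bump at w, on
which Peetre's inequality replaces (1+|z|)^{-α} by (1+|w|)^{-α}. This is the source of the exponent
-α in the growth of functionals on kernels. -/
theorem exists_fockNorm_kernel_le (hn : 1 ≤ n) {p : ℝ} (α : ℝ) (hp : 0 < p) :
    ∃ C : ℝ, 0 < C ∧ ∀ w : Cn n, ∃ hm : kernel w ∈ FockSpace n p (α * p),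
      fockNorm (⟨kernel w, hm⟩ : FockSpace n p (α * p)) ≤ C * growth (-α) ‖w‖ := by
  have hi := integrable_gaussian_rpow hn hp |α|
  have hI := integral_gaussian_rpow_pos hn hp |α|
  let ψ : Cn n → ℝ := fun u => Real.exp (-‖u‖ ^ 2 / 2) * (1 + ‖u‖) ^ |α|
  refine ⟨(∫ u : Cn n, ψ u ^ p ∂(V n)) ^ p⁻¹, by positivity, fun w => ?_⟩
  have hg := growth_pos (β := -α) (norm_nonneg w)
  have hψ : ∀ u, 0 ≤ ψ u := fun u => by simp only [ψ]; positivity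
  obtain ⟨hm, hb⟩ := exists_mem_FockSpace_of_wsize_le (α := α) hp (differentiable_kernel w)
    (h := fun z => growth (-α) ‖w‖ * ψ (z - w)) (fun z => by
      have h1 := norm_exp_neg_inner (-w) z
      have h2 := one_add_rpow_le_mul (x := ‖z‖) (y := ‖w‖) (d := ‖z - w‖) (-α) (norm_nonneg _)
        (norm_nonneg _) (abs_norm_sub_norm_le z w)
      rw [abs_neg] at h2
      rw [inner_neg_left, neg_neg, norm_neg, neg_add_eq_sub] at h1
      have h3 : ‖kernel w z‖ * Real.exp (-‖z‖ ^ 2 / 2)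
          = Real.exp (‖w‖ ^ 2 / 2) * Real.exp (-‖z - w‖ ^ 2 / 2) := by
        rw [← h1, kernel, mul_comm ‖_‖ (Real.exp (-‖w‖ ^ 2 / 2)), mul_assoc, ← mul_assoc (Real.exp (‖w‖ ^ 2 / 2)),
          ← Real.exp_add]
        simp [neg_div]
      simp only [wsize, growth, ψ]
      rw [← mul_assoc, h3]
      calc _ ≤ Real.exp (‖w‖ ^ 2 / 2) * Real.exp (-‖z - w‖ ^ 2 / 2)
            * ((1 + ‖w‖) ^ (-α) * (1 + ‖z - w‖) ^ |α|) := by gcongr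
        _ = _ := by ring)
    (((hi.comp_sub_right w).const_mul (growth (-α) ‖w‖ ^ p)).congr (ae_of_all _ fun z => by
      simp only [ψ]; rw [mul_rpow hg.le (hψ _)]))
  refine ⟨hm, hb.trans_eq ?_⟩
  have e : ∫ z, (growth (-α) ‖w‖ * ψ (z - w)) ^ p ∂(V n)
      = growth (-α) ‖w‖ ^ p * ∫ z, ψ z ^ p ∂(V n) := by
    rw [← integral_sub_right_eq_self (fun z => ψ z ^ p) w, ← integral_const_mul]
    refine integral_congr_ae (ae_of_all _ fun z => ?_)
    simp only; rw [mul_rpow hg.le (hψ _)]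
  rw [e, mul_rpow (by positivity) (integral_nonneg fun z => rpow_nonneg (hψ z) _), ← rpow_mul hg.le,
    mul_inv_cancel₀ hp.ne', rpow_one, mul_comm]

/-! ### The reproducing formula -/

/-- The mean value property on each circle l ↦ lu, against a radial weight of total mass 1. -/
lemma integral_mul_exp_neg_norm_sq {H : Cn n → ℂ} (hH : Differentiable ℂ H)
    (hi : Integrable (fun u => H u * (Real.exp (-‖u‖ ^ 2) : ℂ)) (V n)) :
    ∫ u, H u * (Real.exp (-‖u‖ ^ 2) : ℂ) ∂(V n) = H 0 := by
  have hrot : ∀ u : Cn n, Real.circleAverage (fun l : ℂ => H (l • u) * (Real.exp (-‖l • u‖ ^ 2) : ℂ)) 0 1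
      = (Real.exp (-‖u‖ ^ 2) : ℂ) • H 0 := by
    intro u
    have h1 : Differentiable ℂ fun l : ℂ => H (l • u) := hH.comp (differentiable_id.smul_const u)
    have h2 := (h1.diffContOnCl (s := Metric.ball (0 : ℂ) |1|)).circleAverage
    simp only [zero_smul] at h2
    rw [← h2, ← Real.circleAverage_fun_smul]
    refine Real.circleAverage_congr_sphere fun l hl => ?_
    have hl1 : ‖l‖ = 1 := by simpa using hl
    simp only [norm_smul, hl1, one_mul, smul_eq_mul]
    ring
  rw [(integral_eq_integral_circleAverage hi).2]
  simp_rw [hrot, smul_eq_mul]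
  rw [integral_mul_const, integral_complex_ofReal, integral_exp_neg_norm_sq]
  simp

lemma integrable_of_norm_le_gaussian (hn : 1 ≤ n) {E : Type*} [NormedAddCommGroup E]
    {F : Cn n → E} (hF : AEStronglyMeasurable F (V n)) {A c s : ℝ} (hc : 0 < c)
    (h : ∀ u, ‖F u‖ ≤ A * (Real.exp (-c * ‖u‖ ^ 2) * (1 + ‖u‖) ^ s)) : Integrable F (V n) :=
  ((integrable_one_add_norm_rpow_mul_exp hn hc s).const_mul A).mono' hF (ae_of_all _ h)

/-- Of the weight e^{-|u|²} half is used by the growth of f, and half of the rest absorbs e^{R|u|} ≤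
e^{R²}e^{|u|²/4}. -/
lemma norm_mul_exp_le {α M : ℝ} {f : Cn n → ℂ} (hM : ∀ z, wsize α f z ≤ M) (R : ℝ) (u : Cn n) :
    ‖f u‖ * Real.exp (R * ‖u‖) * Real.exp (-‖u‖ ^ 2) ≤
      M * Real.exp (R ^ 2) * (Real.exp (-(1 / 4) * ‖u‖ ^ 2) * (1 + ‖u‖) ^ α) := by
  have h1 := wsize_le_iff.mp (hM u)
  have hM0 : 0 ≤ M := (wsize_nonneg _ _ _).trans (hM 0)
  have h2 : Real.exp (R * ‖u‖) ≤ Real.exp (R ^ 2) * Real.exp (1 / 4 * ‖u‖ ^ 2) := by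
    rw [← Real.exp_add, Real.exp_le_exp]
    nlinarith [sq_nonneg (R - ‖u‖ / 2)]
  have hg := growth_pos (β := α) (norm_nonneg u)
  calc _ ≤ M * growth α ‖u‖ * (Real.exp (R ^ 2) * Real.exp (1 / 4 * ‖u‖ ^ 2)) *
        Real.exp (-‖u‖ ^ 2) := by gcongr
    _ = M * Real.exp (R ^ 2) * ((Real.exp (‖u‖ ^ 2 / 2) * Real.exp (1 / 4 * ‖u‖ ^ 2) *
        Real.exp (-‖u‖ ^ 2)) * (1 + ‖u‖) ^ α) := by rw [growth]; ring
    _ = _ := by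
      rw [← Real.exp_add, ← Real.exp_add]
      congr 4; ring

lemma integrable_reproducing (hn : 1 ≤ n) {α M : ℝ} {f : Cn n → ℂ} (hf : Continuous f)
    (hM : ∀ z, wsize α f z ≤ M) (z : Cn n) :
    Integrable (fun u => f u * Complex.exp (inner ℂ u z) * (Real.exp (-‖u‖ ^ 2) : ℂ)) (V n) := by
  refine integrable_of_norm_le_gaussian hn (Continuous.aestronglyMeasurable (by fun_prop))
    (A := M * Real.exp (‖z‖ ^ 2)) (c := 1 / 4) (s := α) (by norm_num) fun u => ?_
  rw [norm_mul, norm_mul, Complex.norm_real, Real.norm_of_nonneg (Real.exp_pos _).le]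
  refine le_trans ?_ (norm_mul_exp_le hM ‖z‖ u)
  gcongr
  rw [mul_comm]
  exact norm_kernel_le u z

/-- The reproducing formula `f(z) = ∫ f(u) e^{⟨z, u⟩} e^{-|u|²} dV(u)`. -/
theorem integral_reproducing (hn : 1 ≤ n) {α M : ℝ} {f : Cn n → ℂ} (hf : Differentiable ℂ f)
    (hM : ∀ z, wsize α f z ≤ M) (z : Cn n) :
    ∫ u, f u * Complex.exp (inner ℂ u z) * (Real.exp (-‖u‖ ^ 2) : ℂ) ∂(V n) = f z := by
  have hi := (integrable_reproducing hn hf.continuous hM z).comp_add_left z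
  rw [← integral_add_left_eq_self _ z]
  -- After the translation the antiholomorphic dependence cancels: ⟨z+v, z⟩ - |z+v|² = -⟨z, v⟩ -
  -- |v|², with the inner product linear in its second argument.
  have e : ∀ v : Cn n, f (z + v) * Complex.exp (inner ℂ (z + v) z) * (Real.exp (-‖z + v‖ ^ 2) : ℂ)
      = f (z + v) * Complex.exp (-inner ℂ z v) * (Real.exp (-‖v‖ ^ 2) : ℂ) := by
    intro v
    have h1 : ((‖z + v‖ ^ 2 : ℝ) : ℂ) = inner ℂ (z + v) (z + v) := by
      rw [inner_self_eq_norm_sq_to_K]; push_cast; rfl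
    have h2 : ((‖v‖ ^ 2 : ℝ) : ℂ) = inner ℂ v v := by
      rw [inner_self_eq_norm_sq_to_K]; push_cast; rfl
    rw [mul_assoc, mul_assoc, Complex.ofReal_exp, Complex.ofReal_exp, ← Complex.exp_add,
      ← Complex.exp_add, Complex.ofReal_neg, Complex.ofReal_neg, h1, h2]
    congr 2
    simp only [inner_add_left, inner_add_right]
    ring
  simp_rw [e] at hi ⊢
  have hH : Differentiable ℂ fun v : Cn n => f (z + v) * Complex.exp (-inner ℂ z v) :=
    (hf.comp ((differentiable_const z).add differentiable_id)).mul
      (differentiable_inner_right z).neg.cexp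
  rw [integral_mul_exp_neg_norm_sq hH hi]
  simp

/-- The moments `∫ f(u) conj(u_{s(1)} ⋯ u_{s(k)}) e^{-|u|²} dV(u)`. -/
def moment (f : Cn n → ℂ) (k : ℕ) (s : Fin k → Fin n) : ℂ :=
  ∫ u, f u * conj (∏ j, u (s j)) * (Real.exp (-‖u‖ ^ 2) : ℂ) ∂(V n)

lemma norm_prod_coord_le {k : ℕ} (s : Fin k → Fin n) (u : Cn n) : ‖∏ j, u (s j)‖ ≤ ‖u‖ ^ k := by
  rw [norm_prod]
  calc _ ≤ ∏ _j : Fin k, ‖u‖ := by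
        gcongr with j; exact PiLp.norm_apply_le u (s j)
    _ = _ := by simp

lemma pow_mul_pow_le_factorial_mul_exp (k : ℕ) {x : ℝ} (hx : 0 ≤ x) :
    x ^ k ≤ k.factorial * Real.exp x := by
  have h := Real.pow_div_factorial_le_exp x hx k
  rwa [div_le_iff₀' (by exact_mod_cast k.factorial_pos)] at h

lemma continuous_coord_prod {k : ℕ} (s : Fin k → Fin n) :
    Continuous fun u : Cn n => ∏ j, u (s j) := by fun_prop

lemma integrable_moment (hn : 1 ≤ n) {α M : ℝ} {f : Cn n → ℂ} (hf : Continuous f)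
    (hM : ∀ z, wsize α f z ≤ M) (k : ℕ) (s : Fin k → Fin n) :
    Integrable (fun u => f u * conj (∏ j, u (s j)) * (Real.exp (-‖u‖ ^ 2) : ℂ)) (V n) := by
  refine integrable_of_norm_le_gaussian hn
    (Continuous.aestronglyMeasurable (by have := continuous_coord_prod s; fun_prop))
    (A := k.factorial * (M * Real.exp (1 ^ 2))) (c := 1 / 4) (s := α) (by norm_num) fun u => ?_
  rw [norm_mul, norm_mul, Complex.norm_real, Real.norm_of_nonneg (Real.exp_pos _).le,
    RCLike.norm_conj, mul_assoc (k.factorial : ℝ)]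
  refine le_trans ?_ (mul_le_mul_of_nonneg_left (norm_mul_exp_le hM 1 u) (by positivity))
  have h1 := (norm_prod_coord_le s u).trans (pow_mul_pow_le_factorial_mul_exp k (norm_nonneg u))
  calc _ ≤ ‖f u‖ * (k.factorial * Real.exp ‖u‖) * Real.exp (-‖u‖ ^ 2) := by gcongr
    _ = _ := by rw [one_mul]; ring

/-- Under the integral (R|u|)ᵏ ≤ k! e^{R|u|}, and the exponential is absorbed by the Gaussian. -/
lemma momentBound_moment (hn : 1 ≤ n) {α M : ℝ} {f : Cn n → ℂ}
    (hM : ∀ z, wsize α f z ≤ M) : MomentBound (moment f) := by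
  intro R hR
  refine ⟨∫ u : Cn n, M * Real.exp (R ^ 2) * (Real.exp (-(1 / 4) * ‖u‖ ^ 2) * (1 + ‖u‖) ^ α) ∂(V n),
    fun k s => ?_⟩
  have hi := (integrable_one_add_norm_rpow_mul_exp hn (c := 1 / 4) (by norm_num) α).const_mul
    (M * Real.exp (R ^ 2))
  rw [← le_div_iff₀ (by positivity), moment]
  refine (norm_integral_le_of_norm_le (hi.const_mul (k.factorial / R ^ k)) (ae_of_all _ fun u => ?_)).trans_eq
    (by rw [integral_const_mul]; ring)
  rw [norm_mul, norm_mul, Complex.norm_real, Real.norm_of_nonneg (Real.exp_pos _).le,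
    RCLike.norm_conj]
  refine le_trans ?_ (mul_le_mul_of_nonneg_left (norm_mul_exp_le hM R u) (by positivity))
  have h1 := pow_mul_pow_le_factorial_mul_exp k (show 0 ≤ R * ‖u‖ by positivity)
  have h2 : ‖∏ j, u (s j)‖ ≤ k.factorial / R ^ k * Real.exp (R * ‖u‖) := by
    refine (norm_prod_coord_le s u).trans ?_
    rw [div_mul_eq_mul_div, le_div_iff₀ (by positivity), ← mul_pow, mul_comm ‖u‖]
    exact h1
  calc _ ≤ ‖f u‖ * (k.factorial / R ^ k * Real.exp (R * ‖u‖)) * Real.exp (-‖u‖ ^ 2) := by gcongr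
    _ = _ := by ring

lemma inner_pow_eq_sum (u z : Cn n) (k : ℕ) :
    inner ℂ u z ^ k = ∑ s : Fin k → Fin n, conj (∏ j, u (s j)) * ∏ j, z (s j) := by
  have h : inner ℂ u z = ∑ i, conj (u i) * z i := by
    simp [PiLp.inner_apply, mul_comm]
  rw [h, Fintype.sum_pow]
  refine Finset.sum_congr rfl fun s _ => ?_
  rw [map_prod, Finset.prod_mul_distrib]

lemma integral_mul_inner_pow (hn : 1 ≤ n) {α M : ℝ} {f : Cn n → ℂ} (hf : Continuous f)
    (hM : ∀ z, wsize α f z ≤ M) (k : ℕ) (z : Cn n) :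
    ∫ u, f u * (inner ℂ u z ^ k / k.factorial) * (Real.exp (-‖u‖ ^ 2) : ℂ) ∂(V n)
      = (k.factorial : ℂ)⁻¹ * ∑ s, moment f k s * ∏ j, z (s j) := by
  simp_rw [moment, ← integral_mul_const]
  rw [← integral_finsetSum _ fun s _ => (integrable_moment hn hf hM k s).mul_const _,
    ← integral_const_mul]
  refine integral_congr_ae (ae_of_all _ fun u => ?_)
  simp only
  rw [inner_pow_eq_sum, Finset.sum_div, Finset.mul_sum, Finset.sum_mul, Finset.mul_sum]
  refine Finset.sum_congr rfl fun s _ => ?_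
  ring

/-- The exponential in the reproducing formula is expanded and integrated term by term. Complex
differentiability with the growth bound is thereby upgraded to a power series converging on all of
ℂⁿ. -/
lemma eq_momentSeries_sum (hn : 1 ≤ n) {α M : ℝ} {f : Cn n → ℂ} (hf : Differentiable ℂ f)
    (hM : ∀ z, wsize α f z ≤ M) : (momentSeries (moment f)).sum = f := by
  funext z
  have hc := hf.continuous
  have h : HasSum (fun k : ℕ => ∫ u, f u * (inner ℂ u z ^ k / k.factorial) * (Real.exp (-‖u‖ ^ 2) : ℂ) ∂(V n))
      (∫ u, f u * Complex.exp (inner ℂ u z) * (Real.exp (-‖u‖ ^ 2) : ℂ) ∂(V n)) := by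
    refine hasSum_integral_of_dominated_convergence
      (fun k u => ‖f u‖ * ((‖z‖ * ‖u‖) ^ k / k.factorial) * Real.exp (-‖u‖ ^ 2)) ?_ ?_ ?_ ?_ ?_
    · intro k
      exact Continuous.aestronglyMeasurable (by fun_prop)
    · intro k
      refine ae_of_all _ fun u => ?_
      rw [norm_mul, norm_mul, norm_div, norm_pow, Complex.norm_real,
        Real.norm_of_nonneg (Real.exp_pos _).le, Complex.norm_natCast]
      gcongr
      rw [mul_comm]
      exact norm_inner_le_norm u z
    · exact ae_of_all _ fun u => ((Real.summable_pow_div_factorial _).mul_left _).mul_right _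
    · have e : ∀ u : Cn n, ∑' k : ℕ, ‖f u‖ * ((‖z‖ * ‖u‖) ^ k / k.factorial) * Real.exp (-‖u‖ ^ 2)
          = ‖f u‖ * Real.exp (‖z‖ * ‖u‖) * Real.exp (-‖u‖ ^ 2) := by
        intro u
        rw [tsum_mul_right, tsum_mul_left, Real.exp_eq_exp_ℝ, NormedSpace.exp_eq_tsum_div]
      simp_rw [e]
      refine integrable_of_norm_le_gaussian hn (Continuous.aestronglyMeasurable (by fun_prop))
        (A := M * Real.exp (‖z‖ ^ 2)) (c := 1 / 4) (s := α) (by norm_num) fun u => ?_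
      rw [Real.norm_of_nonneg (by positivity)]
      exact norm_mul_exp_le hM ‖z‖ u
    · refine ae_of_all _ fun u => ?_
      have h1 := NormedSpace.exp_series_hasSum_exp' (𝕂 := ℂ) (𝔸 := ℂ) (inner ℂ u z)
      rw [← Complex.exp_eq_exp_ℂ] at h1
      have h2 := (h1.mul_left (f u)).mul_right (Real.exp (-‖u‖ ^ 2) : ℂ)
      refine h2.congr_fun fun k => ?_
      rw [smul_eq_mul, div_eq_inv_mul]
  rw [integral_reproducing hn hf hM] at h
  rw [← h.tsum_eq, FormalMultilinearSeries.sum]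
  congr 1
  funext k
  rw [integral_mul_inner_pow hn hc hM, momentSeries_apply]

theorem isEntire_of_wsize_le (hn : 1 ≤ n) {α M : ℝ} {f : Cn n → ℂ} (hf : Differentiable ℂ f)
    (hM : ∀ z, wsize α f z ≤ M) : IsEntire f := by
  rw [← eq_momentSeries_sum hn hf hM]
  exact (momentBound_moment hn hM).isEntire

lemma homogPart_eq_sum_moment (hn : 1 ≤ n) {α M : ℝ} {f : Cn n → ℂ} (hf : Differentiable ℂ f)
    (hM : ∀ z, wsize α f z ≤ M) (k : ℕ) (z : Cn n) :
    homogPart f k z = (k.factorial : ℂ)⁻¹ * ∑ s, moment f k s * ∏ j, z (s j) := by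
  rw [← (momentBound_moment hn hM).homogPart_sum, eq_momentSeries_sum hn hf hM]

/-! ### Low and high frequency parts -/

/-- `∑_{k < j} fₖ`. -/
def truncLow (j : ℕ) (f : Cn n → ℂ) (z : Cn n) : ℂ := ∑ k ∈ Finset.range j, homogPart f k z

/-- `f - ∑_{k < j} fₖ`. -/
def truncHigh (j : ℕ) (f : Cn n → ℂ) (z : Cn n) : ℂ := f z - truncLow j f z

lemma differentiable_truncLow (j : ℕ) (f : Cn n → ℂ) : Differentiable ℂ (truncLow j f) :=
  Differentiable.fun_sum fun k _ => differentiable_homogPart f k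

lemma differentiable_truncHigh (j : ℕ) {f : Cn n → ℂ} (hf : Differentiable ℂ f) :
    Differentiable ℂ (truncHigh j f) := hf.sub (differentiable_truncLow j f)

/-- The number of homogeneous parts that are treated separately in the pairing `⟨·, ·⟩_γ`. -/
def cutoff (n : ℕ) (γ : ℝ) : ℕ := if γ < 2 * (n : ℝ) then 0 else ⌊|γ / 2|⌋₊ + 1

/-- From this degree on, |z|^{2k-γ} is integrable at the origin and the Gamma function is evaluated
at positive arguments. -/
lemma cutoff_add_pos (hn : 1 ≤ n) (γ : ℝ) : 0 < cutoff n γ + (n - γ / 2) := by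
  unfold cutoff
  split_ifs with h
  · simp only [Nat.cast_zero, zero_add]; linarith
  · have h1 := Nat.lt_floor_add_one |γ / 2|
    have h2 := le_abs_self (γ / 2)
    have h3 : (1 : ℝ) ≤ n := by exact_mod_cast hn
    push_cast
    linarith

lemma rawPairing_zero_left (γ : ℝ) (g : Cn n → ℂ) : rawPairing γ (fun _ => 0) g = 0 := by
  simp [rawPairing, pairIntegrand]

/-- For γ < 2n the cutoff is 0, the low parts vanish and the high parts are the functions
themselves; both cases of the pairing become one formula. -/
lemma pairing_eq_cutoff (γ : ℝ) (f g : Cn n → ℂ) :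
    pairing γ f g = rawPairing 0 (truncLow (cutoff n γ) f) (truncLow (cutoff n γ) g)
      + rawPairing γ (truncHigh (cutoff n γ) f) (truncHigh (cutoff n γ) g) := by
  unfold pairing cutoff
  split_ifs with h
  · have h0 : ∀ f : Cn n → ℂ, truncLow 0 f = fun _ => 0 := fun f => by funext z; simp [truncLow]
    have h1 : ∀ f : Cn n → ℂ, truncHigh 0 f = f := fun f => by funext z; simp [truncHigh, h0]
    rw [h0, h1, h1, rawPairing_zero_left, zero_add]
  · rfl

lemma pairingConverges_of_cutoff {γ : ℝ} {f g : Cn n → ℂ}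
    (hlow : Integrable (pairIntegrand (truncLow (cutoff n γ) f) (truncLow (cutoff n γ) g)) (W n 0))
    (hhigh : Integrable (pairIntegrand (truncHigh (cutoff n γ) f) (truncHigh (cutoff n γ) g))
      (W n γ)) : PairingConverges γ f g := by
  unfold cutoff at hlow hhigh
  constructor
  · intro h
    rw [if_pos h] at hhigh
    have h1 : ∀ f : Cn n → ℂ, truncHigh 0 f = f := fun f => by
      funext z; simp [truncHigh, truncLow]
    rwa [h1, h1] at hhigh
  · intro h
    rw [if_neg (not_lt.mpr h)] at hlow hhigh
    exact ⟨hlow, hhigh⟩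

/-! ### Estimates for homogeneous parts -/

lemma exists_unit_smul (hn : 1 ≤ n) (z : Cn n) : ∃ ζ : Cn n, ‖ζ‖ = 1 ∧ z = (‖z‖ : ℂ) • ζ := by
  have := nontrivial_Cn hn
  rcases eq_or_ne z 0 with rfl | hz
  · obtain ⟨ζ, hζ⟩ := exists_norm_eq (Cn n) zero_le_one
    exact ⟨ζ, hζ, by simp⟩
  · have h0 : (‖z‖ : ℂ) ≠ 0 := by simpa using hz
    refine ⟨(‖z‖ : ℂ)⁻¹ • z, ?_, by rw [smul_inv_smul₀ h0]⟩
    rw [norm_smul, norm_inv, Complex.norm_real, norm_norm, inv_mul_cancel₀ (norm_ne_zero_iff.mpr hz)]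

section Bounds
variable {α M : ℝ} {f : Cn n → ℂ}

lemma norm_homogPart_le (hf : IsEntire f) (hM : ∀ z, wsize α f z ≤ M) (k : ℕ) (z : Cn n) :
    ‖homogPart f k z‖ ≤ M * growth α ‖z‖ := by
  refine norm_coeff_le (F := fun l => f (l • z)) (hf.summable z) (fun l _ => hf.hasSum_smul l z)
    (fun l hl => ?_) k
  have := wsize_le_iff.mp (hM (l • z))
  rwa [norm_smul, hl, one_mul] at this

/-- Homogeneity carries the bound on the sphere of radius `R` to every point. -/
lemma norm_homogPart_le_pow (hn : 1 ≤ n) (hf : IsEntire f) (hM : ∀ z, wsize α f z ≤ M) {R : ℝ}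
    (hR : 0 < R) (k : ℕ) (z : Cn n) :
    ‖homogPart f k z‖ ≤ M * growth α R * (‖z‖ / R) ^ k := by
  obtain ⟨ζ, hζ, hz⟩ := exists_unit_smul hn z
  have h1 : z = ((‖z‖ / R : ℝ) : ℂ) • ((R : ℂ) • ζ) := by
    rw [smul_smul, ← Complex.ofReal_mul, div_mul_cancel₀ _ hR.ne']; exact hz
  have h2 := norm_homogPart_le hf hM k ((R : ℂ) • ζ)
  rw [norm_smul, hζ, Complex.norm_real, Real.norm_of_nonneg hR.le, mul_one] at h2
  have h3 : 0 ≤ ‖z‖ / R := by positivity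
  rw [h1, homogPart_smul, norm_mul, norm_pow, Complex.norm_real, Real.norm_of_nonneg h3, mul_comm,
    ← h1]
  gcongr

lemma norm_truncLow_le (hn : 1 ≤ n) (hf : IsEntire f) (hM : ∀ z, wsize α f z ≤ M) (j : ℕ)
    (z : Cn n) : ‖truncLow j f z‖ ≤ j * growth α 1 * M * (1 + ‖z‖) ^ j := by
  have hM0 : 0 ≤ M := (wsize_nonneg _ _ _).trans (hM 0)
  have hg := growth_pos (β := α) (x := 1) zero_le_one
  refine (norm_sum_le_of_le _ (n := fun _ => M * growth α 1 * (1 + ‖z‖) ^ j) fun k hk => ?_).trans_eq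
    (by simp; ring)
  refine (norm_homogPart_le_pow hn hf hM one_pos k z).trans ?_
  rw [div_one]
  gcongr
  calc ‖z‖ ^ k ≤ (1 + ‖z‖) ^ k := by gcongr; linarith
    _ ≤ _ := pow_le_pow_right₀ (by linarith [norm_nonneg z]) (Finset.mem_range.mp hk).le

/-- The tail vanishes to order `j` at 0, which compensates the singularity of |z|^{-γ}. The bounds
at radius 2 make it geometric on the unit ball. -/
lemma norm_truncHigh_le_pow (hn : 1 ≤ n) (hf : IsEntire f) (hM : ∀ z, wsize α f z ≤ M) (j : ℕ)
    {z : Cn n} (hz : ‖z‖ ≤ 1) : ‖truncHigh j f z‖ ≤ 2 * growth α 2 * M * ‖z‖ ^ j := by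
  have hM0 : 0 ≤ M := (wsize_nonneg _ _ _).trans (hM 0)
  have hg := growth_pos (β := α) (x := 2) zero_le_two
  have h1 : HasSum (fun k => homogPart f (k + j) z) (truncHigh j f z) := by
    rw [truncHigh, truncLow]
    exact (hasSum_nat_add_iff' j).mpr (hf.hasSum z)
  have h2 : ∀ k, ‖homogPart f (k + j) z‖ ≤ M * growth α 2 * ‖z‖ ^ j * (1 / 2) ^ k := by
    intro k
    refine (norm_homogPart_le_pow hn hf hM two_pos (k + j) z).trans ?_
    rw [mul_assoc (M * growth α 2)]
    gcongr
    rw [pow_add, mul_comm]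
    gcongr
    linarith [norm_nonneg z]
  have h3 := tsum_of_norm_bounded (hasSum_geometric_two.mul_left (M * growth α 2 * ‖z‖ ^ j)) h2
  rw [h1.tsum_eq] at h3
  linarith

end Bounds

/-- Convergence and continuity of the pairing. -/
theorem exists_norm_pairing_le (hn : 1 ≤ n) (α β : ℝ) :
    ∃ K : ℝ, 0 < K ∧ ∀ (f g : Cn n → ℂ) (M B : ℝ), Differentiable ℂ f → Differentiable ℂ g →
      (∀ z, wsize α f z ≤ M) → Integrable (wsize α f) (V n) → (∀ z, wsize β g z ≤ B) →
      Integrable (pairIntegrand (truncLow (cutoff n (α + β)) f) (truncLow (cutoff n (α + β)) g))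
        (W n 0) ∧
      Integrable (pairIntegrand (truncHigh (cutoff n (α + β)) f) (truncHigh (cutoff n (α + β)) g))
        (W n (α + β)) ∧
      ‖pairing (α + β) f g‖ ≤ K * B * (M + ∫ z, wsize α f z ∂(V n)) := by
  set γ := α + β with hγ
  set j := cutoff n γ with hj
  have hjpos := cutoff_add_pos hn γ
  rw [← hj] at hjpos
  -- `D` controls the high parts on the unit ball, `E` the polynomial subtracted from f outside it,
  -- and `L` the product of the low parts.
  let D : Cn n → ℝ := fun z => ‖z‖ ^ (2 * j - γ) * Real.exp (-1 * ‖z‖ ^ 2)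
  let E : Cn n → ℝ := fun z => Real.exp (-(1 / 2) * ‖z‖ ^ 2) * (1 + ‖z‖) ^ (j - α)
  let L : Cn n → ℝ := fun z => Real.exp (-1 * ‖z‖ ^ 2) * (1 + ‖z‖) ^ (2 * j : ℝ)
  have hD : Integrable D (V n) := integrable_norm_rpow_mul_exp hn one_pos (by linarith)
  have hE : Integrable E (V n) := integrable_one_add_norm_rpow_mul_exp hn (by norm_num) _
  have hL : Integrable L (V n) := integrable_one_add_norm_rpow_mul_exp hn one_pos _
  have hD0 : ∀ z, 0 ≤ D z := fun z => by simp only [D]; positivity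
  have hE0 : ∀ z, 0 ≤ E z := fun z => by simp only [E]; positivity
  have hL0 : ∀ z, 0 ≤ L z := fun z => by simp only [L]; positivity
  obtain ⟨C0, hC0, h0⟩ := exists_growth_le β (j : ℝ) (ρ := 0) one_pos
  have ga1 := growth_pos (β := α) (x := 1) zero_le_one
  have gb1 := growth_pos (β := β) (x := 1) zero_le_one
  have ga2 := growth_pos (β := α) (x := 2) zero_le_two
  have gb2 := growth_pos (β := β) (x := 2) zero_le_two
  set c1 : ℝ := 4 * growth α 2 * growth β 2 with hc1
  set c2 : ℝ := 2 ^ |γ| * (1 + j * growth β 1 * C0) with hc2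
  set c3 : ℝ := c2 * (j * growth α 1) with hc3
  set c4 : ℝ := j * growth α 1 * (j * growth β 1) with hc4
  have hc10 : 0 < c1 := by positivity
  have hc20 : 0 < c2 := by positivity
  have hc30 : 0 ≤ c3 := by positivity
  have hc40 : 0 ≤ c4 := by positivity
  have iD : 0 ≤ ∫ z, D z ∂(V n) := integral_nonneg hD0
  have iE : 0 ≤ ∫ z, E z ∂(V n) := integral_nonneg hE0
  have iL : 0 ≤ ∫ z, L z ∂(V n) := integral_nonneg hL0
  refine ⟨c1 * ∫ z, D z ∂(V n) + c2 + c3 * ∫ z, E z ∂(V n) + c4 * ∫ z, L z ∂(V n), by positivity,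
    fun f g M B hf hg hM hfi hB => ?_⟩
  have hfe := isEntire_of_wsize_le hn hf hM
  have hge := isEntire_of_wsize_le hn hg hB
  have hM0 : 0 ≤ M := (wsize_nonneg _ _ _).trans (hM 0)
  have hB0 : 0 ≤ B := (wsize_nonneg _ _ _).trans (hB 0)
  have hflow := norm_truncLow_le hn hfe hM j
  have hglow := norm_truncLow_le hn hge hB j
  have hlowc : Continuous (pairIntegrand (truncLow j f) (truncLow j g)) := by
    have h1 := (differentiable_truncLow j f).continuous
    have h2 := (differentiable_truncLow j g).continuous
    unfold pairIntegrand
    fun_prop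
  have hhighc : Continuous (pairIntegrand (truncHigh j f) (truncHigh j g)) := by
    have h1 := (differentiable_truncHigh j hf).continuous
    have h2 := (differentiable_truncHigh j hg).continuous
    unfold pairIntegrand
    fun_prop
  have npair : ∀ (a b : Cn n → ℂ) z, ‖pairIntegrand a b z‖ = ‖a z‖ * ‖b z‖ * Real.exp (-‖z‖ ^ 2) := by
    intro a b z
    rw [pairIntegrand, norm_mul, norm_mul, RCLike.norm_conj, Complex.norm_real,
      Real.norm_of_nonneg (Real.exp_pos _).le]
  have hlowle : ∀ z, ‖(‖z‖ ^ (-(0 : ℝ)) : ℝ) • pairIntegrand (truncLow j f) (truncLow j g) z‖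
      ≤ c4 * M * B * L z := by
    intro z
    rw [neg_zero, rpow_zero, one_smul, npair]
    calc _ ≤ (j * growth α 1 * M * (1 + ‖z‖) ^ j) * (j * growth β 1 * B * (1 + ‖z‖) ^ j)
          * Real.exp (-‖z‖ ^ 2) := by gcongr; exact hflow z; exact hglow z
      _ = c4 * M * B * (Real.exp (-1 * ‖z‖ ^ 2) * ((1 + ‖z‖) ^ j * (1 + ‖z‖) ^ j)) := by
        rw [hc4, neg_one_mul]; ring
      _ = _ := by
        simp only [L]
        rw [two_mul, rpow_add (by positivity), rpow_natCast]
  have hhighle : ∀ z, ‖(‖z‖ ^ (-γ) : ℝ) • pairIntegrand (truncHigh j f) (truncHigh j g) z‖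
      ≤ c1 * M * B * D z + (c2 * B * wsize α f z + c3 * M * B * E z) := by
    intro z
    have hw := wsize_nonneg α f z
    rw [norm_smul, Real.norm_of_nonneg (by positivity), npair]
    rcases le_total ‖z‖ 1 with hz | hz
    · refine le_add_of_le_of_nonneg ?_ (by have := hE0 z; positivity)
      have h1 := norm_truncHigh_le_pow hn hfe hM j hz
      have h2 := norm_truncHigh_le_pow hn hge hB j hz
      -- An inequality rather than an equality: at z = 0 with j > 0 the left side is 0, while the
      -- right side is 0⁰ = 1 if γ = 2j.
      have h3 : ‖z‖ ^ (-γ) * (‖z‖ ^ j * ‖z‖ ^ j) ≤ ‖z‖ ^ (2 * j - γ) := by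
        rcases (norm_nonneg z).eq_or_lt with hz0 | hz0
        · rcases Nat.eq_zero_or_pos j with hj0 | hj0
          · simp [hj0]
          · rw [← hz0, zero_pow hj0.ne']
            simp only [mul_zero]; positivity
        · rw [sub_eq_add_neg, rpow_add hz0, two_mul, rpow_add hz0, rpow_natCast]
          rw [mul_comm]
      calc _ ≤ ‖z‖ ^ (-γ) * ((2 * growth α 2 * M * ‖z‖ ^ j) * (2 * growth β 2 * B * ‖z‖ ^ j)
            * Real.exp (-‖z‖ ^ 2)) := by gcongr
        _ = c1 * M * B * ((‖z‖ ^ (-γ) * (‖z‖ ^ j * ‖z‖ ^ j)) * Real.exp (-1 * ‖z‖ ^ 2)) := by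
          rw [hc1, neg_one_mul]; ring
        _ ≤ _ := by
          simp only [D]
          gcongr
    · refine le_add_of_nonneg_of_le (by have := hD0 z; positivity) ?_
      have hz0 : 0 < ‖z‖ := by linarith
      have h1 : ‖truncHigh j f z‖ ≤ ‖f z‖ + j * growth α 1 * M * (1 + ‖z‖) ^ j :=
        (norm_sub_le _ _).trans (add_le_add le_rfl (hflow z))
      have h2 : ‖truncHigh j g z‖ ≤ (1 + j * growth β 1 * C0) * B * growth β ‖z‖ := by
        have h3 := wsize_le_iff.mp (hB z)
        have h4 := h0 ‖z‖ hz0.le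
        simp only [zero_mul, zero_div, Real.exp_zero, one_mul, rpow_natCast] at h4
        calc _ ≤ ‖g z‖ + j * growth β 1 * B * (1 + ‖z‖) ^ j :=
              (norm_sub_le _ _).trans (add_le_add le_rfl (hglow z))
          _ ≤ B * growth β ‖z‖ + j * growth β 1 * B * (C0 * growth β ‖z‖) := by gcongr
          _ = _ := by ring
      have h5 : ‖z‖ ^ (-γ) ≤ 2 ^ |γ| * (1 + ‖z‖) ^ (-γ) := by
        have := one_add_rpow_le_mul (x := ‖z‖ - 1) (y := ‖z‖) (d := 1) (-γ) (by linarith) hz0.le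
          (by simp)
        rw [add_sub_cancel, abs_neg] at this
        norm_num at this
        linarith
      -- Here γ = α + β is used: the weight of the pairing times the growth of g is exactly the
      -- weight in `wsize α`.
      have e1 : (1 + ‖z‖) ^ (-γ) * growth β ‖z‖ * Real.exp (-‖z‖ ^ 2)
          = Real.exp (-‖z‖ ^ 2 / 2) * (1 + ‖z‖) ^ (-α) := by
        rw [growth, hγ, neg_add, rpow_add (by positivity), rpow_neg (y := β) (by positivity)]
        have : Real.exp (‖z‖ ^ 2 / 2) * Real.exp (-‖z‖ ^ 2) = Real.exp (-‖z‖ ^ 2 / 2) := by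
          rw [← Real.exp_add]; congr 1; ring
        rw [← this]
        have hne : (1 + ‖z‖) ^ β ≠ 0 := by positivity
        field_simp
      have e2 : Real.exp (-‖z‖ ^ 2 / 2) * (1 + ‖z‖) ^ (-α) * (1 + ‖z‖) ^ j = E z := by
        simp only [E]
        rw [sub_eq_neg_add, rpow_add (by positivity), rpow_natCast, mul_assoc]
        congr 2; ring
      have hgz := growth_pos (β := β) (norm_nonneg z)
      calc _ ≤ (2 ^ |γ| * (1 + ‖z‖) ^ (-γ)) * ((‖f z‖ + j * growth α 1 * M * (1 + ‖z‖) ^ j)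
            * ((1 + j * growth β 1 * C0) * B * growth β ‖z‖) * Real.exp (-‖z‖ ^ 2)) := by gcongr
        _ = c2 * B * (‖f z‖ + j * growth α 1 * M * (1 + ‖z‖) ^ j)
            * ((1 + ‖z‖) ^ (-γ) * growth β ‖z‖ * Real.exp (-‖z‖ ^ 2)) := by rw [hc2]; ring
        _ = c2 * B * (‖f z‖ * (Real.exp (-‖z‖ ^ 2 / 2) * (1 + ‖z‖) ^ (-α)))
            + c3 * M * B * (Real.exp (-‖z‖ ^ 2 / 2) * (1 + ‖z‖) ^ (-α) * (1 + ‖z‖) ^ j) := by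
          rw [e1, hc3]; ring
        _ = _ := by rw [e2]; rfl
  have hlowdom := hL.const_mul (c4 * M * B)
  have hhighdom := (hD.const_mul (c1 * M * B)).add
    ((hfi.const_mul (c2 * B)).add (hE.const_mul (c3 * M * B)))
  have hmeas : ∀ γ : ℝ, Measurable fun z : Cn n => ‖z‖ ^ (-γ) := fun γ => by fun_prop
  refine ⟨?_, ?_, ?_⟩
  · rw [integrable_W]
    exact hlowdom.mono' ((hmeas 0).aestronglyMeasurable.smul hlowc.aestronglyMeasurable)
      (ae_of_all _ hlowle)
  · rw [integrable_W]
    exact hhighdom.mono' ((hmeas γ).aestronglyMeasurable.smul hhighc.aestronglyMeasurable)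
      (ae_of_all _ hhighle)
  · rw [pairing_eq_cutoff, ← hj, rawPairing, rawPairing, integral_W, integral_W]
    have n1 := norm_integral_le_of_norm_le hlowdom (ae_of_all _ hlowle)
    have n2 := norm_integral_le_of_norm_le hhighdom (ae_of_all _ hhighle)
    have e2 : ∫ z, ((fun z => c1 * M * B * D z) + ((fun z => c2 * B * wsize α f z) +
        fun z => c3 * M * B * E z)) z ∂(V n) = c1 * M * B * ∫ z, D z ∂(V n)
        + (c2 * B * ∫ z, wsize α f z ∂(V n) + c3 * M * B * ∫ z, E z ∂(V n)) := by
      rw [integral_add' (hD.const_mul _) ((hfi.const_mul (c2 * B)).add (hE.const_mul _)),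
        integral_add' (hfi.const_mul _) (hE.const_mul _)]
      simp only [integral_const_mul]
    have n2' := n2.trans_eq e2
    rw [integral_const_mul] at n1
    refine (norm_add_le _ _).trans ((add_le_add n1 n2').trans ?_)
    have iw : 0 ≤ ∫ z, wsize α f z ∂(V n) := integral_nonneg fun z => wsize_nonneg _ _ _
    have p1 : 0 ≤ c1 * (∫ z, D z ∂(V n)) * B * ∫ z, wsize α f z ∂(V n) := by positivity
    have p2 : 0 ≤ c3 * (∫ z, E z ∂(V n)) * B * ∫ z, wsize α f z ∂(V n) := by positivity
    have p3 : 0 ≤ c4 * (∫ z, L z ∂(V n)) * B * ∫ z, wsize α f z ∂(V n) := by positivity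
    have p4 : 0 ≤ c2 * B * M := by positivity
    nlinarith

/-! ### Homogeneous parts of the kernel -/

/-- `⟨z, w⟩ᵏ / k!`, the homogeneous part of degree `k` of the kernel. -/
def kernelPart (w : Cn n) (k : ℕ) (z : Cn n) : ℂ := inner ℂ w z ^ k / k.factorial

lemma differentiable_kernelPart (w : Cn n) (k : ℕ) : Differentiable ℂ (kernelPart w k) := by
  have h := (differentiable_inner_right w).pow k
  simpa only [kernelPart, div_eq_mul_inv] using! h.mul_const ((k.factorial : ℂ)⁻¹)

lemma kernelPart_smul (w : Cn n) (k : ℕ) (l : ℂ) (z : Cn n) :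
    kernelPart w k (l • z) = l ^ k * kernelPart w k z := by
  rw [kernelPart, kernelPart, inner_smul_right, mul_pow, mul_div_assoc]

lemma kernelPart_smul_left (w : Cn n) (k : ℕ) (l : ℂ) (z : Cn n) :
    kernelPart (l • w) k z = conj l ^ k * kernelPart w k z := by
  rw [kernelPart, kernelPart, inner_smul_left, mul_pow, mul_div_assoc]

lemma hasSum_kernelPart (w z : Cn n) : HasSum (fun k => kernelPart w k z) (kernel w z) := by
  have h1 := NormedSpace.exp_series_hasSum_exp' (𝕂 := ℂ) (𝔸 := ℂ) (inner ℂ w z)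
  rw [← Complex.exp_eq_exp_ℂ] at h1
  exact h1.congr_fun fun k => by rw [kernelPart, smul_eq_mul, div_eq_inv_mul]

/-- The factor 2⁻ᵏ is bought by doubling the argument of the exponential series, and 2|w||z| ≤ 4|w|²
+ |z|²/4 keeps the growth in z subcritical. Hence the expansion of the kernel converges
geometrically in every Fock norm. -/
lemma norm_kernelPart_le (w : Cn n) (k : ℕ) (z : Cn n) :
    ‖kernelPart w k z‖ ≤ Real.exp (4 * ‖w‖ ^ 2) * (1 / 2) ^ k * Real.exp (1 / 2 * ‖z‖ ^ 2 / 2) := by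
  have h1 : ‖kernelPart w k z‖ ≤ (‖w‖ * ‖z‖) ^ k / k.factorial := by
    rw [kernelPart, norm_div, norm_pow, Complex.norm_natCast]
    gcongr
    exact norm_inner_le_norm w z
  have h2 := Real.pow_div_factorial_le_exp (2 * (‖w‖ * ‖z‖)) (by positivity) k
  have h3 : Real.exp (2 * (‖w‖ * ‖z‖)) ≤ Real.exp (4 * ‖w‖ ^ 2) * Real.exp (1 / 2 * ‖z‖ ^ 2 / 2) := by
    rw [← Real.exp_add, Real.exp_le_exp]
    nlinarith [sq_nonneg (2 * ‖w‖ - ‖z‖ / 2)]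
  calc _ ≤ (‖w‖ * ‖z‖) ^ k / k.factorial := h1
    _ = (1 / 2) ^ k * ((2 * (‖w‖ * ‖z‖)) ^ k / k.factorial) := by
      rw [← mul_div_assoc, ← mul_pow]; congr 2; ring
    _ ≤ (1 / 2) ^ k * (Real.exp (4 * ‖w‖ ^ 2) * Real.exp (1 / 2 * ‖z‖ ^ 2 / 2)) := by
      gcongr; exact h2.trans h3
    _ = _ := by ring

lemma norm_kernel_sub_sum_le (w : Cn n) (N : ℕ) (z : Cn n) :
    ‖kernel w z - ∑ k ∈ Finset.range N, kernelPart w k z‖ ≤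
      2 * Real.exp (4 * ‖w‖ ^ 2) * (1 / 2) ^ N * Real.exp (1 / 2 * ‖z‖ ^ 2 / 2) := by
  have h1 := (hasSum_nat_add_iff' N).mpr (hasSum_kernelPart w z)
  have h2 : ∀ k, ‖kernelPart w (k + N) z‖ ≤
      (Real.exp (4 * ‖w‖ ^ 2) * (1 / 2) ^ N * Real.exp (1 / 2 * ‖z‖ ^ 2 / 2)) * (1 / 2) ^ k := by
    intro k
    refine (norm_kernelPart_le w (k + N) z).trans_eq ?_
    rw [pow_add]; ring
  have h3 := tsum_of_norm_bounded (hasSum_geometric_two.mul_left _) h2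
  rw [h1.tsum_eq] at h3
  linarith

/-! ### Orthogonality -/

lemma circleAverage_conj (f : ℂ → ℂ) :
    Real.circleAverage (fun l => conj (f l)) 0 1 = conj (Real.circleAverage f 0 1) := by
  have h : (0 : ℝ) ≤ 2 * π := by positivity
  simp_rw [Real.circleAverage_def, intervalIntegral.integral_of_le h]
  rw [integral_conj, Complex.real_smul, Complex.real_smul, map_mul, Complex.conj_ofReal]

/-- Pairing with a homogeneous function of degree `k` only sees the part of degree `k`. -/
lemma rawPairing_eq_of_circleAverage {γ : ℝ} {k : ℕ} {P H h : Cn n → ℂ}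
    (hP : ∀ (l : ℂ) (z : Cn n), P (l • z) = l ^ k * P z)
    (hH : ∀ z, Real.circleAverage (fun l => conj l ^ k * H (l • z)) 0 1 = h z)
    (hi : Integrable (pairIntegrand P H) (W n γ)) : rawPairing γ P H = rawPairing γ P h := by
  rw [integrable_W] at hi
  rw [rawPairing, rawPairing, integral_W, integral_W, (integral_eq_integral_circleAverage hi).2]
  refine integral_congr_ae (ae_of_all _ fun z => ?_)
  simp only
  have e : Real.circleAverage (fun l : ℂ => (‖l • z‖ ^ (-γ) : ℝ) • pairIntegrand P H (l • z)) 0 1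
      = Real.circleAverage (fun l : ℂ => (((‖z‖ ^ (-γ) : ℝ) : ℂ) * P z * (Real.exp (-‖z‖ ^ 2) : ℂ)) •
          conj (conj l ^ k * H (l • z))) 0 1 := by
    refine Real.circleAverage_congr_sphere fun l hl => ?_
    have hl1 : ‖l‖ = 1 := by simpa using hl
    simp only [pairIntegrand, norm_smul, hl1, one_mul, hP, smul_eq_mul, Complex.real_smul, map_mul,
      map_pow, Complex.conj_conj]
    ring
  rw [e, Real.circleAverage_fun_smul, circleAverage_conj, hH, pairIntegrand, smul_eq_mul,
    Complex.real_smul]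
  ring

lemma IsEntire.circleAverage_truncLow {f : Cn n → ℂ} (j k : ℕ) (z : Cn n) :
    Real.circleAverage (fun l => conj l ^ k * truncLow j f (l • z)) 0 1
      = if k < j then homogPart f k z else 0 := by
  refine FockDuality.circleAverage_conj_pow_mul (F := fun l => truncLow j f (l • z))
    (a := fun k => if k < j then homogPart f k z else 0)
    (summable_of_ne_finset_zero (s := Finset.range j) fun k hk => by simp_all) (fun l _ => ?_) k
  have h := hasSum_sum_of_ne_finset_zero (L := .unconditional ℕ) (s := Finset.range j)
    (f := fun k => (if k < j then homogPart f k z else 0) * l ^ k) fun k hk => by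
      have : ¬ k < j := by simpa using hk
      simp [this]
  convert! h using 1
  refine Finset.sum_congr rfl fun k hk => ?_
  rw [if_pos (Finset.mem_range.mp hk), homogPart_smul, mul_comm]

lemma IsEntire.circleAverage_truncHigh {f : Cn n → ℂ} (hf : IsEntire f) (j k : ℕ) (z : Cn n) :
    Real.circleAverage (fun l => conj l ^ k * truncHigh j f (l • z)) 0 1
      = if k < j then 0 else homogPart f k z := by
  refine FockDuality.circleAverage_conj_pow_mul (F := fun l => truncHigh j f (l • z))
    (a := fun k => if k < j then 0 else homogPart f k z) ?_ (fun l _ => ?_) k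
  · refine Summable.of_nonneg_of_le (fun k => norm_nonneg _) (fun k => ?_) (hf.summable z)
    split_ifs <;> simp
  have h := hasSum_sum_of_ne_finset_zero (L := .unconditional ℕ) (s := Finset.range j)
    (f := fun k => (if k < j then homogPart f k z else 0) * l ^ k) fun k hk => by
      have : ¬ k < j := by simpa using hk
      simp [this]
  have h2 : ∑ k ∈ Finset.range j, (if k < j then homogPart f k z else 0) * l ^ k
      = truncLow j f (l • z) := by
    refine Finset.sum_congr rfl fun k hk => ?_
    rw [if_pos (Finset.mem_range.mp hk), homogPart_smul, mul_comm]
  rw [h2] at h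
  refine ((hf.hasSum_smul l z).sub h).congr_fun fun k => ?_
  split_ifs <;> simp

/-- The dependence of the pairing of homogeneous functions on the radial weight. -/
lemma rawPairing_homogeneous (hn : 1 ≤ n) {γ : ℝ} {k : ℕ} {P Q : Cn n → ℂ}
    (hk : 0 < k + (n - γ / 2))
    (hP : ∀ (l : ℂ) (z : Cn n), P (l • z) = l ^ k * P z)
    (hQ : ∀ (l : ℂ) (z : Cn n), Q (l • z) = l ^ k * Q z) :
    rawPairing γ P Q = ((Real.Gamma (k + (n - γ / 2)) / Real.Gamma (k + n) : ℝ) : ℂ)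
      * rawPairing 0 P Q := by
  have hF : ∀ (r : ℝ) (z : Cn n), 0 < r →
      (fun z => P z * conj (Q z)) (r • z) = (r : ℂ) ^ (2 * k) * (fun z => P z * conj (Q z)) z := by
    intro r z _
    simp only
    rw [← Complex.coe_smul, hP, hQ, map_mul, map_pow, Complex.conj_ofReal]
    ring
  -- In polar coordinates the spherical integral does not depend on the weight; only the radial
  -- moment does.
  have h : ∀ δ : ℝ, 0 < k + (n - δ / 2) → rawPairing δ P Q
      = (∫ ζ : Metric.sphere (0 : Cn n) 1, P ζ * conj (Q ζ) ∂(V n).toSphere) *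
        ((Real.Gamma (k + (n - δ / 2)) / 2 : ℝ) : ℂ) := by
    intro δ hδ
    rw [← integral_radial_moment hn hδ, ← integral_radial_smul_homogeneous hn
      (F := fun z => P z * conj (Q z)) hF
      (fun r => r ^ (-δ) * Real.exp (-r ^ 2)), rawPairing, integral_W]
    refine integral_congr_ae (ae_of_all _ fun z => ?_)
    simp only [pairIntegrand, Complex.real_smul]
    push_cast; ring
  have hn0 : (0 : ℝ) < k + (n - 0 / 2) := by
    have : (1 : ℝ) ≤ n := by exact_mod_cast hn
    rw [zero_div, sub_zero]; positivity
  have hG := (Real.Gamma_pos_of_pos hn0).ne'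
  rw [h γ hk, h 0 hn0]
  rw [zero_div, sub_zero] at hG ⊢
  have hG' : ((Real.Gamma (k + n) : ℝ) : ℂ) ≠ 0 := by exact_mod_cast hG
  push_cast
  field_simp

lemma rawPairing_conj_symm (γ : ℝ) (P Q : Cn n → ℂ) :
    rawPairing γ P Q = conj (rawPairing γ Q P) := by
  rw [rawPairing, rawPairing, ← integral_conj]
  refine integral_congr_ae (ae_of_all _ fun z => ?_)
  simp only [pairIntegrand, map_mul, Complex.conj_conj, Complex.conj_ofReal]
  ring

lemma rawPairing_kernel (hn : 1 ≤ n) {β B : ℝ} {g : Cn n → ℂ} (hg : Differentiable ℂ g)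
    (hB : ∀ z, wsize β g z ≤ B) (w : Cn n) :
    Integrable (pairIntegrand g (kernel w)) (W n 0) ∧ rawPairing 0 g (kernel w) = g w := by
  have e : ∀ u : Cn n, (‖u‖ ^ (-(0 : ℝ)) : ℝ) • pairIntegrand g (kernel w) u
      = g u * Complex.exp (inner ℂ u w) * (Real.exp (-‖u‖ ^ 2) : ℂ) := by
    intro u
    rw [neg_zero, rpow_zero, one_smul, pairIntegrand, kernel, ← Complex.exp_conj, inner_conj_symm]
  rw [integrable_W, rawPairing, integral_W]
  simp_rw [e]
  exact ⟨integrable_reproducing hn hg.continuous hB w, integral_reproducing hn hg hB w⟩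

/-- `(⟨·, w⟩ᵏ / k!, gₖ)_0 = conj gₖ(w)`. -/
lemma rawPairing_kernelPart_homogPart (hn : 1 ≤ n) {β B : ℝ} {g : Cn n → ℂ} (hg : Differentiable ℂ g)
    (hB : ∀ z, wsize β g z ≤ B) (w : Cn n) (k : ℕ) :
    rawPairing 0 (kernelPart w k) (homogPart g k) = conj (homogPart g k w) := by
  have hge := isEntire_of_wsize_le hn hg hB
  obtain ⟨hi, h⟩ := rawPairing_kernel hn (differentiable_homogPart g k) (β := β) (B := B)
    (fun z => wsize_le_iff.mpr (norm_homogPart_le hge hB k z)) w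
  -- Against g_k only the degree k part of the full kernel survives, so the reproducing formula can
  -- be read off for that part alone.
  have h2 := rawPairing_eq_of_circleAverage (h := kernelPart w k) (homogPart_smul g k) (fun z => by
    refine FockDuality.circleAverage_conj_pow_mul (F := fun l => kernel w (l • z))
      (a := fun k => kernelPart w k z) ?_ (fun l _ => ?_) k
    · refine Summable.of_nonneg_of_le (fun k => norm_nonneg _) (fun k => norm_kernelPart_le w k z) ?_
      exact (summable_geometric_two.mul_left _).mul_right _
    · refine (hasSum_kernelPart w (l • z)).congr_fun fun k => ?_
      rw [kernelPart_smul, mul_comm]) hi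
  rw [rawPairing_conj_symm, ← h2, h]

/-- The pairing of `⟨·, w⟩ᵏ / k!` with `g`. -/
theorem pairing_kernelPart (hn : 1 ≤ n) (α : ℝ) {β B : ℝ} {g : Cn n → ℂ}
    (hg : Differentiable ℂ g) (hB : ∀ z, wsize β g z ≤ B) (w : Cn n) (k : ℕ) :
    pairing (α + β) (kernelPart w k) g =
      (gammaMultiplier (cutoff n (α + β)) (n - (α + β) / 2) n k : ℂ) * conj (homogPart g k w) := by
  set γ := α + β with hγ
  set j := cutoff n γ with hj
  have hjpos := cutoff_add_pos hn γ
  rw [← hj] at hjpos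
  have hge := isEntire_of_wsize_le hn hg hB
  -- No `p` occurs here: membership in the space with exponent 1 supplies the bound and the
  -- integrability that the pairing estimate needs.
  obtain ⟨C, hC, hF⟩ := exists_fockNorm_le_of_gaussian hn α one_pos (ρ := 1 / 2) (by norm_num)
  obtain ⟨hm, -⟩ := hF (kernelPart w k) (Real.exp (4 * ‖w‖ ^ 2) * (1 / 2) ^ k)
    (differentiable_kernelPart w k) (by positivity) (norm_kernelPart_le w k)
  obtain ⟨C1, hC1, h1⟩ := exists_wsize_le_fockNorm hn α one_pos
  obtain ⟨C2, hC2, h2⟩ := exists_integral_wsize_le_fockNorm hn α one_pos le_rfl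
  have hP := differentiable_kernelPart w k
  have hPM := h1 ⟨_, hm⟩
  have hPe := isEntire_of_wsize_le hn hP hPM
  obtain ⟨K, -, hK⟩ := exists_norm_pairing_le hn α β
  obtain ⟨hil, hih, -⟩ := hK _ g _ B hP hg hPM (h2 ⟨_, hm⟩).1 hB
  rw [← hγ, ← hj] at hil hih
  have hlow : truncLow j (kernelPart w k) = if k < j then kernelPart w k else fun _ => 0 := by
    funext z
    simp only [truncLow, hPe.homogPart_of_homogeneous (kernelPart_smul w k)]
    rw [Finset.sum_ite_eq']
    simp only [Finset.mem_range]
    split_ifs <;> rfl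
  have hhigh : truncHigh j (kernelPart w k) = if k < j then fun _ => 0 else kernelPart w k := by
    funext z
    rw [truncHigh, hlow]
    split_ifs <;> simp
  rw [pairing_eq_cutoff, ← hj]
  rw [hlow] at hil ⊢
  rw [hhigh] at hih ⊢
  unfold gammaMultiplier
  -- Low degrees are paired with the unweighted Gaussian, so the multiplier is 1; high degrees carry
  -- |z|^{-γ} and give the quotient of Gamma values.
  by_cases hkj : k < j
  · simp only [hkj, if_true] at hil hih ⊢
    rw [rawPairing_zero_left, add_zero, rawPairing_eq_of_circleAverage (kernelPart_smul w k)
      (h := homogPart g k) (fun z => by rw [IsEntire.circleAverage_truncLow, if_pos hkj]) hil,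
      rawPairing_kernelPart_homogPart hn hg hB]
    simp
  · simp only [hkj, if_false] at hil hih ⊢
    have hjk : (j : ℝ) ≤ k := by exact_mod_cast not_lt.mp hkj
    rw [rawPairing_zero_left, zero_add, rawPairing_eq_of_circleAverage (kernelPart_smul w k)
      (h := homogPart g k) (fun z => by rw [hge.circleAverage_truncHigh, if_neg hkj]) hih,
      rawPairing_homogeneous hn (by linarith) (kernelPart_smul w k) (homogPart_smul g k),
      rawPairing_kernelPart_homogPart hn hg hB]

/-! ### Bounded functionals evaluated on kernels -/

section Functional
variable {p α N : ℝ}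

lemma kernelPart_mem (hn : 1 ≤ n) (α : ℝ) (hp : 0 < p) (w : Cn n) (k : ℕ) :
    kernelPart w k ∈ FockSpace n p (α * p) := by
  obtain ⟨C, hC, hF⟩ := exists_fockNorm_le_of_gaussian hn α hp (ρ := 1 / 2) (by norm_num)
  exact (hF (kernelPart w k) (Real.exp (4 * ‖w‖ ^ 2) * (1 / 2) ^ k)
    (differentiable_kernelPart w k) (by positivity) (norm_kernelPart_le w k)).1

lemma kernel_mem (hn : 1 ≤ n) (α : ℝ) (hp : 0 < p) (w : Cn n) :
    kernel w ∈ FockSpace n p (α * p) := by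
  obtain ⟨C, hC, hF⟩ := exists_fockNorm_kernel_le hn α hp
  exact (hF w).1

/-- A linear functional evaluated on the homogeneous parts of the kernel. -/
def kernelCoeff (hn : 1 ≤ n) (hp : 0 < p) (ν : FockSpace n p (α * p) →ₗ[ℂ] ℂ) (w : Cn n) (k : ℕ) : ℂ :=
  ν ⟨kernelPart w k, kernelPart_mem hn α hp w k⟩

lemma kernelCoeff_smul (hn : 1 ≤ n) (hp : 0 < p) (ν : FockSpace n p (α * p) →ₗ[ℂ] ℂ) (l : ℂ)
    (w : Cn n) (k : ℕ) : kernelCoeff hn hp ν (l • w) k = conj l ^ k * kernelCoeff hn hp ν w k := by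
  have : (⟨kernelPart (l • w) k, kernelPart_mem hn α hp (l • w) k⟩ : FockSpace n p (α * p))
      = conj l ^ k • ⟨kernelPart w k, kernelPart_mem hn α hp w k⟩ := by
    ext z
    exact kernelPart_smul_left w k l z
  rw [kernelCoeff, this, map_smul, smul_eq_mul, kernelCoeff]

lemma exists_norm_kernelCoeff_le (hn : 1 ≤ n) (hp : 0 < p) {ν : FockSpace n p (α * p) →ₗ[ℂ] ℂ}
    (hN : 0 ≤ N) (hν : ∀ f, ‖ν f‖ ≤ N * fockNorm f) (w : Cn n) :
    ∃ C : ℝ, ∀ k, ‖kernelCoeff hn hp ν w k‖ ≤ C * (1 / 2) ^ k := by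
  obtain ⟨C, hC, hF⟩ := exists_fockNorm_le_of_gaussian hn α hp (ρ := 1 / 2) (by norm_num)
  refine ⟨N * (C * Real.exp (4 * ‖w‖ ^ 2)), fun k => ?_⟩
  obtain ⟨hm, hb⟩ := hF (kernelPart w k) (Real.exp (4 * ‖w‖ ^ 2) * (1 / 2) ^ k)
    (differentiable_kernelPart w k) (by positivity) (norm_kernelPart_le w k)
  refine (hν _).trans ?_
  calc _ ≤ N * (C * (Real.exp (4 * ‖w‖ ^ 2) * (1 / 2) ^ k)) := by gcongr
    _ = _ := by ring

/-- The remainder of the kernel expansion is O(2⁻ᵐ) in the Fock norm. It is estimated as a single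
function, so the failure of the triangle inequality for p < 1 does no harm. -/
lemma hasSum_kernelCoeff (hn : 1 ≤ n) (hp : 0 < p) {ν : FockSpace n p (α * p) →ₗ[ℂ] ℂ}
    (hN : 0 ≤ N) (hν : ∀ f, ‖ν f‖ ≤ N * fockNorm f) (w : Cn n) :
    HasSum (kernelCoeff hn hp ν w) (ν ⟨kernel w, kernel_mem hn α hp w⟩) := by
  obtain ⟨C0, h0⟩ := exists_norm_kernelCoeff_le hn hp hN hν w
  have hs : Summable (kernelCoeff hn hp ν w) :=
    Summable.of_norm (Summable.of_nonneg_of_le (fun k => norm_nonneg _) h0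
      (summable_geometric_two.mul_left C0))
  rw [hs.hasSum_iff_tendsto_nat, tendsto_iff_norm_sub_tendsto_zero]
  obtain ⟨C, hC, hF⟩ := exists_fockNorm_le_of_gaussian hn α hp (ρ := 1 / 2) (by norm_num)
  have hle : ∀ m : ℕ, ‖∑ k ∈ Finset.range m, kernelCoeff hn hp ν w k
      - ν ⟨kernel w, kernel_mem hn α hp w⟩‖ ≤ N * (C * (2 * Real.exp (4 * ‖w‖ ^ 2))) * (1 / 2) ^ m := by
    intro m
    obtain ⟨hm, hb⟩ := hF (fun z => kernel w z - ∑ k ∈ Finset.range m, kernelPart w k z)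
      (2 * Real.exp (4 * ‖w‖ ^ 2) * (1 / 2) ^ m)
      ((differentiable_kernel w).sub (Differentiable.fun_sum fun k _ => differentiable_kernelPart w k))
      (by positivity) (norm_kernel_sub_sum_le w m)
    have e : (⟨fun z => kernel w z - ∑ k ∈ Finset.range m, kernelPart w k z, hm⟩ :
        FockSpace n p (α * p)) = ⟨kernel w, kernel_mem hn α hp w⟩
          - ∑ k ∈ Finset.range m, ⟨kernelPart w k, kernelPart_mem hn α hp w k⟩ := by
      ext z
      simp
    have h1 := hν ⟨_, hm⟩
    rw [e, map_sub, map_sum, norm_sub_rev, ← e] at h1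
    refine h1.trans ?_
    calc _ ≤ N * (C * (2 * Real.exp (4 * ‖w‖ ^ 2) * (1 / 2) ^ m)) := by gcongr
      _ = _ := by ring
  refine squeeze_zero (fun m => norm_nonneg _) hle ?_
  have := (tendsto_pow_atTop_nhds_zero_of_lt_one (r := (1 / 2 : ℝ)) (by norm_num) (by norm_num)).const_mul
    (N * (C * (2 * Real.exp (4 * ‖w‖ ^ 2))))
  simpa using this

/-- The multiplier inverting the action of the pairing on homogeneous parts. -/
def inverseMultiplier (n : ℕ) (γ : ℝ) (k : ℕ) : ℝ := gammaMultiplier (cutoff n γ) n (n - γ / 2) k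

/-- The growth of the function representing a bounded linear functional. -/
theorem exists_norm_tsum_inverseMultiplier_le (hn : 1 ≤ n) (hp : 0 < p) (α β : ℝ) :
    ∃ C : ℝ, 0 < C ∧ ∀ (ν : FockSpace n p (α * p) →ₗ[ℂ] ℂ) (N : ℝ), 0 ≤ N →
      (∀ f, ‖ν f‖ ≤ N * fockNorm f) → ∀ z : Cn n,
      ‖∑' k, (inverseMultiplier n (α + β) k : ℂ) * conj (kernelCoeff hn hp ν z k)‖
        ≤ C * N * growth β ‖z‖ := by
  set γ := α + β with hγ
  have hn0 : (0 : ℝ) < n := by exact_mod_cast hn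
  obtain ⟨C1, hC1, h1⟩ := exists_fockNorm_kernel_le hn α hp
  obtain ⟨C2, hC2, h2⟩ := exists_hasGrowth_gammaMultiplier (-α) (j := cutoff n γ) (A := n)
    (B := n - γ / 2) (by positivity) (cutoff_add_pos hn γ)
  refine ⟨C2 * C1, by positivity, fun ν N hN hν z => ?_⟩
  obtain ⟨ζ, hζ, hz⟩ := exists_unit_smul hn z
  -- On the line through ζ these are the coefficients of l ↦ conj ν(K_{lζ}); the conjugate makes it
  -- holomorphic in l, and the norm of K_{lζ} gives the exponent -α.
  have hG : HasGrowth (fun k => conj (kernelCoeff hn hp ν ζ k)) (-α) (C1 * N) := by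
    constructor
    · intro r hr
      obtain ⟨C0, h0⟩ := exists_norm_kernelCoeff_le hn hp hN hν ((r : ℂ) • ζ)
      refine Summable.of_nonneg_of_le (fun k => by positivity) (fun k => ?_)
        (summable_geometric_two.mul_left C0)
      refine le_trans (le_of_eq ?_) (h0 k)
      rw [kernelCoeff_smul, norm_mul, norm_pow, RCLike.norm_conj, RCLike.norm_conj,
        Complex.norm_real, Real.norm_of_nonneg hr, mul_comm]
    · intro l
      have h3 := (hasSum_kernelCoeff hn hp hN hν (l • ζ)).tsum_eq
      obtain ⟨hm, hb⟩ := h1 (l • ζ)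
      have h4 : ∑' k, conj (kernelCoeff hn hp ν ζ k) * l ^ k
          = conj (ν ⟨kernel (l • ζ), kernel_mem hn α hp (l • ζ)⟩) := by
        rw [← h3, Complex.conj_tsum]
        congr 1
        funext k
        rw [kernelCoeff_smul, map_mul, map_pow, Complex.conj_conj, mul_comm]
      rw [h4, RCLike.norm_conj]
      rw [norm_smul, hζ, mul_one] at hb
      calc _ ≤ N * (C1 * growth (-α) ‖l‖) := (hν _).trans (by gcongr)
        _ = _ := by ring
  have h5 := (h2 _ _ hG).bound ‖z‖
  -- The multiplier Γ(k+n)/Γ(k+n-γ/2) raises the exponent by γ = α + β, from -α to β.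
  have e : -α - 2 * ((n : ℝ) - γ / 2 - n) = β := by rw [hγ]; ring
  rw [e, Complex.norm_real, norm_norm] at h5
  have e2 : ∀ k, (inverseMultiplier n γ k : ℂ) * conj (kernelCoeff hn hp ν z k)
      = (gammaMultiplier (cutoff n γ) n (n - γ / 2) k : ℂ) * conj (kernelCoeff hn hp ν ζ k) * (‖z‖ : ℂ) ^ k := by
    intro k
    conv_lhs => rw [hz, kernelCoeff_smul, map_mul, map_pow, Complex.conj_conj]
    rw [inverseMultiplier]
    ring
  simp_rw [e2]
  refine h5.trans_eq ?_
  ring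

/-! ### The function representing a functional -/

/-- The quotients (k+A)/(k+B) of consecutive values are bounded for k ≥ j. This crude bound is
enough for the series of the representing function to be entire; its true growth comes from the
multiplier theorem. -/
lemma exists_gammaMultiplier_le {j : ℕ} {A B : ℝ} (hA : 0 < j + A) (hB : 0 < j + B) :
    ∃ C Q : ℝ, 0 < C ∧ 0 < Q ∧ ∀ k, gammaMultiplier j A B k ≤ C * Q ^ k := by
  have hj := gammaMultiplier_pos hA hB j
  have hQ : 1 ≤ 1 + |A - B| / (j + B) := le_add_of_nonneg_right (by positivity)
  refine ⟨1 + gammaMultiplier j A B j, 1 + |A - B| / (j + B), by positivity, by positivity, fun k => ?_⟩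
  rcases lt_or_ge k j with hk | hk
  · have h1 : gammaMultiplier j A B k = 1 := by simp [gammaMultiplier, hk]
    rw [h1]
    exact one_le_mul_of_one_le_of_one_le (by linarith) (one_le_pow₀ hQ)
  · obtain ⟨i, rfl⟩ := Nat.exists_eq_add_of_le hk
    have h2 : ∀ i : ℕ, gammaMultiplier j A B (j + i)
        ≤ gammaMultiplier j A B j * (1 + |A - B| / (j + B)) ^ i := by
      intro i
      induction i with
      | zero => simp
      | succ i ih =>
        have hkA : 0 < ((j + i : ℕ) : ℝ) + A := by push_cast; linarith [Nat.cast_nonneg (α := ℝ) i]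
        have hkB : 0 < ((j + i : ℕ) : ℝ) + B := by push_cast; linarith [Nat.cast_nonneg (α := ℝ) i]
        have hp := gammaMultiplier_pos hA hB (j + i)
        have hstep : gammaMultiplier j A B (j + (i + 1))
            = gammaMultiplier j A B (j + i) * ((((j + i : ℕ) : ℝ) + A) / (((j + i : ℕ) : ℝ) + B)) := by
          unfold gammaMultiplier
          rw [if_neg (by omega), if_neg (by omega), ← add_assoc j i 1, Nat.cast_succ,
            add_right_comm _ 1 A, add_right_comm _ 1 B, Real.Gamma_add_one hkA.ne',
            Real.Gamma_add_one hkB.ne', mul_comm, mul_div_mul_comm, mul_comm]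
          ring
        have hratio : (((j + i : ℕ) : ℝ) + A) / (((j + i : ℕ) : ℝ) + B) ≤ 1 + |A - B| / (j + B) := by
          have h3 : (((j + i : ℕ) : ℝ) + A) / (((j + i : ℕ) : ℝ) + B)
              = 1 + (A - B) / (((j + i : ℕ) : ℝ) + B) := by
            rw [eq_comm, ← eq_sub_iff_add_eq', div_sub_one hkB.ne']
            congr 1; ring
          rw [h3]
          gcongr
          · exact le_abs_self _
          · exact Nat.le_add_right j i
        rw [hstep, pow_succ, ← mul_assoc]
        exact mul_le_mul ih hratio (by positivity) (by positivity)
    calc _ ≤ _ := h2 i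
      _ ≤ (1 + gammaMultiplier j A B j) * (1 + |A - B| / (j + B)) ^ (j + i) := by
        gcongr
        · linarith
        · omega

lemma differentiable_coord_prod {k : ℕ} (s : Fin k → Fin n) :
    Differentiable ℂ fun z : Cn n => ∏ j, z (s j) :=
  fun z => (HasFDerivAt.finsetProd (u := Finset.univ) (g := fun j (z : Cn n) => z (s j))
    fun j _ => (EuclideanSpace.proj (s j) : Cn n →L[ℂ] ℂ).hasFDerivAt (x := z)).differentiableAt

lemma norm_coord_prod_le_gaussian {R : ℝ} (hR : 0 < R) {k : ℕ} (s : Fin k → Fin n) (z : Cn n) :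
    ‖∏ j, z (s j)‖ ≤ (k.factorial / R ^ k * Real.exp (R ^ 2)) * Real.exp (1 / 2 * ‖z‖ ^ 2 / 2) := by
  have h1 := pow_mul_pow_le_factorial_mul_exp k (show 0 ≤ R * ‖z‖ by positivity)
  have h2 : Real.exp (R * ‖z‖) ≤ Real.exp (R ^ 2) * Real.exp (1 / 2 * ‖z‖ ^ 2 / 2) := by
    rw [← Real.exp_add, Real.exp_le_exp]
    nlinarith [sq_nonneg (R - ‖z‖ / 2)]
  refine (norm_prod_coord_le s z).trans ?_
  rw [div_mul_eq_mul_div, div_mul_eq_mul_div, le_div_iff₀ (by positivity), ← mul_pow, mul_comm ‖z‖,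
    mul_assoc]
  exact h1.trans (by gcongr)

lemma coord_prod_mem (hn : 1 ≤ n) (α : ℝ) (hp : 0 < p) {k : ℕ} (s : Fin k → Fin n) :
    (fun z : Cn n => ∏ j, z (s j)) ∈ FockSpace n p (α * p) := by
  obtain ⟨C, hC, hF⟩ := exists_fockNorm_le_of_gaussian hn α hp (ρ := 1 / 2) (by norm_num)
  exact (hF _ _ (differentiable_coord_prod s) (by positivity)
    (norm_coord_prod_le_gaussian one_pos s)).1

lemma kernelCoeff_eq_sum (hn : 1 ≤ n) (hp : 0 < p) (ν : FockSpace n p (α * p) →ₗ[ℂ] ℂ) (w : Cn n)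
    (k : ℕ) : kernelCoeff hn hp ν w k = (k.factorial : ℂ)⁻¹ *
      ∑ s : Fin k → Fin n, conj (∏ j, w (s j)) * ν ⟨_, coord_prod_mem hn α hp s⟩ := by
  have : (⟨kernelPart w k, kernelPart_mem hn α hp w k⟩ : FockSpace n p (α * p))
      = (k.factorial : ℂ)⁻¹ • ∑ s : Fin k → Fin n,
        conj (∏ j, w (s j)) • ⟨_, coord_prod_mem hn α hp s⟩ := by
    ext z
    change kernelPart w k z = _
    rw [kernelPart, inner_pow_eq_sum, div_eq_inv_mul]
    simp
  rw [kernelCoeff, this, map_smul, map_sum, smul_eq_mul]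
  simp_rw [map_smul, smul_eq_mul]

/-- Every bounded functional agrees on homogeneous kernels with the pairing with some
`g ∈ F^∞_β`. -/
theorem exists_representing (hn : 1 ≤ n) (hp : 0 < p) (α β : ℝ)
    {ν : FockSpace n p (α * p) →ₗ[ℂ] ℂ} (hN : 0 ≤ N) (hν : ∀ f, ‖ν f‖ ≤ N * fockNorm f) :
    ∃ g : FockSpaceInf n β, ∀ w k,
      pairing (α + β) (kernelPart w k) (g : Cn n → ℂ) = kernelCoeff hn hp ν w k := by
  have hn0 : (0 : ℝ) < n := by exact_mod_cast hn
  have hcut := cutoff_add_pos hn (α + β)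
  have hcutn : (0 : ℝ) < cutoff n (α + β) + (n : ℝ) := by positivity
  obtain ⟨C1, Q, hC1, hQ, h1⟩ := exists_gammaMultiplier_le hcutn hcut
  -- These moments give the function the homogeneous parts forced by `pairing_kernelPart`.
  let m : (k : ℕ) → (Fin k → Fin n) → ℂ := fun k s =>
    (inverseMultiplier n (α + β) k : ℂ) * conj (ν ⟨_, coord_prod_mem hn α hp s⟩)
  have hm : MomentBound m := by
    intro R hR
    obtain ⟨C, hC, hF⟩ := exists_fockNorm_le_of_gaussian hn α hp (ρ := 1 / 2) (by norm_num)
    -- The monomials are estimated with radius `Q * R` to cancel the factor `Q ^ k` of the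
    -- multiplier.
    refine ⟨C1 * (N * (C * Real.exp ((Q * R) ^ 2))), fun k s => ?_⟩
    have hQR : 0 < Q * R := by positivity
    obtain ⟨hm, hb⟩ := hF _ _ (differentiable_coord_prod s) (by positivity)
      (norm_coord_prod_le_gaussian hQR s)
    have h2 : ‖ν ⟨_, coord_prod_mem hn α hp s⟩‖ ≤
        N * (C * (k.factorial / (Q * R) ^ k * Real.exp ((Q * R) ^ 2))) :=
      (hν _).trans (by gcongr)
    have h3 : ‖(inverseMultiplier n (α + β) k : ℂ)‖ ≤ C1 * Q ^ k := by
      rw [inverseMultiplier, Complex.norm_real,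
        Real.norm_of_nonneg (gammaMultiplier_pos hcutn hcut k).le]
      exact h1 k
    simp only [m]
    rw [norm_mul, RCLike.norm_conj]
    calc _ ≤ (C1 * Q ^ k) * (N * (C * (k.factorial / (Q * R) ^ k * Real.exp ((Q * R) ^ 2)))) * R ^ k := by
          gcongr
      _ = _ := by
        rw [mul_pow]
        field_simp
  have hhom : ∀ k z, homogPart (momentSeries m).sum k z
      = (inverseMultiplier n (α + β) k : ℂ) * conj (kernelCoeff hn hp ν z k) := by
    intro k z
    rw [hm.homogPart_sum, kernelCoeff_eq_sum, map_mul, map_inv₀, map_sum, Complex.conj_natCast,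
      mul_left_comm]
    congr 1
    rw [Finset.mul_sum]
    refine Finset.sum_congr rfl fun s _ => ?_
    simp only [m]
    rw [map_mul, Complex.conj_conj]
    ring
  obtain ⟨C, hC, hb⟩ := exists_norm_tsum_inverseMultiplier_le hn hp α β
  have hgd := hm.isEntire.differentiable
  have hgb : ∀ z, wsize β (momentSeries m).sum z ≤ C * N := by
    intro z
    rw [wsize_le_iff, ← (hm.isEntire.hasSum z).tsum_eq]
    simp_rw [hhom]
    exact hb ν N hN hν z
  refine ⟨⟨_, mem_FockSpaceInf_of_le hgd hgb⟩, fun w k => ?_⟩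
  rw [pairing_kernelPart hn α hgd hgb, hhom, map_mul, Complex.conj_ofReal, Complex.conj_conj,
    ← mul_assoc, ← Complex.ofReal_mul, inverseMultiplier, gammaMultiplier_mul_swap hcut hcutn]
  simp

end Functional

/-! ### Functionals vanishing on homogeneous kernels -/

section Density
variable {p α N : ℝ}

lemma homogPart_eq_coe (hn : 1 ≤ n) (hp : 0 < p) {M : ℝ} {f : Cn n → ℂ} (hf : Differentiable ℂ f)
    (hM : ∀ z, wsize α f z ≤ M) (k : ℕ) :
    homogPart f k = (((k.factorial : ℂ)⁻¹ • ∑ s : Fin k → Fin n,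
      moment f k s • ⟨_, coord_prod_mem hn α hp s⟩ : FockSpace n p (α * p)) : Cn n → ℂ) := by
  funext z
  rw [homogPart_eq_sum_moment hn hf hM]
  simp

lemma homogPart_mem (hn : 1 ≤ n) (hp : 0 < p) {M : ℝ} {f : Cn n → ℂ} (hf : Differentiable ℂ f)
    (hM : ∀ z, wsize α f z ≤ M) (k : ℕ) : homogPart f k ∈ FockSpace n p (α * p) := by
  rw [homogPart_eq_coe hn hp hf hM]
  exact Subtype.coe_prop _

/-- A functional vanishing on the homogeneous kernels vanishes on homogeneous parts. -/
lemma map_homogPart_eq_zero (hn : 1 ≤ n) (hp : 0 < p) {M : ℝ} {f : Cn n → ℂ}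
    (hf : Differentiable ℂ f) (hM : ∀ z, wsize α f z ≤ M) {ν : FockSpace n p (α * p) →ₗ[ℂ] ℂ}
    (h0 : ∀ w k, kernelCoeff hn hp ν w k = 0) (k : ℕ) :
    ν ⟨homogPart f k, homogPart_mem hn hp hf hM k⟩ = 0 := by
  have e : (⟨homogPart f k, homogPart_mem hn hp hf hM k⟩ : FockSpace n p (α * p))
      = (k.factorial : ℂ)⁻¹ • ∑ s : Fin k → Fin n, moment f k s • ⟨_, coord_prod_mem hn α hp s⟩ :=
    Subtype.ext (homogPart_eq_coe hn hp hf hM k)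
  -- The sum over monomials is finite, so ν passes through the integral: ν(f_k) is the integral of
  -- f(u) ν(⟨·, u⟩ᵏ/k!) e^{-|u|²}.
  have h1 : ∫ u, f u * kernelCoeff hn hp ν u k * (Real.exp (-‖u‖ ^ 2) : ℂ) ∂(V n)
      = (k.factorial : ℂ)⁻¹ * ∑ s : Fin k → Fin n,
        moment f k s * ν ⟨_, coord_prod_mem hn α hp s⟩ := by
    simp_rw [moment, ← integral_mul_const]
    rw [← integral_finsetSum _ fun s _ =>
      (integrable_moment hn hf.continuous hM k s).mul_const _, ← integral_const_mul]
    refine integral_congr_ae (ae_of_all _ fun u => ?_)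
    simp only
    rw [kernelCoeff_eq_sum, Finset.mul_sum, Finset.mul_sum, Finset.sum_mul, Finset.mul_sum]
    refine Finset.sum_congr rfl fun s _ => ?_
    ring
  rw [e, map_smul, map_sum, smul_eq_mul]
  simp_rw [map_smul, smul_eq_mul]
  rw [← h1]
  simp [h0]

/-- Since ρ² < ρ, the dilated Gaussian e^{ρ²x²/2} leaves room below e^{ρx²/2} for the power of 1 +
ρx. -/
lemma exists_growth_mul_le (α : ℝ) {ρ : ℝ} (h0 : 0 < ρ) (h1 : ρ < 1) :
    ∃ C : ℝ, 0 < C ∧ ∀ x : ℝ, 0 ≤ x → growth α (ρ * x) ≤ C * Real.exp (ρ * x ^ 2 / 2) := by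
  obtain ⟨C, hC, h⟩ := exists_one_add_rpow_le_exp α (ε := (1 - ρ) / 2) (by linarith)
  refine ⟨C, hC, fun x hx => ?_⟩
  have h2 : Real.exp ((ρ * x) ^ 2 / 2) * Real.exp ((1 - ρ) / 2 * (ρ * x) ^ 2)
      ≤ Real.exp (ρ * x ^ 2 / 2) := by
    rw [← Real.exp_add, Real.exp_le_exp]
    have : ρ * (2 - ρ) ≤ 1 := by nlinarith [sq_nonneg (1 - ρ)]
    have h3 : ρ * x ^ 2 * (ρ * (2 - ρ)) ≤ ρ * x ^ 2 * 1 := by gcongr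
    nlinarith
  calc growth α (ρ * x) ≤ Real.exp ((ρ * x) ^ 2 / 2) * (C * Real.exp ((1 - ρ) / 2 * (ρ * x) ^ 2)) := by
        unfold growth; gcongr; exact h _ (by positivity)
    _ = C * (Real.exp ((ρ * x) ^ 2 / 2) * Real.exp ((1 - ρ) / 2 * (ρ * x) ^ 2)) := by ring
    _ ≤ _ := by gcongr

/-- The Taylor terms at ρz are bounded by the growth of f, and those at rz are smaller by (r/ρ)ᵏ.
The remainders are then geometric multiples of one subcritical Gaussian, hence small in the Fock
norm. -/
lemma norm_dilate_sub_sum_le {f : Cn n → ℂ} (hf : IsEntire f) {M C r ρ : ℝ}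
    (hM : ∀ z, wsize α f z ≤ M) (hr : 0 < r) (hrρ : r < ρ)
    (hC : ∀ x : ℝ, 0 ≤ x → growth α (ρ * x) ≤ C * Real.exp (ρ * x ^ 2 / 2)) (m : ℕ) (z : Cn n) :
    ‖f ((r : ℂ) • z) - ∑ k ∈ Finset.range m, (r : ℂ) ^ k * homogPart f k z‖
      ≤ M * C * (r / ρ) ^ m / (1 - r / ρ) * Real.exp (ρ * ‖z‖ ^ 2 / 2) := by
  have hρ : 0 < ρ := hr.trans hrρ
  have hM0 : 0 ≤ M := (wsize_nonneg _ _ _).trans (hM 0)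
  have hq : r / ρ < 1 := (div_lt_one hρ).mpr hrρ
  have h := dist_le_of_le_geometric_of_tendsto (r / ρ) (M * (C * Real.exp (ρ * ‖z‖ ^ 2 / 2))) hq
    (f := fun m => ∑ k ∈ Finset.range m, homogPart f k z * (r : ℂ) ^ k) (fun k => ?_)
    (hf.hasSum_smul (r : ℂ) z).tendsto_sum_nat m
  · rw [dist_comm, dist_eq_norm] at h
    simp_rw [mul_comm ((r : ℂ) ^ _)]
    refine h.trans_eq ?_
    ring
  · have h2 := norm_homogPart_le hf hM k ((ρ : ℂ) • z)
    rw [homogPart_smul, norm_mul, norm_pow, norm_smul, Complex.norm_real,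
      Real.norm_of_nonneg hρ.le] at h2
    rw [dist_comm, dist_eq_norm, Finset.sum_range_succ, add_sub_cancel_left, norm_mul, norm_pow,
      Complex.norm_real, Real.norm_of_nonneg hr.le]
    have h3 : ρ ^ k * ‖homogPart f k z‖ ≤ M * (C * Real.exp (ρ * ‖z‖ ^ 2 / 2)) :=
      h2.trans (by gcongr; exact hC _ (norm_nonneg z))
    calc _ = ρ ^ k * ‖homogPart f k z‖ * (r / ρ) ^ k := by
          rw [div_pow]; field_simp
      _ ≤ _ := by gcongr

/-- A bounded functional vanishing on homogeneous kernels vanishes on dilates. -/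
lemma map_dilate_eq_zero (hn : 1 ≤ n) (hp : 0 < p) {M : ℝ} {f : Cn n → ℂ}
    (hf : Differentiable ℂ f) (hM : ∀ z, wsize α f z ≤ M) {ν : FockSpace n p (α * p) →ₗ[ℂ] ℂ}
    (hN : 0 ≤ N) (hν : ∀ f, ‖ν f‖ ≤ N * fockNorm f)
    (h0 : ∀ w k, kernelCoeff hn hp ν w k = 0) {r : ℝ} (hr : 0 < r) (hr1 : r < 1) :
    ∃ hm : (fun z => f ((r : ℂ) • z)) ∈ FockSpace n p (α * p), ν ⟨_, hm⟩ = 0 := by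
  have hE := isEntire_of_wsize_le hn hf hM
  have hM0 : 0 ≤ M := (wsize_nonneg _ _ _).trans (hM 0)
  -- Any number strictly between r and 1 would serve.
  set ρ := (1 + r) / 2 with hρ
  have hrρ : r < ρ := by rw [hρ]; linarith
  have hρ1 : ρ < 1 := by rw [hρ]; linarith
  have hρ0 : 0 < ρ := hr.trans hrρ
  have hq : r / ρ < 1 := (div_lt_one hρ0).mpr hrρ
  have hq' : 0 < 1 - r / ρ := sub_pos.mpr hq
  obtain ⟨C, hC, hgr⟩ := exists_growth_mul_le α hρ0 hρ1
  obtain ⟨C', hC', hF⟩ := exists_fockNorm_le_of_gaussian hn α hp hρ1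
  have hd : Differentiable ℂ fun z => f ((r : ℂ) • z) := hf.comp (differentiable_fun_id.const_smul (r : ℂ))
  have hb := norm_dilate_sub_sum_le hE hM hr hrρ hgr
  have hm : (fun z => f ((r : ℂ) • z)) ∈ FockSpace n p (α * p) :=
    (hF _ (M * C / (1 - r / ρ)) hd (by positivity) (fun z => by simpa using hb 0 z)).1
  refine ⟨hm, ?_⟩
  have key : ∀ m : ℕ, ‖ν ⟨_, hm⟩‖ ≤ N * (C' * (M * C / (1 - r / ρ))) * (r / ρ) ^ m := by
    intro m
    obtain ⟨hm', hb'⟩ := hF _ _ (hd.sub (Differentiable.fun_sum (u := Finset.range m) fun k _ =>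
      (differentiable_homogPart f k).const_mul ((r : ℂ) ^ k))) (by positivity) (hb m)
    have e : (⟨_, hm'⟩ : FockSpace n p (α * p)) = ⟨_, hm⟩
        - ∑ k ∈ Finset.range m, (r : ℂ) ^ k • ⟨_, homogPart_mem hn hp hf hM k⟩ := by
      ext z
      simp
    have h1 := hν ⟨_, hm'⟩
    have h2 : ν ⟨_, hm'⟩ = ν ⟨_, hm⟩ := by
      rw [e, map_sub, map_sum, Finset.sum_eq_zero, sub_zero]
      intro k _
      rw [map_smul, map_homogPart_eq_zero hn hp hf hM h0, smul_zero]
    rw [h2] at h1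
    calc _ ≤ N * (C' * (M * C * (r / ρ) ^ m / (1 - r / ρ))) := h1.trans (by gcongr)
      _ = _ := by ring
  have hlim := (tendsto_pow_atTop_nhds_zero_of_lt_one (r := r / ρ) (by positivity) hq).const_mul
    (N * (C' * (M * C / (1 - r / ρ))))
  rw [mul_zero] at hlim
  exact norm_le_zero_iff.mp (ge_of_tendsto' hlim key)

/-- A version of Pratt's lemma. -/
lemma tendsto_integral_zero_of_le {X ι : Type*} [MeasurableSpace X] {μ : Measure X} {l : Filter ι}
    [l.IsCountablyGenerated] {d G : ι → X → ℝ} {H : X → ℝ}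
    (hd0 : ∀ᶠ i in l, ∀ x, 0 ≤ d i x) (hle : ∀ᶠ i in l, ∀ x, d i x ≤ G i x)
    (hd : ∀ᶠ i in l, Integrable (d i) μ) (hG : ∀ᶠ i in l, Integrable (G i) μ)
    (hH0 : ∀ x, 0 ≤ H x) (hH : Integrable H μ)
    (hdlim : ∀ x, Tendsto (fun i => d i x) l (𝓝 0)) (hGlim : ∀ x, Tendsto (fun i => G i x) l (𝓝 (H x)))
    (hint : Tendsto (fun i => ∫ x, G i x ∂μ) l (𝓝 (∫ x, H x ∂μ))) :
    Tendsto (fun i => ∫ x, d i x ∂μ) l (𝓝 0) := by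
  -- The truncation min(G - d, H) is dominated by the fixed function H and tends to it, while d ≤ G
  -- - min(G - d, H).
  have h1 : Tendsto (fun i => ∫ x, min (G i x - d i x) (H x) ∂μ) l (𝓝 (∫ x, H x ∂μ)) := by
    refine tendsto_integral_filter_of_dominated_convergence H ?_ ?_ hH ?_
    · filter_upwards [hd, hG] with i hi hi'
      exact ((hi'.sub hi).inf hH).aestronglyMeasurable
    · filter_upwards [hle] with i hi
      refine ae_of_all _ fun x => ?_
      rw [Real.norm_of_nonneg (le_min (sub_nonneg.mpr (hi x)) (hH0 x))]
      exact min_le_right _ _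
    · refine ae_of_all _ fun x => ?_
      simpa using ((hGlim x).sub (hdlim x)).min (tendsto_const_nhds (x := H x))
  have h2 := hint.sub h1
  rw [sub_self] at h2
  refine tendsto_of_tendsto_of_tendsto_of_le_of_le' tendsto_const_nhds h2 ?_ ?_
  · filter_upwards [hd0] with i hi
    exact integral_nonneg hi
  · filter_upwards [hd, hG] with i hi hi'
    have h3 : Integrable (fun x => min (G i x - d i x) (H x)) μ := (hi'.sub hi).inf hH
    rw [← integral_sub hi' h3]
    refine integral_mono hi (hi'.sub h3) fun x => ?_
    have := min_le_left (G i x - d i x) (H x)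
    simp only
    linarith

/-- Shrinking the point only helps the Gaussian, and the polynomial weight costs at most r^{-|α|}.
This factor tends to 1 as r → 1, so the dominating integrals converge. -/
lemma wsize_dilate_le {f : Cn n → ℂ} {r : ℝ} (hr : 0 < r) (hr1 : r < 1) (z : Cn n) :
    wsize α (fun z => f ((r : ℂ) • z)) z ≤ r ^ (-|α|) * wsize α f ((r : ℂ) • z) := by
  have e : ‖(r : ℂ) • z‖ = r * ‖z‖ := by
    rw [norm_smul, Complex.norm_real, Real.norm_of_nonneg hr.le]
  have hz := norm_nonneg z
  have h1 : Real.exp (-‖z‖ ^ 2 / 2) ≤ Real.exp (-(r * ‖z‖) ^ 2 / 2) := by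
    have : r * ‖z‖ ≤ ‖z‖ := mul_le_of_le_one_left hz hr1.le
    gcongr
  have h2 : (1 + ‖z‖) ^ (-α) ≤ r ^ (-|α|) * (1 + r * ‖z‖) ^ (-α) := by
    rcases le_total 0 α with ha | ha
    · calc (1 + ‖z‖) ^ (-α) ≤ (1 + r * ‖z‖) ^ (-α) :=
            rpow_le_rpow_of_nonpos (by positivity) (by nlinarith) (by linarith)
        _ ≤ _ := le_mul_of_one_le_left (by positivity)
            (one_le_rpow_of_pos_of_le_one_of_nonpos hr hr1.le (by simp))
    · have h3 : r ^ (-|α|) = r⁻¹ ^ (-α) := by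
        rw [abs_of_nonpos ha, neg_neg, inv_rpow hr.le, rpow_neg hr.le, inv_inv]
      rw [h3, ← mul_rpow (by positivity) (by positivity)]
      refine rpow_le_rpow (by positivity) ?_ (by linarith)
      rw [← div_eq_inv_mul, le_div_iff₀ hr]
      nlinarith
  unfold wsize
  rw [e]
  calc _ ≤ ‖f ((r : ℂ) • z)‖ * (Real.exp (-(r * ‖z‖) ^ 2 / 2) * (r ^ (-|α|) * (1 + r * ‖z‖) ^ (-α))) := by
        gcongr
    _ = _ := by ring

/-- Dilates approximate in the Fock norm. -/
lemma tendsto_integral_wsize_dilate_sub (hp : 0 < p) (hp1 : p ≤ 1) {f : Cn n → ℂ}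
    (hf : f ∈ FockSpace n p (α * p)) :
    Tendsto (fun r : ℝ => ∫ z, wsize α (fun z => f ((r : ℂ) • z) - f z) z ^ p ∂(V n))
      (𝓝[<] 1) (𝓝 0) := by
  obtain ⟨hd, hi⟩ := (mem_FockSpace_iff hp).mp hf
  have hc := hd.continuous
  have hev : ∀ᶠ r : ℝ in 𝓝[<] 1, 0 < r ∧ r < 1 := Ioo_mem_nhdsLT one_pos
  have hi' : ∀ r : ℝ, 0 < r → Integrable (fun z => wsize α f ((r : ℂ) • z) ^ p) (V n) := by
    intro r hr
    exact hi.comp_smul (μ := V n) hr.ne'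
  have hG : ∀ r : ℝ, 0 < r → Integrable (fun z =>
      (r ^ (-|α|) * wsize α f ((r : ℂ) • z)) ^ p + wsize α f z ^ p) (V n) := by
    intro r hr
    refine (((hi' r hr).const_mul ((r ^ (-|α|)) ^ p)).congr (ae_of_all _ fun z => ?_)).add hi
    exact (mul_rpow (by positivity) (wsize_nonneg _ _ _)).symm
  have hle : ∀ r : ℝ, 0 < r → r < 1 → ∀ z, wsize α (fun z => f ((r : ℂ) • z) - f z) z ^ p ≤
      (r ^ (-|α|) * wsize α f ((r : ℂ) • z)) ^ p + wsize α f z ^ p := by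
    intro r hr hr1 z
    have h1 : wsize α (fun z => f ((r : ℂ) • z) - f z) z
        ≤ r ^ (-|α|) * wsize α f ((r : ℂ) • z) + wsize α f z := by
      refine le_trans ?_ (add_le_add_left (wsize_dilate_le hr hr1 z) _)
      unfold wsize
      rw [← add_mul]
      gcongr
      exact norm_sub_le _ _
    have h2 := wsize_nonneg α f z
    have h3 := wsize_nonneg α f ((r : ℂ) • z)
    exact (rpow_le_rpow (wsize_nonneg _ _ _) h1 hp.le).trans
      (rpow_add_le_add_rpow (by positivity) h2 hp.le hp1)
  have hcr : ∀ z : Cn n, Tendsto (fun r : ℝ => (r : ℂ) • z) (𝓝[<] 1) (𝓝 z) := by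
    intro z
    have : Continuous fun r : ℝ => (r : ℂ) • z := by fun_prop
    simpa using (this.tendsto 1).mono_left nhdsWithin_le_nhds
  have hr1 : ∀ s : ℝ, Tendsto (fun r : ℝ => r ^ s) (𝓝[<] 1) (𝓝 1) := by
    intro s
    simpa using ((Real.continuousAt_rpow_const 1 s (Or.inl one_ne_zero)).tendsto).mono_left
      nhdsWithin_le_nhds
  -- The dominating function varies with r, but its integral converges by the change of variables
  -- with Jacobian r^{-2n}; plain dominated convergence does not apply.
  refine tendsto_integral_zero_of_le
    (G := fun r z => (r ^ (-|α|) * wsize α f ((r : ℂ) • z)) ^ p + wsize α f z ^ p)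
    (H := fun z => wsize α f z ^ p + wsize α f z ^ p)
    (.of_forall fun r z => rpow_nonneg (wsize_nonneg _ _ _) _)
    (hev.mono fun r hr => hle r hr.1 hr.2) (hev.mono fun r hr => ?_)
    (hev.mono fun r hr => hG r hr.1) (fun z => ?_) (hi.add hi) (fun z => ?_) (fun z => ?_) ?_
  · refine (hG r hr.1).mono' ((continuous_wsize α (by fun_prop)).rpow_const
      fun _ => Or.inr hp.le).aestronglyMeasurable (ae_of_all _ fun z => ?_)
    rw [Real.norm_of_nonneg (rpow_nonneg (wsize_nonneg _ _ _) _)]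
    exact hle r hr.1 hr.2 z
  · have := wsize_nonneg α f z
    positivity
  · have h1 : Tendsto (fun r : ℝ => wsize α (fun z => f ((r : ℂ) • z) - f z) z) (𝓝[<] 1) (𝓝 0) := by
      unfold wsize
      have := (((hc.tendsto z).comp (hcr z)).sub_const (f z)).norm.mul_const
        (Real.exp (-‖z‖ ^ 2 / 2) * (1 + ‖z‖) ^ (-α))
      simpa using! this
    simpa [hp.ne'] using h1.rpow_const (p := p) (Or.inr hp.le)
  · refine Tendsto.add ?_ tendsto_const_nhds
    have h1 := (hr1 (-|α|)).mul (((continuous_wsize α hc).tendsto z).comp (hcr z))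
    rw [one_mul] at h1
    exact h1.rpow_const (Or.inr hp.le)
  · have h1 : ∀ᶠ r : ℝ in 𝓝[<] 1, (r ^ (-|α|)) ^ p * ((r ^ (2 * n))⁻¹ * ∫ z, wsize α f z ^ p ∂(V n))
        + ∫ z, wsize α f z ^ p ∂(V n)
        = ∫ z, ((r ^ (-|α|) * wsize α f ((r : ℂ) • z)) ^ p + wsize α f z ^ p) ∂(V n) := by
      filter_upwards [hev] with r hr
      have h2 := Measure.integral_comp_smul_of_nonneg (V n) (fun z => wsize α f z ^ p) r (hR := hr.1.le)
      rw [finrank_Cn, smul_eq_mul] at h2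
      have h3 := integral_add ((hi' r hr.1).const_mul ((r ^ (-|α|)) ^ p)) hi
      rw [← h2, ← integral_const_mul]
      refine Eq.trans h3.symm ?_
      refine integral_congr_ae (ae_of_all _ fun z => ?_)
      simp only
      rw [mul_rpow (rpow_nonneg hr.1.le _) (wsize_nonneg _ _ _)]
    refine Tendsto.congr' h1 ?_
    rw [integral_add hi hi]
    refine Tendsto.add ?_ tendsto_const_nhds
    have h3 : Tendsto (fun r : ℝ => (r ^ (2 * n))⁻¹) (𝓝[<] 1) (𝓝 1) := by
      have : ContinuousAt (fun r : ℝ => (r ^ (2 * n))⁻¹) 1 :=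
        ContinuousAt.inv₀ (by fun_prop) (by simp)
      simpa using this.tendsto.mono_left nhdsWithin_le_nhds
    have h4 := (hr1 (-|α|)).rpow_const (p := p) (Or.inr hp.le)
    simpa using h4.mul (h3.mul_const (∫ z, wsize α f z ^ p ∂(V n)))

/-- A bounded functional vanishing on homogeneous kernels is zero. -/
theorem eq_zero_of_kernelCoeff (hn : 1 ≤ n) (hp : 0 < p) (hp1 : p ≤ 1)
    {ν : FockSpace n p (α * p) →ₗ[ℂ] ℂ} (hN : 0 ≤ N) (hν : ∀ f, ‖ν f‖ ≤ N * fockNorm f)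
    (h0 : ∀ w k, kernelCoeff hn hp ν w k = 0) : ν = 0 := by
  ext f
  obtain ⟨C, hC, h⟩ := exists_wsize_le_fockNorm hn α hp
  have hlim := (tendsto_integral_wsize_dilate_sub hp hp1 f.2).rpow_const (p := p⁻¹)
    (Or.inr (by positivity)) |>.const_mul N
  rw [zero_rpow (by positivity), mul_zero] at hlim
  rw [LinearMap.zero_apply, ← norm_le_zero_iff]
  refine ge_of_tendsto hlim ?_
  filter_upwards [Ioo_mem_nhdsLT one_pos] with r hr
  obtain ⟨hm, h1⟩ := map_dilate_eq_zero hn hp f.2.1 (h f) hN hν h0 hr.1 hr.2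
  -- Since ν vanishes on the dilate, |ν(f)| is at most N times the Fock norm of the difference,
  -- which tends to 0.
  have h2 := hν (⟨_, hm⟩ - f)
  rw [map_sub, h1, zero_sub, norm_neg, fockNorm_eq hp] at h2
  exact h2

end Density

/-! ### Sesquilinearity of the pairing -/

lemma IsEntire.add {f g : Cn n → ℂ} (hf : IsEntire f) (hg : IsEntire g) : IsEntire (f + g) := by
  obtain ⟨P, hP⟩ := hf
  obtain ⟨Q, hQ⟩ := hg
  exact ⟨P + Q, hP.add hQ⟩

lemma IsEntire.const_smul {f : Cn n → ℂ} (c : ℂ) (hf : IsEntire f) : IsEntire (c • f) := by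
  obtain ⟨P, hP⟩ := hf
  exact ⟨c • P, hP.const_smul⟩

lemma homogPart_add {f g : Cn n → ℂ} (hf : IsEntire f) (hg : IsEntire g) (k : ℕ) (z : Cn n) :
    homogPart (f + g) k z = homogPart f k z + homogPart g k z := by
  refine (hf.add hg).homogPart_eq_of_hasSum (a := fun k => homogPart f k z + homogPart g k z) ?_
    (fun l _ => ?_) k
  · exact Summable.of_nonneg_of_le (fun k => norm_nonneg _) (fun k => norm_add_le _ _)
      ((hf.summable z).add (hg.summable z))
  · exact ((hf.hasSum_smul l z).add (hg.hasSum_smul l z)).congr_fun fun k => add_mul _ _ _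

lemma homogPart_const_smul {f : Cn n → ℂ} (hf : IsEntire f) (c : ℂ) (k : ℕ) (z : Cn n) :
    homogPart (c • f) k z = c * homogPart f k z := by
  refine (hf.const_smul c).homogPart_eq_of_hasSum (a := fun k => c * homogPart f k z) ?_
    (fun l _ => ?_) k
  · simp_rw [norm_mul]
    exact (hf.summable z).mul_left _
  · exact ((hf.hasSum_smul l z).mul_left c).congr_fun fun k => mul_assoc _ _ _

lemma truncLow_add {f g : Cn n → ℂ} (hf : IsEntire f) (hg : IsEntire g) (j : ℕ) :
    truncLow j (f + g) = truncLow j f + truncLow j g := by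
  funext z
  simp [truncLow, homogPart_add hf hg, Finset.sum_add_distrib]

lemma truncHigh_add {f g : Cn n → ℂ} (hf : IsEntire f) (hg : IsEntire g) (j : ℕ) :
    truncHigh j (f + g) = truncHigh j f + truncHigh j g := by
  funext z
  simp only [truncHigh, truncLow_add hf hg, Pi.add_apply]
  ring

lemma truncLow_const_smul {f : Cn n → ℂ} (hf : IsEntire f) (c : ℂ) (j : ℕ) :
    truncLow j (c • f) = c • truncLow j f := by
  funext z
  simp [truncLow, homogPart_const_smul hf, Finset.mul_sum]

lemma truncHigh_const_smul {f : Cn n → ℂ} (hf : IsEntire f) (c : ℂ) (j : ℕ) :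
    truncHigh j (c • f) = c • truncHigh j f := by
  funext z
  simp only [truncHigh, truncLow_const_smul hf, Pi.smul_apply, smul_eq_mul]
  ring

lemma rawPairing_add_left {γ : ℝ} {f₁ f₂ g : Cn n → ℂ}
    (h₁ : Integrable (pairIntegrand f₁ g) (W n γ)) (h₂ : Integrable (pairIntegrand f₂ g) (W n γ)) :
    rawPairing γ (f₁ + f₂) g = rawPairing γ f₁ g + rawPairing γ f₂ g := by
  rw [rawPairing, rawPairing, rawPairing, ← integral_add h₁ h₂]
  congr 1
  funext z
  simp only [pairIntegrand, Pi.add_apply]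
  ring

lemma rawPairing_add_right {γ : ℝ} {f g₁ g₂ : Cn n → ℂ}
    (h₁ : Integrable (pairIntegrand f g₁) (W n γ)) (h₂ : Integrable (pairIntegrand f g₂) (W n γ)) :
    rawPairing γ f (g₁ + g₂) = rawPairing γ f g₁ + rawPairing γ f g₂ := by
  rw [rawPairing, rawPairing, rawPairing, ← integral_add h₁ h₂]
  congr 1
  funext z
  simp only [pairIntegrand, Pi.add_apply, map_add]
  ring

lemma rawPairing_const_smul_left (γ : ℝ) (c : ℂ) (f g : Cn n → ℂ) :
    rawPairing γ (c • f) g = c * rawPairing γ f g := by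
  rw [rawPairing, rawPairing, ← integral_const_mul]
  congr 1
  funext z
  simp only [pairIntegrand, Pi.smul_apply, smul_eq_mul]
  ring

lemma rawPairing_const_smul_right (γ : ℝ) (c : ℂ) (f g : Cn n → ℂ) :
    rawPairing γ f (c • g) = conj c * rawPairing γ f g := by
  rw [rawPairing, rawPairing, ← integral_const_mul]
  congr 1
  funext z
  simp only [pairIntegrand, Pi.smul_apply, smul_eq_mul, map_mul]
  ring

/-! ### The duality map -/

section Duality
variable {p α β : ℝ}

lemma isEntire_of_mem_FockSpace (hn : 1 ≤ n) (hp : 0 < p) (f : FockSpace n p (α * p)) :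
    IsEntire (f : Cn n → ℂ) := by
  obtain ⟨C, hC, h⟩ := exists_wsize_le_fockNorm hn α hp
  exact isEntire_of_wsize_le hn f.2.1 (h f)

lemma isEntire_of_mem_FockSpaceInf (hn : 1 ≤ n) (g : FockSpaceInf n β) :
    IsEntire (g : Cn n → ℂ) :=
  isEntire_of_wsize_le hn g.2.1 (wsize_le_fockNormInf g)

lemma fockNormInf_nonneg (g : FockSpaceInf n β) : 0 ≤ fockNormInf g := ENNReal.toReal_nonneg

lemma integrable_pairIntegrand_trunc (hn : 1 ≤ n) (hp : 0 < p) (hp1 : p ≤ 1)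
    (f : FockSpace n p (α * p)) (g : FockSpaceInf n β) :
    Integrable (pairIntegrand (truncLow (cutoff n (α + β)) (f : Cn n → ℂ))
      (truncLow (cutoff n (α + β)) (g : Cn n → ℂ))) (W n 0) ∧
    Integrable (pairIntegrand (truncHigh (cutoff n (α + β)) (f : Cn n → ℂ))
      (truncHigh (cutoff n (α + β)) (g : Cn n → ℂ))) (W n (α + β)) := by
  obtain ⟨K, hK, h⟩ := exists_norm_pairing_le hn α β
  obtain ⟨C, hC, h1⟩ := exists_wsize_le_fockNorm hn α hp
  obtain ⟨C', hC', h2⟩ := exists_integral_wsize_le_fockNorm hn α hp hp1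
  obtain ⟨ha, hb, -⟩ := h f g _ _ f.2.1 g.2.1 (h1 f) (h2 f).1 (wsize_le_fockNormInf g)
  exact ⟨ha, hb⟩

theorem exists_norm_pairing_le_fockNorm (hn : 1 ≤ n) (hp : 0 < p) (hp1 : p ≤ 1) (α β : ℝ) :
    ∃ C : ℝ, 0 < C ∧ ∀ (f : FockSpace n p (α * p)) (g : FockSpaceInf n β),
      ‖pairing (α + β) (f : Cn n → ℂ) (g : Cn n → ℂ)‖ ≤ C * fockNormInf g * fockNorm f := by
  obtain ⟨K, hK, h⟩ := exists_norm_pairing_le hn α β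
  obtain ⟨C, hC, h1⟩ := exists_wsize_le_fockNorm hn α hp
  obtain ⟨C', hC', h2⟩ := exists_integral_wsize_le_fockNorm hn α hp hp1
  refine ⟨K * (C + C'), by positivity, fun f g => ?_⟩
  obtain ⟨-, -, hb⟩ := h f g _ _ f.2.1 g.2.1 (h1 f) (h2 f).1 (wsize_le_fockNormInf g)
  have hg := fockNormInf_nonneg g
  calc _ ≤ K * fockNormInf g * (C * fockNorm f + C' * fockNorm f) :=
        hb.trans (by gcongr; exact (h2 f).2)
    _ = _ := by ring

/-- The functional `⟨·, g⟩` on `F^p`. -/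
def pairingFunctional (hn : 1 ≤ n) (hp : 0 < p) (hp1 : p ≤ 1) (α : ℝ) (g : FockSpaceInf n β) :
    FockSpace n p (α * p) →ₗ[ℂ] ℂ where
  toFun f := pairing (α + β) (f : Cn n → ℂ) g
  map_add' f₁ f₂ := by
    have e₁ := isEntire_of_mem_FockSpace hn hp f₁
    have e₂ := isEntire_of_mem_FockSpace hn hp f₂
    obtain ⟨a₁, b₁⟩ := integrable_pairIntegrand_trunc hn hp hp1 f₁ g
    obtain ⟨a₂, b₂⟩ := integrable_pairIntegrand_trunc hn hp hp1 f₂ g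
    simp_rw [pairing_eq_cutoff]
    rw [Submodule.coe_add, truncLow_add e₁ e₂, truncHigh_add e₁ e₂, rawPairing_add_left a₁ a₂,
      rawPairing_add_left b₁ b₂]
    ring
  map_smul' c f := by
    have e := isEntire_of_mem_FockSpace hn hp f
    simp_rw [pairing_eq_cutoff]
    rw [Submodule.coe_smul, truncLow_const_smul e, truncHigh_const_smul e,
      rawPairing_const_smul_left, rawPairing_const_smul_left, RingHom.id_apply, smul_eq_mul]
    ring

/-- The map `g ↦ ⟨·, g⟩` from `F^∞` to the dual of `F^p`. -/
def pairingMap (hn : 1 ≤ n) (hp : 0 < p) (hp1 : p ≤ 1) (α β : ℝ) :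
    FockSpaceInf n β →ₛₗ[starRingEnd ℂ] FockDual n p (α * p) where
  toFun g := ⟨pairingFunctional hn hp hp1 α g, by
    obtain ⟨C, hC, h⟩ := exists_norm_pairing_le_fockNorm hn hp hp1 α β
    exact ⟨C * fockNormInf g, fun f => h f g⟩⟩
  map_add' g₁ g₂ := by
    have e₁ := isEntire_of_mem_FockSpaceInf hn g₁
    have e₂ := isEntire_of_mem_FockSpaceInf hn g₂
    ext f
    obtain ⟨a₁, b₁⟩ := integrable_pairIntegrand_trunc hn hp hp1 f g₁
    obtain ⟨a₂, b₂⟩ := integrable_pairIntegrand_trunc hn hp hp1 f g₂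
    change pairing (α + β) (f : Cn n → ℂ) ((g₁ : Cn n → ℂ) + g₂)
      = pairing (α + β) (f : Cn n → ℂ) g₁ + pairing (α + β) (f : Cn n → ℂ) g₂
    simp_rw [pairing_eq_cutoff]
    rw [truncLow_add e₁ e₂, truncHigh_add e₁ e₂, rawPairing_add_right a₁ a₂,
      rawPairing_add_right b₁ b₂]
    ring
  map_smul' c g := by
    have e := isEntire_of_mem_FockSpaceInf hn g
    ext f
    change pairing (α + β) (f : Cn n → ℂ) (c • (g : Cn n → ℂ))
      = conj c * pairing (α + β) (f : Cn n → ℂ) g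
    simp_rw [pairing_eq_cutoff]
    rw [truncLow_const_smul e, truncHigh_const_smul e, rawPairing_const_smul_right,
      rawPairing_const_smul_right]
    ring

lemma pairingMap_apply (hn : 1 ≤ n) (hp : 0 < p) (hp1 : p ≤ 1) (α : ℝ) (g : FockSpaceInf n β)
    (f : FockSpace n p (α * p)) :
    (pairingMap hn hp hp1 α β g).1 f = pairing (α + β) (f : Cn n → ℂ) g := rfl

/-! ### The dual norm -/

lemma fockNorm_zero : fockNorm (0 : FockSpace n p α) = 0 := by
  simpa using fockNorm_smul (0 : ℂ) (0 : FockSpace n p α)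

lemma dualNorm_le {ν : FockDual n p α} {M : ℝ} (h : ∀ f, ‖ν.1 f‖ ≤ M * fockNorm f) (hM : 0 ≤ M) :
    dualNorm ν ≤ M := by
  refine csSup_le ⟨0, 0, by simp [fockNorm_zero], by simp⟩ ?_
  rintro x ⟨f, hf, rfl⟩
  exact (h f).trans (mul_le_of_le_one_right hM hf)

lemma dualNorm_nonneg (ν : FockDual n p α) : 0 ≤ dualNorm ν := by
  refine Real.sSup_nonneg ?_
  rintro x ⟨f, -, rfl⟩
  exact norm_nonneg _

lemma norm_apply_le_dualNorm (ν : FockDual n p α) (f : FockSpace n p α) :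
    ‖ν.1 f‖ ≤ dualNorm ν * fockNorm f := by
  obtain ⟨C, hC⟩ := ν.2
  rcases (fockNorm_nonneg f).eq_or_lt with h0 | h0
  · simpa [← h0] using hC f
  have hbdd : BddAbove {x : ℝ | ∃ f : FockSpace n p α, fockNorm f ≤ 1 ∧ x = ‖ν.1 f‖} := by
    refine ⟨|C|, ?_⟩
    rintro x ⟨g, hg, rfl⟩
    calc _ ≤ C * fockNorm g := hC g
      _ ≤ |C| * 1 := mul_le_mul (le_abs_self C) hg (fockNorm_nonneg g) (abs_nonneg C)
      _ = _ := mul_one _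
  have h1 : ‖ν.1 (((fockNorm f)⁻¹ : ℂ) • f)‖ ≤ dualNorm ν := by
    refine le_csSup hbdd ⟨_, ?_, rfl⟩
    rw [fockNorm_smul, norm_inv, Complex.norm_real, Real.norm_of_nonneg h0.le,
      inv_mul_cancel₀ h0.ne']
  rw [map_smul, norm_smul, norm_inv, Complex.norm_real, Real.norm_of_nonneg h0.le,
    inv_mul_le_iff₀ h0] at h1
  rwa [mul_comm]

/-- The two multipliers are reciprocal, so the Taylor parts of g are recovered from its functional.
Injectivity and the lower norm bound both rest on this. -/
lemma conj_kernelCoeff_pairing (hn : 1 ≤ n) (hp : 0 < p) (hp1 : p ≤ 1) (α : ℝ)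
    (g : FockSpaceInf n β) (w : Cn n) (k : ℕ) :
    (inverseMultiplier n (α + β) k : ℂ) *
      conj (kernelCoeff hn hp (pairingMap hn hp hp1 α β g).1 w k) = homogPart (g : Cn n → ℂ) k w := by
  have hn0 : (0 : ℝ) < n := by exact_mod_cast hn
  have hcut := cutoff_add_pos hn (α + β)
  have hcutn : (0 : ℝ) < cutoff n (α + β) + (n : ℝ) := by positivity
  rw [kernelCoeff, pairingMap_apply, pairing_kernelPart hn α g.2.1 (wsize_le_fockNormInf g),
    map_mul, Complex.conj_ofReal, Complex.conj_conj, ← mul_assoc, ← Complex.ofReal_mul,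
    inverseMultiplier, gammaMultiplier_mul_swap hcutn hcut]
  simp

/-- For the functional of g, the series bounded in `exists_norm_tsum_inverseMultiplier_le` is the
Taylor expansion of g. -/
theorem exists_fockNormInf_le_dualNorm (hn : 1 ≤ n) (hp : 0 < p) (hp1 : p ≤ 1) (α β : ℝ) :
    ∃ C : ℝ, 0 < C ∧ ∀ g : FockSpaceInf n β,
      fockNormInf g ≤ C * dualNorm (pairingMap hn hp hp1 α β g) := by
  obtain ⟨C, hC, h⟩ := exists_norm_tsum_inverseMultiplier_le hn hp α β
  refine ⟨C, hC, fun g => ?_⟩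
  have hN := dualNorm_nonneg (pairingMap hn hp hp1 α β g)
  refine fockNormInf_le (by positivity) g fun z => ?_
  rw [wsize_le_iff, ← ((isEntire_of_mem_FockSpaceInf hn g).hasSum z).tsum_eq]
  have h1 := h (pairingMap hn hp hp1 α β g).1 _ hN (norm_apply_le_dualNorm _) z
  simp_rw [conj_kernelCoeff_pairing] at h1
  exact h1

theorem pairingMap_injective (hn : 1 ≤ n) (hp : 0 < p) (hp1 : p ≤ 1) (α β : ℝ) :
    Function.Injective (pairingMap hn hp hp1 α β) := by
  rw [injective_iff_map_eq_zero]
  intro g hg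
  ext z
  have e := isEntire_of_mem_FockSpaceInf hn g
  rw [← (e.hasSum z).tsum_eq]
  simp_rw [← conj_kernelCoeff_pairing hn hp hp1 α g, hg]
  simp [kernelCoeff]

/-- The candidate of `exists_representing` matches ν on homogeneous kernels, and a bounded
functional is determined by its values there. -/
theorem pairingMap_surjective (hn : 1 ≤ n) (hp : 0 < p) (hp1 : p ≤ 1) (α β : ℝ) :
    Function.Surjective (pairingMap hn hp hp1 α β) := by
  intro ν
  obtain ⟨g, hg⟩ := exists_representing hn hp α β (dualNorm_nonneg ν) (norm_apply_le_dualNorm ν)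
  refine ⟨g, ?_⟩
  rw [← sub_eq_zero]
  refine Subtype.ext (eq_zero_of_kernelCoeff hn hp hp1 (dualNorm_nonneg _)
    (norm_apply_le_dualNorm (pairingMap hn hp hp1 α β g - ν)) fun w k => ?_)
  have := hg w k
  rw [kernelCoeff] at this ⊢
  exact sub_eq_zero.mpr this

end Duality

end FockDuality

end

theorem theorem5p7 (n : ℕ) (hn : 1 ≤ n) (p α β : ℝ) (hp0 : 0 < p) (hp1 : p ≤ 1) :
    (∀ f ∈ FockDuality.FockSpace n p (α * p), ∀ g ∈ FockDuality.FockSpaceInf n β,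
      FockDuality.PairingConverges (α + β) f g) ∧
    ∃ Φ : FockDuality.FockSpaceInf n β ≃ₛₗ[starRingEnd ℂ] FockDuality.FockDual n p (α * p),
      (∀ (g : FockDuality.FockSpaceInf n β) (f : FockDuality.FockSpace n p (α * p)),
        (Φ g).1 f = FockDuality.pairing (α + β) (f : FockDuality.Cn n → ℂ) g) ∧
      ∃ c C : ℝ, 0 < c ∧ 0 < C ∧ ∀ g : FockDuality.FockSpaceInf n β,
        c * FockDuality.fockNormInf g ≤ FockDuality.dualNorm (Φ g) ∧
        FockDuality.dualNorm (Φ g) ≤ C * FockDuality.fockNormInf g := by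
  refine ⟨fun f hf g hg => ?_, LinearEquiv.ofBijective (FockDuality.pairingMap hn hp0 hp1 α β)
    ⟨FockDuality.pairingMap_injective hn hp0 hp1 α β,
      FockDuality.pairingMap_surjective hn hp0 hp1 α β⟩, fun g f => rfl, ?_⟩
  · obtain ⟨h1, h2⟩ := FockDuality.integrable_pairIntegrand_trunc hn hp0 hp1 ⟨f, hf⟩ ⟨g, hg⟩
    exact FockDuality.pairingConverges_of_cutoff h1 h2
  · obtain ⟨C, hC, h⟩ := FockDuality.exists_norm_pairing_le_fockNorm hn hp0 hp1 α β
    obtain ⟨C', hC', h'⟩ := FockDuality.exists_fockNormInf_le_dualNorm hn hp0 hp1 α β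
    refine ⟨C'⁻¹, C, by positivity, hC, fun g => ⟨?_, ?_⟩⟩
    · rw [inv_mul_le_iff₀ hC']
      exact h' g
    · exact FockDuality.dualNorm_le (fun f => h f g)
        (mul_nonneg hC.le (FockDuality.fockNormInf_nonneg g))
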